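/- Let $s\ge 1$ be an integer, let $\{\xi_l\}_{l\in\mathbb Z}$ be i.i.d. real random variables with $E[\xi_1]=0$, and let $\{c_l\}_{l\in\mathbb Z}$ be real numbers. Assume that (reg) $E[|\xi_1|^2]<\infty$; (tail) $\sup_{t\ge 1} t^{\alpha}P(|\xi_1|^s>t)<\infty$ for some $\alpha>1$; (decay) $\sup_{l\in\mathbb Z}|l|^{\sigma}|c_l|<\infty$ for some $\sigma\in(\tfrac12,1]$. Then for every $k\in\mathbb Z$ the series $x_k=\sum_{l=-\infty}^{\infty}c_{k-l}\xi_l$ converges almost surely (that is, $\sum_{l=-M}^{N}c_{k-l}\xi_l$ converges as $M,N\to\infty$ independently), $E[|x_k|^s]<\infty$, and $$\lim_{n\to\infty} n^{-1/p}\sum_{k=1}^{n}\bigl((x_k)^s-E[(x_k)^s]\bigr)=0\quad\text{a.s.}$$ for all $p$ with $$0<p<\begin{cases}\frac{2}{3-2\sigma}, & s=1,\\[2pt] 2\wedge\alpha\wedge\frac{1}{2-2\sigma}, & s=2,\\[2pt] \alpha\wedge\frac{2}{3-2\sigma}, & s>2,\end{cases}$$ where $\frac{1}{2-2\sigma}$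 is read as $+\infty$ when $\sigma=1$. Furthermore, if $\xi_1$ is symmetric (that is, $-\xi_1$ has the same distribution as $\xi_1$) and $s$ is even, then the same limit holds for all $p$ with $0<p<2\wedge\alpha\wedge\frac{1}{2-2\sigma}$ (same convention when $\sigma=1$). -/

import Mathlib

open MeasureTheory ProbabilityTheory Filter Topology

/-- The finite section `∑_{l = -M}^{N} c_{k-l} ξ_l` of a two-sided moving average, `(M, N) = w`. -/
noncomputable def linearPartialSum {Ω : Type*} (c : ℤ → ℝ) (ξ : ℤ → Ω → ℝ) (k : ℤ) (ω : Ω)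
    (w : ℕ × ℕ) : ℝ :=
  ∑ l ∈ Finset.Icc (-(w.1 : ℤ)) (w.2 : ℤ), c (k - l) * ξ l ω

/-- The two-sided linear process `x_k = ∑_{l = -∞}^{∞} c_{k-l} ξ_l`: the limit of the finite
sections as both end points tend to infinity independently.  The series need not converge
absolutely, so this is not `∑'`.  On outcomes where the limit does not exist the value is
arbitrary. -/
noncomputable def linearProcess {Ω : Type*} (c : ℤ → ℝ) (ξ : ℤ → Ω → ℝ) (k : ℤ) (ω : Ω) : ℝ :=
  limUnder atTop (linearPartialSum c ξ k ω)

/-- `n^{-1/p} ∑_{k=1}^{n} (x_k^s - E[x_k^s]) → 0` almost surely. -/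
def PowerMSLLN {Ω : Type*} [MeasurableSpace Ω] (μ : Measure Ω) (x : ℤ → Ω → ℝ) (s : ℕ)
    (p : ℝ) : Prop :=
  ∀ᵐ ω ∂μ, Tendsto
    (fun n : ℕ => (n : ℝ) ^ (-(1 / p)) *
      ∑ k ∈ Finset.Icc 1 n, (x (k : ℤ) ω ^ s - ∫ ω', x (k : ℤ) ω' ^ s ∂μ))
    atTop (𝓝 0)

/-! For a finite section `S = ∑ a_l ξ_l`, the power `S ^ s` is `s!` times the coefficient of `t ^ s`
in `∏ exp (a_l ξ_l t)`. Each factor splits as `φ_l + Y_l + g_l`: the generating series of the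
moments, the linear term `a_l ξ_l t`, and a centred rest of order at least two in `t`. Expanding the
product separates `∏ (φ_l + Y_l)` from terms carrying some `g_m`.

The first product is a combination of square-free monomials in the innovations, which are orthogonal
in `L²`. If `d` is a lower bound for the degrees of its nonconstant monomials, the second moment of
its centred sum over a block of `n` values of `k` is at most a constant times `∑ (∑_l |c_{k-l}
c_{k'-l}|) ^ d` over pairs `k, k'`, and the inner sum decays like `|k - k'| ^ (-(2σ - 1))`, up to an
arbitrarily small loss. The choice `d = 1` leads to `p < 2 / (3 - 2σ)`; if `s` is even and the odd
moments below `s` vanish, the linear term disappears and `d = 2` leads to `p < 1 / (2 - 2σ)`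
(`exists_multilinear_sum_bound`).

In the remainder `g_m` has size `a_m ^ 2`. Squares of the coefficients are summable, so this part
has short memory, but it has only moments of order `r ≤ 2` with `r < α` when `s ≥ 2`. A von
Bahr–Esseen inequality gives block sums of order `n ^ (1/r)` in `L^r`
(`exists_remainder_sum_bound`). It requires the `m`-th increment to be orthogonal to functions of
the earlier ones; since the factors above `m` involve later innovations, this is arranged by
averaging over subsets `A` of the indices (`sum_powerset_decoupling`).

Both bounds are uniform in the finite section (`exists_window_bound`), so they pass to the infinite
series by Fatou. Dyadic chaining turns `L^r` bounds of order `n ^ β` into almost sure convergence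
for every `p` with `β < 1 / p` (`ae_tendsto_rpow_mul_sum`, `powerMSLLN`). -/

/-! ### Elementary inequalities for powers of absolute values. -/

section RpowInequalities

/-- Compare `1 + u` with `exp u`, then use `exp x ≤ 1 + x + x ^ 2` for `|x| ≤ 1`. -/
theorem abs_one_add_rpow_le_of_small {q u : ℝ} (hq : 1 ≤ q) (hu : q * |u| ≤ 1) :
    |1 + u| ^ q ≤ 1 + q * u + (q * |u|) ^ 2 := by
  have hq0 : 0 < q := by linarith
  have hu1 : |u| ≤ 1 := by nlinarith [abs_nonneg u]
  have h1 : 0 ≤ 1 + u := by linarith [(abs_le.1 hu1).1]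
  rw [abs_of_nonneg h1]
  have h2 : (1 + u) ^ q ≤ Real.exp (q * u) := by
    calc (1 + u) ^ q ≤ (Real.exp u) ^ q :=
          Real.rpow_le_rpow h1 (by linarith [Real.add_one_le_exp u]) hq0.le
      _ = Real.exp (q * u) := by rw [← Real.exp_mul, mul_comm]
  have h3 : |q * u| ≤ 1 := by rwa [abs_mul, abs_of_pos hq0]
  have h4 := (abs_le.1 (Real.abs_exp_sub_one_sub_id_le h3)).2
  have h5 : (q * |u|) ^ 2 = (q * u) ^ 2 := by rw [mul_pow, mul_pow, sq_abs]
  linarith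

theorem abs_one_add_rpow_le_of_large {q u : ℝ} (hq : 1 ≤ q) (hu : 1 ≤ q * |u|) :
    |1 + u| ^ q ≤ (q + 1) ^ q * |u| ^ q := by
  rw [← Real.mul_rpow (by linarith) (abs_nonneg u)]
  refine Real.rpow_le_rpow (abs_nonneg _) ?_ (by linarith)
  calc |1 + u| ≤ |1| + |u| := abs_add_le 1 u
    _ ≤ (q + 1) * |u| := by rw [abs_one]; linarith

theorem rpow_mul_abs_le {r u : ℝ} (hr : 1 ≤ r) (hr2 : r ≤ 2) :
    (r * |u|) ^ r ≤ r ^ 2 * |u| ^ r := by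
  rw [Real.mul_rpow (by linarith) (abs_nonneg u)]
  refine mul_le_mul_of_nonneg_right ?_ (Real.rpow_nonneg (abs_nonneg _) _)
  calc r ^ r ≤ r ^ (2 : ℝ) := Real.rpow_le_rpow_of_exponent_le hr hr2
    _ = r ^ 2 := Real.rpow_two r

theorem abs_one_add_rpow_le_of_le_two {r u : ℝ} (hr : 1 ≤ r) (hr2 : r ≤ 2) :
    |1 + u| ^ r ≤ 1 + r * u + ((r + 1) ^ r + r ^ 2) * |u| ^ r := by
  have hP : 0 ≤ (r + 1) ^ r * |u| ^ r := by positivity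
  have hM := rpow_mul_abs_le (u := u) hr hr2
  have h0 : 0 ≤ r * |u| := by positivity
  rcases le_total (r * |u|) 1 with h | h
  · have h1 := abs_one_add_rpow_le_of_small hr h
    have h2 : (r * |u|) ^ 2 ≤ (r * |u|) ^ r := by
      rw [← Real.rpow_two]
      exact Real.rpow_le_rpow_of_exponent_ge_of_imp h0 h hr2 (by intro _ h'; linarith)
    linarith
  · have h1 := abs_one_add_rpow_le_of_large hr h
    have h2 : r * |u| ≤ (r * |u|) ^ r := Real.self_le_rpow_of_one_le h hr
    -- The linear term may be negative; the part `r ^ 2` of the constant pays for it.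
    have h3 : -(r * |u|) ≤ r * u := by
      have := neg_abs_le u
      nlinarith
    linarith

theorem abs_one_add_rpow_le_of_two_le {q u : ℝ} (hq : 2 ≤ q) :
    |1 + u| ^ q ≤ 1 + q * u + ((q + 1) ^ q + q ^ 2) * (u ^ 2 + |u| ^ q) := by
  have hq1 : 1 ≤ q := by linarith
  have hP : 0 ≤ (q + 1) ^ q * |u| ^ q := by positivity
  have hP2 : 0 ≤ q ^ 2 * |u| ^ q := by positivity
  have hP3 : 0 ≤ (q + 1) ^ q * u ^ 2 := by positivity
  have h5 : (q * |u|) ^ 2 = q ^ 2 * u ^ 2 := by rw [mul_pow, sq_abs]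
  rcases le_total (q * |u|) 1 with h | h
  · have h1 := abs_one_add_rpow_le_of_small hq1 h
    linarith
  · have h1 := abs_one_add_rpow_le_of_large hq1 h
    have h2 : q * |u| ≤ (q * |u|) ^ 2 := by nlinarith
    have h3 : -(q * |u|) ≤ q * u := by
      have := neg_abs_le u
      nlinarith
    linarith

theorem abs_rpow_sub_two_mul_sq {a q : ℝ} (ha : a ≠ 0) : |a| ^ (q - 2) * a ^ 2 = |a| ^ q := by
  rw [← sq_abs a, ← Real.rpow_two, ← Real.rpow_add (abs_pos.2 ha)]
  congr 1; ring

theorem abs_abs_rpow_mul_self {a r : ℝ} (hr : 1 < r) : |(|a| ^ (r - 2) * a)| = |a| ^ (r - 1) := by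
  rcases eq_or_ne a 0 with rfl | ha
  · simp [Real.zero_rpow (show r - 1 ≠ 0 by linarith)]
  · rw [abs_mul, abs_of_nonneg (Real.rpow_nonneg (abs_nonneg a) _)]
    nth_rewrite 2 [← Real.rpow_one |a|]
    rw [← Real.rpow_add (abs_pos.2 ha)]
    congr 1; ring

/-- By homogeneity this is the bound for `1 + b / a`. The linear term is kept exactly because it is
the one that integrates to zero. -/
theorem abs_add_rpow_le_of_le_two {r : ℝ} (hr : 1 ≤ r) (hr2 : r ≤ 2) (a b : ℝ) :
    |a + b| ^ r ≤ |a| ^ r + r * (b * (|a| ^ (r - 2) * a)) + ((r + 1) ^ r + r ^ 2) * |b| ^ r := by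
  rcases eq_or_ne a 0 with rfl | ha
  · have h1 : 1 ≤ (r + 1) ^ r := Real.one_le_rpow (by linarith) (by linarith)
    have h2 : 0 ≤ |b| ^ r := by positivity
    have h3 : (0 : ℝ) ≤ |0| ^ r := by positivity
    simp only [zero_add, mul_zero, add_zero]
    nlinarith [sq_nonneg r]
  · have h := abs_one_add_rpow_le_of_le_two (u := b / a) hr hr2
    have e1 : a + b = a * (1 + b / a) := by field_simp
    have hb : |a| ^ r * |b / a| ^ r = |b| ^ r := by
      rw [← Real.mul_rpow (abs_nonneg _) (abs_nonneg _), ← abs_mul]; congr 2; field_simp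
    have hu : |a| ^ r * (b / a) = b * (|a| ^ (r - 2) * a) := by
      rw [← abs_rpow_sub_two_mul_sq ha]; field_simp
    have ha0 : 0 ≤ |a| ^ r := by positivity
    calc |a + b| ^ r = |a| ^ r * |1 + b / a| ^ r := by
          rw [e1, abs_mul, Real.mul_rpow (abs_nonneg _) (abs_nonneg _)]
      _ ≤ |a| ^ r * (1 + r * (b / a) + ((r + 1) ^ r + r ^ 2) * |b / a| ^ r) :=
          mul_le_mul_of_nonneg_left h ha0
      _ = |a| ^ r + r * (|a| ^ r * (b / a)) + ((r + 1) ^ r + r ^ 2) * (|a| ^ r * |b / a| ^ r) := by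
          ring
      _ = _ := by rw [hb, hu]

theorem abs_add_rpow_le_of_two_le {q : ℝ} (hq : 2 ≤ q) (a b : ℝ) :
    |a + b| ^ q ≤ |a| ^ q + q * (b * (|a| ^ (q - 2) * a)) +
      ((q + 1) ^ q + q ^ 2) * (|a| ^ (q - 2) * b ^ 2 + |b| ^ q) := by
  rcases eq_or_ne a 0 with rfl | ha
  · have h1 : 1 ≤ (q + 1) ^ q := Real.one_le_rpow (by linarith) (by linarith)
    have h2 : 0 ≤ |b| ^ q := by positivity
    have h3 : (0 : ℝ) ≤ |0| ^ q := by positivity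
    -- At `q = 2` the power `|0| ^ (q - 2)` equals `1`, so only the sign of this term is used.
    have h4 : (0 : ℝ) ≤ |0| ^ (q - 2) * b ^ 2 := by positivity
    simp only [zero_add, mul_zero, add_zero]
    nlinarith [sq_nonneg q]
  · have h := abs_one_add_rpow_le_of_two_le (u := b / a) hq
    have e1 : a + b = a * (1 + b / a) := by field_simp
    have hb : |a| ^ q * |b / a| ^ q = |b| ^ q := by
      rw [← Real.mul_rpow (abs_nonneg _) (abs_nonneg _), ← abs_mul]; congr 2; field_simp
    have hu : |a| ^ q * (b / a) = b * (|a| ^ (q - 2) * a) := by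
      rw [← abs_rpow_sub_two_mul_sq ha]; field_simp
    have hv : |a| ^ q * (b / a) ^ 2 = |a| ^ (q - 2) * b ^ 2 := by
      rw [← abs_rpow_sub_two_mul_sq ha]; field_simp
    have ha0 : 0 ≤ |a| ^ q := by positivity
    calc |a + b| ^ q = |a| ^ q * |1 + b / a| ^ q := by
          rw [e1, abs_mul, Real.mul_rpow (abs_nonneg _) (abs_nonneg _)]
      _ ≤ |a| ^ q * (1 + q * (b / a) + ((q + 1) ^ q + q ^ 2) * ((b / a) ^ 2 + |b / a| ^ q)) :=
          mul_le_mul_of_nonneg_left h ha0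
      _ = |a| ^ q + q * (|a| ^ q * (b / a)) +
            ((q + 1) ^ q + q ^ 2) * (|a| ^ q * (b / a) ^ 2 + |a| ^ q * |b / a| ^ q) := by
          ring
      _ = _ := by rw [hb, hu, hv]

/-- A weak form of Young's inequality. -/
theorem mul_rpow_le_add_rpow {x y p q : ℝ} (hx : 0 ≤ x) (hy : 0 ≤ y) (hp : 0 ≤ p) (hq : 0 ≤ q) : x ^ p * y ^ q ≤ x ^ (p + q) + y ^ (p + q) := by
  rcases le_total x y with h | h
  · calc x ^ p * y ^ q ≤ y ^ p * y ^ q := by gcongr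
      _ = y ^ (p + q) := (Real.rpow_add_of_nonneg hy hp hq).symm
      _ ≤ _ := le_add_of_nonneg_left (by positivity)
  · calc x ^ p * y ^ q ≤ x ^ p * x ^ q := by gcongr
      _ = x ^ (p + q) := (Real.rpow_add_of_nonneg hx hp hq).symm
      _ ≤ _ := le_add_of_nonneg_right (by positivity)

theorem rpow_le_one_add_rpow {x p q : ℝ} (hx : 0 ≤ x) (hp : 0 ≤ p) (hpq : p ≤ q) :
    x ^ p ≤ 1 + x ^ q := by
  rcases le_total x 1 with h | h
  · exact (Real.rpow_le_one hx h hp).trans (le_add_of_nonneg_right (by positivity))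
  · exact (Real.rpow_le_rpow_of_exponent_le h hpq).trans (le_add_of_nonneg_left zero_le_one)

end RpowInequalities

/-! ### Moments of order `r` and the effect of one orthogonal increment. -/

section MomentSteps

variable {Ω : Type*} [MeasurableSpace Ω] {μ : Measure Ω} {f g : Ω → ℝ}

theorem memLp_ofReal_iff {q : ℝ} (hq : 0 < q) (hf : AEStronglyMeasurable f μ) :
    MemLp f (ENNReal.ofReal q) μ ↔ Integrable (fun ω => |f ω| ^ q) μ := by
  rw [← integrable_norm_rpow_iff hf (by simpa using hq) ENNReal.ofReal_ne_top,
    ENNReal.toReal_ofReal hq.le]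
  rfl

theorem MeasureTheory.MemLp.integrable_abs_rpow {q : ℝ} (hq : 0 < q)
    (hf : MemLp f (ENNReal.ofReal q) μ) : Integrable (fun ω => |f ω| ^ q) μ :=
  (memLp_ofReal_iff hq hf.1).1 hf

theorem lpNorm_rpow_eq_integral {q : ℝ} (hq : 0 < q) (hf : AEStronglyMeasurable f μ) :
    lpNorm f (ENNReal.ofReal q) μ ^ q = ∫ ω, |f ω| ^ q ∂μ := by
  rw [lpNorm_eq_integral_norm_rpow_toReal (by simpa using hq) ENNReal.ofReal_ne_top hf,
    ENNReal.toReal_ofReal hq.le, Real.rpow_inv_rpow _ hq.ne']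
  · rfl
  · exact integral_nonneg fun ω => Real.rpow_nonneg (norm_nonneg _) _

theorem integral_abs_add_rpow_le {r : ℝ} (hr : 1 < r) (hr2 : r ≤ 2)
    (hf : MemLp f (ENNReal.ofReal r) μ) (hg : MemLp g (ENNReal.ofReal r) μ)
    (horth : ∫ ω, g ω * (|f ω| ^ (r - 2) * f ω) ∂μ = 0) :
    ∫ ω, |f ω + g ω| ^ r ∂μ ≤
      ∫ ω, |f ω| ^ r ∂μ + ((r + 1) ^ r + r ^ 2) * ∫ ω, |g ω| ^ r ∂μ := by
  have hr0 : 0 < r := by linarith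
  have hfi := hf.integrable_abs_rpow hr0
  have hgi := hg.integrable_abs_rpow hr0
  have hfg : Integrable (fun ω => g ω * (|f ω| ^ (r - 2) * f ω)) μ := by
    refine (hgi.add hfi).mono' ?_ (ae_of_all _ fun ω => ?_)
    · have h1 := hf.1.aemeasurable
      have h2 := hg.1.aemeasurable
      exact AEMeasurable.aestronglyMeasurable (by fun_prop)
    · rw [Real.norm_eq_abs, abs_mul, abs_abs_rpow_mul_self hr]
      have := mul_rpow_le_add_rpow (abs_nonneg (g ω)) (abs_nonneg (f ω)) zero_le_one
        (show 0 ≤ r - 1 by linarith)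
      simpa using this
  calc ∫ ω, |f ω + g ω| ^ r ∂μ
      ≤ ∫ ω, (|f ω| ^ r + r * (g ω * (|f ω| ^ (r - 2) * f ω)) +
          ((r + 1) ^ r + r ^ 2) * |g ω| ^ r) ∂μ := by
        refine integral_mono (hf.add hg |>.integrable_abs_rpow hr0) ?_
          fun ω => abs_add_rpow_le_of_le_two hr.le hr2 _ _
        exact (hfi.add (hfg.const_mul _)).add (hgi.const_mul _)
    _ = _ := by
        have hi : Integrable (fun ω => |f ω| ^ r + r * (g ω * (|f ω| ^ (r - 2) * f ω))) μ :=
          hfi.add (hfg.const_mul _)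
        rw [integral_add hi (hgi.const_mul _), integral_add hfi (hfg.const_mul _),
          integral_const_mul, integral_const_mul, horth]
        ring

end MomentSteps

/-! ### Independence read off from disjoint index sets. -/

section CoordinateAlgebra

variable {Ω : Type*} {ξ : ℤ → Ω → ℝ}

/-- The `σ`-algebra generated by the random variables `ξ i`, `i ∈ S`. -/
def coordAlg (ξ : ℤ → Ω → ℝ) (S : Set ℤ) : MeasurableSpace Ω :=
  ⨆ i ∈ S, MeasurableSpace.comap (ξ i) inferInstance

theorem coordAlg_mono {S T : Set ℤ} (h : S ⊆ T) : coordAlg ξ S ≤ coordAlg ξ T :=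
  biSup_mono h

theorem measurable_coordAlg_self {S : Set ℤ} {i : ℤ} (hi : i ∈ S) :
    Measurable[coordAlg ξ S] (ξ i) := by
  have h : MeasurableSpace.comap (ξ i) inferInstance ≤ coordAlg ξ S :=
    le_biSup (fun i => MeasurableSpace.comap (ξ i) inferInstance) hi
  exact (comap_measurable (ξ i)).mono h le_rfl

theorem Measurable.coordAlg_mono {S T : Set ℤ} {f : Ω → ℝ} (hf : Measurable[coordAlg ξ S] f)
    (h : S ⊆ T) : Measurable[coordAlg ξ T] f :=
  hf.mono (_root_.coordAlg_mono h) le_rfl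

variable [mΩ : MeasurableSpace Ω] {μ : Measure Ω}

theorem coordAlg_le (hmeas : ∀ l, Measurable (ξ l)) (S : Set ℤ) : coordAlg ξ S ≤ mΩ :=
  iSup₂_le fun i _ => (hmeas i).comap_le

theorem Measurable.of_coordAlg {S : Set ℤ} {f : Ω → ℝ} (hf : Measurable[coordAlg ξ S] f)
    (hmeas : ∀ l, Measurable (ξ l)) : Measurable f :=
  hf.mono (coordAlg_le hmeas S) le_rfl

theorem indepFun_of_coordAlg (hmeas : ∀ l, Measurable (ξ l)) (hindep : iIndepFun ξ μ)
    {S T : Set ℤ} (hST : Disjoint S T) {f g : Ω → ℝ} (hf : Measurable[coordAlg ξ S] f)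
    (hg : Measurable[coordAlg ξ T] g) : IndepFun f g μ := by
  have h : Indep (coordAlg ξ S) (coordAlg ξ T) μ :=
    indep_iSup_of_disjoint (fun i => (hmeas i).comap_le) hindep hST
  rw [IndepFun_iff_Indep]
  exact indep_of_indep_of_le_left (indep_of_indep_of_le_right h hg.comap_le) hf.comap_le

end CoordinateAlgebra

/-! ### Products of independent variables in `L^q`. -/

section IndepMoments

variable {Ω : Type*} [mΩ : MeasurableSpace Ω] {μ : Measure Ω} {f g : Ω → ℝ}

theorem ProbabilityTheory.IndepFun.abs_rpow {q : ℝ} (h : IndepFun f g μ) :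
    IndepFun (fun ω => |f ω| ^ q) (fun ω => |g ω| ^ q) μ :=
  h.comp (φ := fun x : ℝ => |x| ^ q) (ψ := fun x : ℝ => |x| ^ q) (by fun_prop) (by fun_prop)

/-- Independence keeps the exponent `q`, where Hölder's inequality would lose moments that are not
available. -/
theorem ProbabilityTheory.IndepFun.memLp_mul {q : ℝ} (hq : 0 < q) (h : IndepFun f g μ)
    (hf : MemLp f (ENNReal.ofReal q) μ) (hg : MemLp g (ENNReal.ofReal q) μ) :
    MemLp (fun ω => f ω * g ω) (ENNReal.ofReal q) μ := by
  have hfg : AEStronglyMeasurable (fun ω => f ω * g ω) μ := hf.1.mul hg.1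
  rw [memLp_ofReal_iff hq hfg]
  have := h.abs_rpow.integrable_mul (hf.integrable_abs_rpow hq) (hg.integrable_abs_rpow hq)
  refine this.congr (ae_of_all _ fun ω => ?_)
  simp [abs_mul, Real.mul_rpow]

theorem ProbabilityTheory.IndepFun.lpNorm_mul {q : ℝ} (hq : 0 < q) (h : IndepFun f g μ)
    (hf : AEStronglyMeasurable f μ) (hg : AEStronglyMeasurable g μ) :
    lpNorm (fun ω => f ω * g ω) (ENNReal.ofReal q) μ =
      lpNorm f (ENNReal.ofReal q) μ * lpNorm g (ENNReal.ofReal q) μ := by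
  have hfg : AEStronglyMeasurable (fun ω => f ω * g ω) μ := hf.mul hg
  rw [← Real.rpow_left_inj lpNorm_nonneg (mul_nonneg lpNorm_nonneg lpNorm_nonneg) hq.ne',
    Real.mul_rpow lpNorm_nonneg lpNorm_nonneg, lpNorm_rpow_eq_integral hq hf,
    lpNorm_rpow_eq_integral hq hg, lpNorm_rpow_eq_integral hq hfg]
  have := (h.abs_rpow (q := q)).integral_fun_mul_eq_mul_integral
    (hf.aemeasurable.abs.pow_const q).aestronglyMeasurable
    (hg.aemeasurable.abs.pow_const q).aestronglyMeasurable
  rw [← this]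
  simp [abs_mul, Real.mul_rpow]

end IndepMoments

/-! ### The von Bahr–Esseen inequality. -/

section VonBahrEsseen

variable {Ω : Type*} [mΩ : MeasurableSpace Ω] {μ : Measure Ω}

/-- A von Bahr–Esseen inequality for sums ordered along a linear order. -/
theorem integral_abs_sum_rpow_le {ι : Type*} [LinearOrder ι] {r : ℝ} (hr : 1 < r) (hr2 : r ≤ 2)
    (T : Finset ι) (D : ι → Ω → ℝ) (hD : ∀ m ∈ T, MemLp (D m) (ENNReal.ofReal r) μ)
    (horth : ∀ m ∈ T, ∀ f : Ω → ℝ, f = (fun ω => ∑ i ∈ T with i < m, D i ω) →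
      ∫ ω, D m ω * (|f ω| ^ (r - 2) * f ω) ∂μ = 0) :
    ∫ ω, |∑ m ∈ T, D m ω| ^ r ∂μ ≤ ((r + 1) ^ r + r ^ 2) * ∑ m ∈ T, ∫ ω, |D m ω| ^ r ∂μ := by
  induction T using Finset.induction_on_max with
  | empty =>
    have : (0 : ℝ) ^ r = 0 := Real.zero_rpow (by linarith)
    simp [this]
  | insert m T hm ih =>
    have hmT : m ∉ T := fun h => lt_irrefl _ (hm m h)
    have hT : (insert m T).filter (· < m) = T := by
      ext i
      simp only [Finset.mem_filter, Finset.mem_insert]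
      constructor
      · rintro ⟨rfl | h, h'⟩
        · exact absurd h' (lt_irrefl _)
        · exact h
      · exact fun h => ⟨Or.inr h, hm i h⟩
    have h1 := ih (fun i hi => hD i (Finset.mem_insert_of_mem hi)) (by
      intro i hi f hf
      refine horth i (Finset.mem_insert_of_mem hi) f ?_
      rw [hf]
      have : (insert m T).filter (· < i) = T.filter (· < i) := by
        rw [Finset.filter_insert, if_neg (not_lt.2 (hm i hi).le)]
      rw [this])
    have hS : MemLp (fun ω => ∑ i ∈ T, D i ω) (ENNReal.ofReal r) μ :=
      memLp_finsetSum T fun i hi => hD i (Finset.mem_insert_of_mem hi)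
    -- Only orthogonality to this one function of the preceding sum is needed, so the increments
    -- need not form a martingale difference sequence.
    have h2 := integral_abs_add_rpow_le hr hr2 hS (hD m (Finset.mem_insert_self m T))
      (horth m (Finset.mem_insert_self m T) _ (by rw [hT]))
    simp only [Finset.sum_insert hmT]
    calc ∫ ω, |D m ω + ∑ i ∈ T, D i ω| ^ r ∂μ
        = ∫ ω, |∑ i ∈ T, D i ω + D m ω| ^ r ∂μ := by simp only [add_comm]
      _ ≤ _ := by linarith

end VonBahrEsseen

/-! ### Innovations and moment bounds for their linear combinations. -/

theorem measurable_coordAlg_linear {Ω : Type*} (ξ : ℤ → Ω → ℝ) (a : ℤ → ℝ) (Λ : Finset ℤ) {S : Set ℤ}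
    (hS : ∀ l ∈ Λ, l ∈ S) : Measurable[coordAlg ξ S] (fun ω => ∑ l ∈ Λ, a l * ξ l ω) := by
  refine Finset.measurable_fun_sum Λ fun l hl => ?_
  exact (measurable_coordAlg_self (hS l hl)).const_mul (a l)

/-- Independent identically distributed centred random variables with a finite moment of order
`s * r`, where `1 < r ≤ 2 ≤ s * r`. -/
structure Innovations {Ω : Type*} [MeasurableSpace Ω] (μ : Measure Ω) (ξ : ℤ → Ω → ℝ) (s : ℕ)
    (r : ℝ) : Prop where
  meas : ∀ l, Measurable (ξ l)
  indep : iIndepFun ξ μ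
  ident : ∀ l, IdentDistrib (ξ l) (ξ 1) μ μ
  mean : ∫ ω, ξ 1 ω ∂μ = 0
  one_lt : 1 < r
  le_two : r ≤ 2
  two_le : 2 ≤ s * r
  memLp_one : MemLp (ξ 1) (ENNReal.ofReal (s * r)) μ

namespace Innovations

variable {Ω : Type*} [MeasurableSpace Ω] {μ : Measure Ω}
  {ξ : ℤ → Ω → ℝ} {s : ℕ} {r : ℝ}

theorem r_pos (h : Innovations μ ξ s r) : 0 < r := by linarith [h.one_lt]

theorem q_pos (h : Innovations μ ξ s r) : 0 < s * r := by linarith [h.two_le]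

theorem one_le_s (h : Innovations μ ξ s r) : 1 ≤ s := by
  rcases Nat.eq_zero_or_pos s with h0 | h0
  · have := h.two_le
    rw [h0] at this
    norm_num at this
  · exact h0

theorem memLp (h : Innovations μ ξ s r) (l : ℤ) : MemLp (ξ l) (ENNReal.ofReal (s * r)) μ :=
  (h.ident l).symm.memLp_snd h.memLp_one

theorem integral_comp (h : Innovations μ ξ s r) {g : ℝ → ℝ} (hg : Measurable g) (l : ℤ) :
    ∫ ω, g (ξ l ω) ∂μ = ∫ ω, g (ξ 1 ω) ∂μ :=
  ((h.ident l).comp hg).integral_eq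

theorem integral_eq_zero (h : Innovations μ ξ s r) (l : ℤ) : ∫ ω, ξ l ω ∂μ = 0 :=
  (h.integral_comp measurable_id l).trans h.mean

theorem memLp_linear (h : Innovations μ ξ s r) (a : ℤ → ℝ) (Λ : Finset ℤ) :
    MemLp (fun ω => ∑ l ∈ Λ, a l * ξ l ω) (ENNReal.ofReal (s * r)) μ :=
  memLp_finsetSum Λ fun l _ => (h.memLp l).const_mul (a l)

variable [IsProbabilityMeasure μ]

theorem memLp_of_le (h : Innovations μ ξ s r) {p : ℝ} (hp : p ≤ s * r) (l : ℤ) :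
    MemLp (ξ l) (ENNReal.ofReal p) μ :=
  (h.memLp l).mono_exponent (ENNReal.ofReal_le_ofReal hp)

theorem memLp_two (h : Innovations μ ξ s r) (l : ℤ) : MemLp (ξ l) 2 μ := by
  have := h.memLp_of_le h.two_le l
  simpa using this

theorem integrable (h : Innovations μ ξ s r) (l : ℤ) : Integrable (ξ l) μ :=
  (h.memLp_two l).integrable (by norm_num)

/-- A Rosenthal-type bound obtained by adding one innovation at a time: the linear term vanishes by
independence, and the quadratic one costs `a_i ^ 2 E|S|^(q-2)`. Tracking `1 + E|S|^q` instead of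
`E|S|^q` dominates both `E|S|^(q-2)` and `1`, so each step multiplies by at most `1 + C (a_i ^ 2 +
|a_i| ^ q)`. -/
theorem exists_moment_exp_bound (h : Innovations μ ξ s r) :
    ∃ C : ℝ, 0 ≤ C ∧ ∀ (a : ℤ → ℝ) (Λ : Finset ℤ),
      1 + ∫ ω, |∑ l ∈ Λ, a l * ξ l ω| ^ (s * r) ∂μ ≤
        Real.exp (C * ∑ l ∈ Λ, (a l ^ 2 + |a l| ^ (s * r))) := by
  set q : ℝ := s * r with hq
  have hq2 : 2 ≤ q := h.two_le
  have hq0 : 0 < q := h.q_pos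
  set m2 := ∫ ω, ξ 1 ω ^ 2 ∂μ with hm2
  set mq := ∫ ω, |ξ 1 ω| ^ q ∂μ with hmq
  have hm2' : 0 ≤ m2 := integral_nonneg fun ω => sq_nonneg _
  have hmq' : 0 ≤ mq := integral_nonneg fun ω => by positivity
  set C0 := (q + 1) ^ q + q ^ 2 with hC0
  have hC0' : 0 ≤ C0 := by positivity
  refine ⟨C0 * (m2 + mq), by positivity, fun a Λ => ?_⟩
  induction Λ using Finset.induction_on with
  | empty => simp [Real.zero_rpow hq0.ne']
  | insert i Λ hi ih =>
    set S : Ω → ℝ := fun ω => ∑ l ∈ Λ, a l * ξ l ω with hS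
    have hSL : MemLp S (ENNReal.ofReal q) μ := h.memLp_linear a Λ
    have hSm : Measurable[coordAlg ξ (Λ : Set ℤ)] S := measurable_coordAlg_linear ξ a Λ fun l hl => hl
    have hSm' := hSm.of_coordAlg h.meas
    have hind : IndepFun (ξ i) S μ :=
      indepFun_of_coordAlg h.meas h.indep (S := {i}) (T := Λ)
        (Set.disjoint_singleton_left.2 (by simpa using hi)) (measurable_coordAlg_self rfl) hSm
    have hSi := hSL.integrable_abs_rpow hq0
    have hSi2 : Integrable (fun ω => |S ω| ^ (q - 2)) μ := by
      refine ((integrable_const 1).add hSi).mono'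
        (hSm'.abs.pow_const _).aestronglyMeasurable (ae_of_all _ fun ω => ?_)
      rw [Real.norm_of_nonneg (by positivity)]
      exact rpow_le_one_add_rpow (abs_nonneg _) (by linarith) (by linarith)
    have hSi1 : Integrable (fun ω => |S ω| ^ (q - 2) * S ω) μ := by
      refine ((integrable_const 1).add hSi).mono'
        ((hSm'.abs.pow_const _).mul hSm').aestronglyMeasurable (ae_of_all _ fun ω => ?_)
      rw [Real.norm_eq_abs, abs_abs_rpow_mul_self (by linarith)]
      exact rpow_le_one_add_rpow (abs_nonneg _) (by linarith) (by linarith)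
    have hx2 : Integrable (fun ω => ξ i ω ^ 2) μ := (h.memLp_two i).integrable_sq
    have hxq : Integrable (fun ω => |ξ i ω| ^ q) μ := (h.memLp i).integrable_abs_rpow hq0
    have i1 : Integrable (fun ω => ξ i ω * (|S ω| ^ (q - 2) * S ω)) μ :=
      (hind.comp (φ := id) (ψ := fun x : ℝ => |x| ^ (q - 2) * x) measurable_id
        (by fun_prop)).integrable_mul (h.integrable i) hSi1
    have e1 : ∫ ω, ξ i ω * (|S ω| ^ (q - 2) * S ω) ∂μ = 0 := by
      have := (hind.comp (φ := id) (ψ := fun x : ℝ => |x| ^ (q - 2) * x) measurable_id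
        (by fun_prop)).integral_fun_mul_eq_mul_integral
        (h.integrable i).1 hSi1.1
      refine this.trans ?_
      simp [h.integral_eq_zero i]
    have hind2 : IndepFun (fun ω => |S ω| ^ (q - 2)) (fun ω => ξ i ω ^ 2) μ :=
      hind.symm.comp (φ := fun x : ℝ => |x| ^ (q - 2)) (ψ := fun x : ℝ => x ^ 2)
        (by fun_prop) (by fun_prop)
    have i2 : Integrable (fun ω => |S ω| ^ (q - 2) * ξ i ω ^ 2) μ := hind2.integrable_mul hSi2 hx2
    have e2 : ∫ ω, |S ω| ^ (q - 2) * ξ i ω ^ 2 ∂μ ≤ (1 + ∫ ω, |S ω| ^ q ∂μ) * m2 := by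
      rw [hind2.integral_fun_mul_eq_mul_integral hSi2.1 hx2.1]
      have ex : ∫ ω, ξ i ω ^ 2 ∂μ = m2 :=
        h.integral_comp (g := fun x => x ^ 2) (by fun_prop) i
      rw [ex]
      refine mul_le_mul_of_nonneg_right ?_ hm2'
      calc ∫ ω, |S ω| ^ (q - 2) ∂μ ≤ ∫ ω, (1 + |S ω| ^ q) ∂μ :=
            integral_mono hSi2 ((integrable_const 1).add hSi) fun ω =>
              rpow_le_one_add_rpow (abs_nonneg _) (by linarith) (by linarith)
        _ = _ := by rw [integral_add (integrable_const 1) hSi]; simp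
    have e3 : ∫ ω, |ξ i ω| ^ q ∂μ = mq :=
      h.integral_comp (g := fun x => |x| ^ q) (by fun_prop) i
    have hM : 0 ≤ ∫ ω, |S ω| ^ q ∂μ := integral_nonneg fun ω => by positivity
    have key : ∫ ω, |∑ l ∈ insert i Λ, a l * ξ l ω| ^ q ∂μ ≤
        ∫ ω, |S ω| ^ q ∂μ +
          C0 * (a i ^ 2 * ((1 + ∫ ω, |S ω| ^ q ∂μ) * m2) + |a i| ^ q * mq) := by
      calc ∫ ω, |∑ l ∈ insert i Λ, a l * ξ l ω| ^ q ∂μ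
          ≤ ∫ ω, (|S ω| ^ q + (q * a i) * (ξ i ω * (|S ω| ^ (q - 2) * S ω)) +
              (C0 * a i ^ 2 * (|S ω| ^ (q - 2) * ξ i ω ^ 2) +
                C0 * |a i| ^ q * |ξ i ω| ^ q)) ∂μ := by
            refine integral_mono ((h.memLp_linear a _).integrable_abs_rpow hq0) ?_ fun ω => ?_
            · exact (hSi.add (i1.const_mul _)).add ((i2.const_mul _).add (hxq.const_mul _))
            · have := abs_add_rpow_le_of_two_le hq2 (S ω) (a i * ξ i ω)
              simp only [Finset.sum_insert hi]
              rw [add_comm]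
              refine this.trans (le_of_eq ?_)
              rw [abs_mul, Real.mul_rpow (abs_nonneg _) (abs_nonneg _)]
              ring
        _ = ∫ ω, |S ω| ^ q ∂μ + C0 * (a i ^ 2 * ∫ ω, |S ω| ^ (q - 2) * ξ i ω ^ 2 ∂μ +
              |a i| ^ q * mq) := by
            have j1 : Integrable (fun ω => |S ω| ^ q +
                (q * a i) * (ξ i ω * (|S ω| ^ (q - 2) * S ω))) μ := hSi.add (i1.const_mul _)
            have j2 : Integrable (fun ω => C0 * a i ^ 2 * (|S ω| ^ (q - 2) * ξ i ω ^ 2) +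
                C0 * |a i| ^ q * |ξ i ω| ^ q) μ := (i2.const_mul _).add (hxq.const_mul _)
            rw [integral_add j1 j2, integral_add hSi (i1.const_mul _),
              integral_add (i2.const_mul _) (hxq.const_mul _), integral_const_mul,
              integral_const_mul, integral_const_mul, e1, e3]
            ring
        _ ≤ _ := by gcongr
    rw [Finset.sum_insert hi, mul_add, Real.exp_add, mul_comm (Real.exp _)]
    have hx := Real.add_one_le_exp (C0 * (m2 + mq) * (a i ^ 2 + |a i| ^ q))
    have ha : 0 ≤ |a i| ^ q := by positivity
    have ha2 := sq_nonneg (a i)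
    set M := ∫ ω, |S ω| ^ q ∂μ
    calc 1 + ∫ ω, |∑ l ∈ insert i Λ, a l * ξ l ω| ^ q ∂μ
        ≤ (1 + M) * (1 + C0 * (m2 + mq) * (a i ^ 2 + |a i| ^ q)) := by
          have p1 : 0 ≤ C0 * (1 + M) * (a i ^ 2 * mq) := by positivity
          have p2 : 0 ≤ C0 * (1 + M) * (|a i| ^ q * m2) := by positivity
          have p3 : 0 ≤ C0 * M * (|a i| ^ q * mq) := by positivity
          nlinarith [key]
      _ ≤ _ := by
          refine mul_le_mul ih (by linarith) (by positivity) (Real.exp_pos _).le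

/-- Linear combinations of the innovations with square summable coefficients are bounded in
`L^{s r}`. -/
theorem exists_moment_bound (h : Innovations μ ξ s r) (B : ℝ) :
    ∃ K : ℝ, 1 ≤ K ∧ ∀ (a : ℤ → ℝ) (Λ : Finset ℤ), ∑ l ∈ Λ, a l ^ 2 ≤ B →
      ∫ ω, |∑ l ∈ Λ, a l * ξ l ω| ^ (s * r) ∂μ ≤ K := by
  obtain ⟨C, hC, hb⟩ := h.exists_moment_exp_bound
  have hq2 := h.two_le
  -- Since every `a_l ^ 2` is at most `|B|`, one has `|a_l| ^ q ≤ |B| ^ (q/2 - 1) * a_l ^ 2` with `q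
  -- = s * r`.
  refine ⟨Real.exp (C * (|B| + |B| ^ ((s * r) / 2 - 1) * |B|)), ?_, fun a Λ ha => ?_⟩
  · refine Real.one_le_exp (by positivity)
  · have h1 := hb a Λ
    have ha' : ∑ l ∈ Λ, a l ^ 2 ≤ |B| := ha.trans (le_abs_self B)
    have h2 : ∑ l ∈ Λ, |a l| ^ (s * r) ≤ |B| ^ ((s * r) / 2 - 1) * |B| := by
      calc ∑ l ∈ Λ, |a l| ^ (s * r) ≤ ∑ l ∈ Λ, |B| ^ ((s * r) / 2 - 1) * a l ^ 2 := by
            refine Finset.sum_le_sum fun l hl => ?_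
            rcases eq_or_ne (a l) 0 with h0 | h0
            · rw [h0, abs_zero, Real.zero_rpow h.q_pos.ne']
              positivity
            · have hal : a l ^ 2 ≤ |B| :=
                (Finset.single_le_sum (f := fun l => a l ^ 2) (fun i _ => sq_nonneg _) hl).trans ha'
              have e : |a l| ^ (s * r) = (a l ^ 2) ^ ((s * r) / 2 - 1) * a l ^ 2 := by
                rw [← sq_abs, ← Real.rpow_natCast, ← Real.rpow_mul (abs_nonneg _),
                  ← Real.rpow_add (abs_pos.2 h0)]
                congr 1; push_cast; ring
              rw [e]
              refine mul_le_mul_of_nonneg_right ?_ (sq_nonneg _)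
              exact Real.rpow_le_rpow (sq_nonneg _) hal (by linarith)
        _ = |B| ^ ((s * r) / 2 - 1) * ∑ l ∈ Λ, a l ^ 2 := by rw [Finset.mul_sum]
        _ ≤ _ := by gcongr
    have h3 : Real.exp (C * ∑ l ∈ Λ, (a l ^ 2 + |a l| ^ (s * r))) ≤
        Real.exp (C * (|B| + |B| ^ ((s * r) / 2 - 1) * |B|)) := by
      rw [Finset.sum_add_distrib]
      gcongr
    linarith

end Innovations

/-! ### Dyadic chaining and almost sure convergence. -/

section Chaining

/-- Erasing the binary digits of `n` from the lowest one removes at most one dyadic block per digit,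
and all these blocks lie in `(0, n]`. -/
theorem abs_sum_le_of_dyadic_blocks {y : ℕ → ℝ} {Z γ : ℝ} (hγ : 0 ≤ γ) (hZ : 0 ≤ Z)
    (hb : ∀ j i : ℕ, |∑ k ∈ Finset.Ioc (i * 2 ^ j) (i * 2 ^ j + 2 ^ j), y k| ≤
      Z * ((2 ^ j * (i + 1) : ℕ) : ℝ) ^ γ) (n : ℕ) :
    |∑ k ∈ Finset.Icc 1 n, y k| ≤ (Nat.log 2 n + 1 : ℕ) * (Z * (n : ℝ) ^ γ) := by
  set T : ℕ → ℝ := fun m => ∑ k ∈ Finset.Ioc 0 m, y k with hT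
  have hW : 0 ≤ Z * (n : ℝ) ^ γ := by positivity
  have hstep : ∀ j, |T (n / 2 ^ j * 2 ^ j) - T (n / 2 ^ (j + 1) * 2 ^ (j + 1))| ≤
      Z * (n : ℝ) ^ γ := by
    intro j
    have hdiv : n / 2 ^ (j + 1) = n / 2 ^ j / 2 := by rw [pow_succ, Nat.div_div_eq_div_mul]
    rw [hdiv]
    have hle : n / 2 ^ j * 2 ^ j ≤ n := Nat.div_mul_le_self n (2 ^ j)
    generalize n / 2 ^ j = a at hle ⊢
    rcases Nat.even_or_odd' a with ⟨b, rfl | rfl⟩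
    · have : 2 * b / 2 * 2 ^ (j + 1) = 2 * b * 2 ^ j := by
        rw [Nat.mul_div_cancel_left b two_pos, pow_succ]; ring
      rw [this, sub_self, abs_zero]
      exact hW
    · have e1 : (2 * b + 1) / 2 * 2 ^ (j + 1) = 2 * b * 2 ^ j := by
        rw [show (2 * b + 1) / 2 = b by omega, pow_succ]; ring
      have e2 : (2 * b + 1) * 2 ^ j = 2 * b * 2 ^ j + 2 ^ j := by ring
      have e3 : T (2 * b * 2 ^ j + 2 ^ j) - T (2 * b * 2 ^ j) =
          ∑ k ∈ Finset.Ioc (2 * b * 2 ^ j) (2 * b * 2 ^ j + 2 ^ j), y k := by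
        rw [sub_eq_iff_eq_add', hT]
        exact (Finset.sum_Ioc_consecutive y (Nat.zero_le _) (Nat.le_add_right _ _)).symm
      rw [e1, e2, e3]
      refine (hb j (2 * b)).trans ?_
      gcongr
      exact le_of_eq_of_le (by ring) hle
  have htel : ∀ J : ℕ, |T n - T (n / 2 ^ J * 2 ^ J)| ≤ J * (Z * (n : ℝ) ^ γ) := by
    intro J
    induction J with
    | zero => simp
    | succ J ih =>
      calc |T n - T (n / 2 ^ (J + 1) * 2 ^ (J + 1))|
          ≤ |T n - T (n / 2 ^ J * 2 ^ J)| +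
            |T (n / 2 ^ J * 2 ^ J) - T (n / 2 ^ (J + 1) * 2 ^ (J + 1))| := abs_sub_le _ _ _
        _ ≤ J * (Z * (n : ℝ) ^ γ) + Z * (n : ℝ) ^ γ := add_le_add ih (hstep J)
        _ = ((J + 1 : ℕ) : ℝ) * (Z * (n : ℝ) ^ γ) := by push_cast; ring
  -- After this many digits the quotient is `0`, so the telescoping reaches the empty sum.
  have h := htel (Nat.log 2 n + 1)
  rw [Nat.div_eq_of_lt (Nat.lt_pow_succ_log_self one_lt_two n)] at h
  have hIcc : Finset.Icc 1 n = Finset.Ioc 0 n := by ext; simp [Nat.succ_le_iff]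
  rw [hIcc]
  simpa [hT] using h

theorem exists_log_add_one_le_rpow {δ : ℝ} (hδ : 0 < δ) :
    ∃ C : ℝ, ∀ n : ℕ, 1 ≤ n → ((Nat.log 2 n + 1 : ℕ) : ℝ) ≤ C * (n : ℝ) ^ δ := by
  refine ⟨1 / (δ * Real.log 2) + 1, fun n hn => ?_⟩
  have hl2 : 0 < Real.log 2 := Real.log_pos one_lt_two
  have hn' : (1 : ℝ) ≤ n := by exact_mod_cast hn
  have h1 : (Nat.log 2 n : ℝ) * Real.log 2 ≤ Real.log n := by
    rw [← Real.log_pow]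
    refine Real.log_le_log (by positivity) ?_
    exact_mod_cast Nat.pow_log_le_self 2 (by omega)
  have h2 := Real.log_le_rpow_div (x := (n : ℝ)) (by positivity) hδ
  have h3 : (1 : ℝ) ≤ (n : ℝ) ^ δ := Real.one_le_rpow hn' hδ.le
  have h4 : (Nat.log 2 n : ℝ) ≤ 1 / (δ * Real.log 2) * (n : ℝ) ^ δ := by
    rw [div_mul_eq_mul_div, one_mul, le_div_iff₀ (by positivity)]
    rw [le_div_iff₀ hδ] at h2
    nlinarith
  push_cast
  linarith

theorem tendsto_rpow_mul_of_dyadic_blocks {y : ℕ → ℝ} {Z γ γ' : ℝ} (hγ : 0 ≤ γ) (hγ' : γ < γ')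
    (hZ : 0 ≤ Z)
    (hb : ∀ j i : ℕ, |∑ k ∈ Finset.Ioc (i * 2 ^ j) (i * 2 ^ j + 2 ^ j), y k| ≤
      Z * ((2 ^ j * (i + 1) : ℕ) : ℝ) ^ γ) :
    Tendsto (fun n : ℕ => (n : ℝ) ^ (-γ') * ∑ k ∈ Finset.Icc 1 n, y k) atTop (𝓝 0) := by
  obtain ⟨C, hC⟩ := exists_log_add_one_le_rpow (δ := (γ' - γ) / 2) (by linarith)
  have hlim : Tendsto (fun n : ℕ => C * Z * (n : ℝ) ^ (-((γ' - γ) / 2))) atTop (𝓝 0) := by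
    have := ((tendsto_rpow_neg_atTop (y := (γ' - γ) / 2) (by linarith)).comp
      tendsto_natCast_atTop_atTop).const_mul (C * Z)
    simpa using this
  refine squeeze_zero_norm' ?_ hlim
  filter_upwards [eventually_ge_atTop 1] with n hn
  have hn' : (0 : ℝ) < n := by exact_mod_cast hn
  rw [Real.norm_eq_abs, abs_mul, abs_of_nonneg (Real.rpow_nonneg hn'.le _)]
  calc (n : ℝ) ^ (-γ') * |∑ k ∈ Finset.Icc 1 n, y k|
      ≤ (n : ℝ) ^ (-γ') * ((C * (n : ℝ) ^ ((γ' - γ) / 2)) * (Z * (n : ℝ) ^ γ)) := by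
        gcongr
        refine (abs_sum_le_of_dyadic_blocks hγ hZ hb n).trans ?_
        gcongr
        exact hC n hn
    _ = C * Z * ((n : ℝ) ^ (-γ') * (n : ℝ) ^ ((γ' - γ) / 2) * (n : ℝ) ^ γ) := by ring
    _ = C * Z * (n : ℝ) ^ (-((γ' - γ) / 2)) := by
        rw [← Real.rpow_add hn', ← Real.rpow_add hn']
        congr 2; ring

variable {Ω : Type*} [MeasurableSpace Ω] {μ : Measure Ω}

/-- If the `L^r` norms of the block sums of length `n` are `O(n ^ β)`, then the partial sums are
almost surely `o(n ^ γ)` for all `γ > β`. -/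
theorem ae_tendsto_rpow_mul_sum {y : ℕ → Ω → ℝ} {r β γ C : ℝ} (hr : 0 < r) (hβ : 1 ≤ β * r)
    (hγ : β < γ) (hmeas : ∀ k, AEMeasurable (y k) μ)
    (hb : ∀ m n : ℕ, 1 ≤ n →
      ∫⁻ ω, ‖∑ k ∈ Finset.Ioc m (m + n), y k ω‖ₑ ^ r ∂μ ≤ ENNReal.ofReal (C * (n : ℝ) ^ (β * r))) :
    ∀ᵐ ω ∂μ, Tendsto (fun n : ℕ => (n : ℝ) ^ (-γ) * ∑ k ∈ Finset.Icc 1 n, y k ω) atTop (𝓝 0) := by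
  have hβ0 : 0 < β := by
    by_contra hcon
    nlinarith
  -- The gap `δ - β` makes the sum over scales converge; the gap `γ - δ` absorbs the logarithmic
  -- number of blocks.
  obtain ⟨δ, hδ1, hδ2⟩ := exists_between hγ
  set B : ℕ × ℕ → Ω → ℝ := fun z ω =>
    ∑ k ∈ Finset.Ioc (z.2 * 2 ^ z.1) (z.2 * 2 ^ z.1 + 2 ^ z.1), y k ω with hB
  -- The weight is a power of the right end point of the block. Its sum over positions converges
  -- because `δ r > β r ≥ 1`.
  set w : ℕ × ℕ → ℝ := fun z => ((2 ^ z.1 * (z.2 + 1) : ℕ) : ℝ) ^ (-(δ * r)) with hw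
  have hBm : ∀ z, AEMeasurable (fun ω => ENNReal.ofReal (w z) * ‖B z ω‖ₑ ^ r) μ := by
    intro z
    have : AEMeasurable (B z) μ := Finset.aemeasurable_fun_sum _ fun k _ => hmeas k
    exact (this.enorm.pow_const r).const_mul _
  have hle : ∀ z, ∫⁻ ω, ENNReal.ofReal (w z) * ‖B z ω‖ₑ ^ r ∂μ ≤
      ENNReal.ofReal (C * (((2 : ℝ) ^ (-((δ - β) * r))) ^ z.1 * ((z.2 + 1 : ℕ) : ℝ) ^ (-(δ * r))))
      := by
    intro z
    rw [lintegral_const_mul'' _ ((Finset.aemeasurable_fun_sum _ fun k _ => hmeas k).enorm.pow_const r)]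
    refine (mul_le_mul_right (hb (z.2 * 2 ^ z.1) (2 ^ z.1) Nat.one_le_two_pow) _).trans ?_
    rw [← ENNReal.ofReal_mul (by positivity)]
    refine ENNReal.ofReal_le_ofReal (le_of_eq ?_)
    rw [hw]
    push_cast
    rw [Real.mul_rpow (by positivity) (by positivity), ← Real.rpow_natCast,
      ← Real.rpow_mul two_pos.le, ← Real.rpow_mul two_pos.le]
    have : (2 : ℝ) ^ ((z.1 : ℝ) * -(δ * r)) * (2 : ℝ) ^ ((z.1 : ℝ) * (β * r)) =
        ((2 : ℝ) ^ (-((δ - β) * r))) ^ z.1 := by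
      rw [← Real.rpow_natCast, ← Real.rpow_mul two_pos.le, ← Real.rpow_add two_pos]
      congr 1; ring
    rw [← this]; ring
  have hsum : Summable (fun z : ℕ × ℕ =>
      C * (((2 : ℝ) ^ (-((δ - β) * r))) ^ z.1 * ((z.2 + 1 : ℕ) : ℝ) ^ (-(δ * r)))) := by
    refine Summable.mul_left C ?_
    refine Summable.mul_of_nonneg (f := fun j : ℕ => ((2 : ℝ) ^ (-((δ - β) * r))) ^ j)
      (g := fun i : ℕ => ((i + 1 : ℕ) : ℝ) ^ (-(δ * r))) ?_ ?_ (fun j => by positivity)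
      (fun i => by positivity)
    · refine summable_geometric_of_lt_one (by positivity) ?_
      refine Real.rpow_lt_one_of_one_lt_of_neg one_lt_two ?_
      have : 0 < (δ - β) * r := mul_pos (by linarith) hr
      linarith
    · have : Summable (fun i : ℕ => (i : ℝ) ^ (-(δ * r))) := by
        rw [Real.summable_nat_rpow]
        have : β * r < δ * r := by gcongr
        linarith
      exact (summable_nat_add_iff 1).2 this
  -- The weighted sum over all blocks has finite expectation; its almost surely finite value `Z`
  -- then controls every block at once.
  have hfin : ∫⁻ ω, ∑' z, ENNReal.ofReal (w z) * ‖B z ω‖ₑ ^ r ∂μ ≠ ⊤ := by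
    rw [lintegral_tsum hBm]
    refine ne_top_of_le_ne_top ?_ (ENNReal.tsum_le_tsum hle)
    exact hsum.tsum_ofReal_ne_top
  filter_upwards [ae_lt_top' (AEMeasurable.tsum hBm) hfin] with ω hω
  set Z := ∑' z, ENNReal.ofReal (w z) * ‖B z ω‖ₑ ^ r with hZ
  refine tendsto_rpow_mul_of_dyadic_blocks (Z := Z.toReal ^ r⁻¹) (γ := δ) (by linarith) hδ2
    (by positivity) fun j i => ?_
  have h1 : ENNReal.ofReal (w (j, i)) * ‖B (j, i) ω‖ₑ ^ r ≤ Z := ENNReal.le_tsum (j, i)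
  have h2 : w (j, i) * |B (j, i) ω| ^ r ≤ Z.toReal := by
    have := ENNReal.toReal_mono hω.ne h1
    rw [ENNReal.toReal_mul, ENNReal.toReal_ofReal (by positivity), ← ENNReal.toReal_rpow,
      toReal_enorm] at this
    exact this
  set x : ℝ := ((2 ^ j * (i + 1) : ℕ) : ℝ) with hx
  have hx0 : 0 < x := by rw [hx]; positivity
  have hwx : w (j, i) = (x ^ (δ * r))⁻¹ := by rw [hw, ← Real.rpow_neg hx0.le]
  rw [hwx, inv_mul_le_iff₀ (by positivity)] at h2
  calc |B (j, i) ω| = (|B (j, i) ω| ^ r) ^ r⁻¹ := (Real.rpow_rpow_inv (abs_nonneg _) hr.ne').symm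
    _ ≤ (x ^ (δ * r) * Z.toReal) ^ r⁻¹ := by gcongr
    _ = Z.toReal ^ r⁻¹ * x ^ δ := by
        rw [Real.mul_rpow (by positivity) (by positivity), Real.rpow_mul hx0.le,
          Real.rpow_rpow_inv (by positivity) hr.ne', mul_comm]

end Chaining

/-! ### Powers as coefficients of formal exponential series. -/

section ExpSeries

/-- The exponential series `∑ (y t)^j / j!`. -/
noncomputable def expSeries (y : ℝ) : PowerSeries ℝ := PowerSeries.rescale y (PowerSeries.exp ℝ)

theorem coeff_expSeries (y : ℝ) (j : ℕ) :
    PowerSeries.coeff j (expSeries y) = y ^ j / j.factorial := by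
  simp [expSeries, PowerSeries.coeff_rescale, PowerSeries.coeff_exp, div_eq_mul_inv]

theorem expSeries_zero : expSeries 0 = 1 := by
  ext j
  rcases j with _ | j <;> simp [coeff_expSeries, PowerSeries.coeff_one]

theorem expSeries_add (x y : ℝ) : expSeries (x + y) = expSeries x * expSeries y :=
  (PowerSeries.exp_mul_exp_eq_exp_add x y).symm

theorem prod_expSeries {ι : Type*} (Λ : Finset ι) (y : ι → ℝ) :
    ∏ l ∈ Λ, expSeries (y l) = expSeries (∑ l ∈ Λ, y l) := by
  classical
  induction Λ using Finset.induction_on with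
  | empty => simp [expSeries_zero]
  | insert i Λ hi ih => rw [Finset.prod_insert hi, Finset.sum_insert hi, ih, expSeries_add]

theorem pow_eq_factorial_mul_coeff (x : ℝ) (j : ℕ) :
    x ^ j = j.factorial * PowerSeries.coeff j (expSeries x) := by
  rw [coeff_expSeries]
  field_simp

/-- An odd total degree forces an odd degree in one of the factors, and that degree is again below
`N`. -/
theorem coeff_prod_eq_zero_of_odd {ι : Type*} {N : ℕ} (Λ : Finset ι) (f : ι → PowerSeries ℝ)
    (hf : ∀ l ∈ Λ, ∀ j < N, Odd j → PowerSeries.coeff j (f l) = 0) {j : ℕ} (hj : j < N)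
    (hodd : Odd j) : PowerSeries.coeff j (∏ l ∈ Λ, f l) = 0 := by
  classical
  induction Λ using Finset.induction_on generalizing j with
  | empty =>
    rw [Finset.prod_empty, PowerSeries.coeff_one, if_neg]
    rintro rfl
    simp at hodd
  | insert i Λ hi ih =>
    rw [Finset.prod_insert hi, PowerSeries.coeff_mul]
    refine Finset.sum_eq_zero fun z hz => ?_
    have hz' : z.1 + z.2 = j := Finset.HasAntidiagonal.mem_antidiagonal.1 hz
    rcases Nat.even_or_odd z.1 with h1 | h1
    · have h2 : Odd z.2 := by
        rw [← hz', Nat.odd_add'] at hodd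
        exact hodd.2 h1
      rw [ih (fun l hl => hf l (Finset.mem_insert_of_mem hl)) (by omega) h2, mul_zero]
    · rw [hf i (Finset.mem_insert_self i Λ) z.1 (by omega) h1, zero_mul]

end ExpSeries

/-! ### Sums over large subsets. -/

section PowersetSums

/-- The left side is the part of degree at least `d` of `∏ (1 + u_l)`. In the induction, subsets
containing the new index need only `d - 1` others. -/
theorem sum_powerset_filter_prod_le {ι : Type*} [DecidableEq ι] (Λ : Finset ι) (u : ι → ℝ)
    (hu : ∀ l, 0 ≤ u l) (d : ℕ) :
    ∑ I ∈ Λ.powerset with d ≤ I.card, ∏ l ∈ I, u l ≤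
      (∑ l ∈ Λ, u l) ^ d * Real.exp (∑ l ∈ Λ, u l) := by
  simp only [Finset.sum_filter]
  induction Λ using Finset.induction_on generalizing d with
  | empty =>
    rcases d with _ | d <;> simp
  | insert i Λ hi ih =>
    rw [Finset.sum_powerset_insert hi, Finset.sum_insert hi]
    set U := ∑ l ∈ Λ, u l with hU
    have hU0 : 0 ≤ U := Finset.sum_nonneg fun l _ => hu l
    have hins : ∀ I ∈ Λ.powerset, (if d ≤ (insert i I).card then ∏ l ∈ insert i I, u l else 0) =
        u i * (if d - 1 ≤ I.card then ∏ l ∈ I, u l else 0) := by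
      intro I hI
      have hiI : i ∉ I := fun h' => hi (Finset.mem_powerset.1 hI h')
      rw [Finset.card_insert_of_notMem hiI, Finset.prod_insert hiI, mul_ite, mul_zero]
      simp only [Nat.sub_le_iff_le_add]
    rw [Finset.sum_congr rfl hins, ← Finset.mul_sum]
    have h1 := ih d
    have h2 := ih (d - 1)
    have hui := hu i
    have hexp := Real.add_one_le_exp (u i)
    have hE : 0 < Real.exp U := Real.exp_pos U
    have hle : U ^ d * Real.exp U + u i * (U ^ (d - 1) * Real.exp U) ≤
        (u i + U) ^ d * Real.exp (u i + U) := by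
      -- For `d = 0` the truncated `d - 1` is `0`, and the claim reduces to `1 + u ≤ exp u`.
      rcases d with _ | d
      · rw [Real.exp_add]
        simp only [pow_zero, one_mul, Nat.zero_sub]
        nlinarith
      · rw [Nat.add_sub_cancel, pow_succ, pow_succ]
        have p1 : U ^ d ≤ (u i + U) ^ d := by gcongr; linarith
        have p2 : Real.exp U ≤ Real.exp (u i + U) := by gcongr; linarith
        calc U ^ d * U * Real.exp U + u i * (U ^ d * Real.exp U)
            = U ^ d * (u i + U) * Real.exp U := by ring
          _ ≤ (u i + U) ^ d * (u i + U) * Real.exp (u i + U) := by gcongr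
    have h3 := mul_le_mul_of_nonneg_left h2 hui
    linarith

end PowersetSums

/-! ### Moment series and square-free polynomials in the innovations. -/

namespace Innovations

variable {Ω : Type*} [MeasurableSpace Ω] {μ : Measure Ω} {ξ : ℤ → Ω → ℝ} {s : ℕ} {r : ℝ}
  [IsProbabilityMeasure μ]

theorem integrable_pow_of_memLp (h : Innovations μ ξ s r) {f : Ω → ℝ}
    (hf : MemLp f (ENNReal.ofReal (s * r)) μ) {i : ℕ} (hi : i ≤ s) :
    Integrable (fun ω => f ω ^ i) μ := by
  refine ((integrable_const 1).add (hf.integrable_abs_rpow h.q_pos)).mono' (hf.1.pow i)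
    (ae_of_all _ fun ω => ?_)
  rw [norm_pow, Real.norm_eq_abs, ← Real.rpow_natCast]
  refine rpow_le_one_add_rpow (abs_nonneg _) (Nat.cast_nonneg i) ?_
  have h1 : (i : ℝ) ≤ s := by exact_mod_cast hi
  have h2 := h.one_lt
  nlinarith [Nat.cast_nonneg (α := ℝ) s]

/-- The exponential generating series of the moments of `a ξ`. -/
noncomputable def momentSeries (μ : Measure Ω) (ξ : ℤ → Ω → ℝ) (a : ℝ) : PowerSeries ℝ :=
  PowerSeries.mk fun j => a ^ j * (∫ ω, ξ 1 ω ^ j ∂μ) / j.factorial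

/-- Independence makes the moment series multiplicative. As the series are formal, only moments up
to order `s` must exist. -/
theorem coeff_prod_momentSeries (h : Innovations μ ξ s r) (a : ℤ → ℝ) (Λ : Finset ℤ) {i : ℕ}
    (hi : i ≤ s) : PowerSeries.coeff i (∏ l ∈ Λ, momentSeries μ ξ (a l)) =
      (∫ ω, (∑ l ∈ Λ, a l * ξ l ω) ^ i ∂μ) / i.factorial := by
  induction Λ using Finset.induction_on generalizing i with
  | empty => rcases i with _ | i <;> simp [PowerSeries.coeff_one]
  | insert n Λ hn ih =>
    have hSL := h.memLp_linear a Λ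
    have hind : IndepFun (ξ n) (fun ω => ∑ l ∈ Λ, a l * ξ l ω) μ :=
      indepFun_of_coordAlg h.meas h.indep (S := {n}) (T := Λ)
        (Set.disjoint_singleton_left.2 (by simpa using hn)) (measurable_coordAlg_self rfl)
        (measurable_coordAlg_linear ξ a Λ fun l hl => hl)
    have hterm : ∀ z ∈ Finset.HasAntidiagonal.antidiagonal i,
        IndepFun (fun ω => ξ n ω ^ z.1) (fun ω => (∑ l ∈ Λ, a l * ξ l ω) ^ z.2) μ := fun z _ =>
      hind.comp (φ := fun x : ℝ => x ^ z.1) (ψ := fun x : ℝ => x ^ z.2) (by fun_prop) (by fun_prop)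
    have hi1 : ∀ z ∈ Finset.HasAntidiagonal.antidiagonal i, Integrable (fun ω => ξ n ω ^ z.1) μ := fun z hz =>
      h.integrable_pow_of_memLp (h.memLp n) (by have := Finset.HasAntidiagonal.mem_antidiagonal.1 hz; omega)
    have hi2 : ∀ z ∈ Finset.HasAntidiagonal.antidiagonal i,
        Integrable (fun ω => (∑ l ∈ Λ, a l * ξ l ω) ^ z.2) μ := fun z hz =>
      h.integrable_pow_of_memLp hSL (by have := Finset.HasAntidiagonal.mem_antidiagonal.1 hz; omega)
    have hexp : ∀ ω, (∑ l ∈ insert n Λ, a l * ξ l ω) ^ i / i.factorial =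
        ∑ z ∈ Finset.HasAntidiagonal.antidiagonal i, a n ^ z.1 / (z.1.factorial * z.2.factorial) *
          (ξ n ω ^ z.1 * (∑ l ∈ Λ, a l * ξ l ω) ^ z.2) := by
      intro ω
      rw [Finset.sum_insert hn, ← coeff_expSeries, expSeries_add, PowerSeries.coeff_mul]
      refine Finset.sum_congr rfl fun z _ => ?_
      rw [coeff_expSeries, coeff_expSeries, mul_pow, div_mul_div_comm, div_mul_eq_mul_div]
      ring
    have hi3 : ∀ z ∈ Finset.HasAntidiagonal.antidiagonal i,
        Integrable (fun ω => ξ n ω ^ z.1 * (∑ l ∈ Λ, a l * ξ l ω) ^ z.2) μ := fun z hz =>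
      (hterm z hz).integrable_mul (hi1 z hz) (hi2 z hz)
    rw [← integral_div]
    simp only [hexp]
    rw [integral_finsetSum _ fun z hz => (hi3 z hz).const_mul _,
      Finset.prod_insert hn, PowerSeries.coeff_mul]
    refine Finset.sum_congr rfl fun z hz => ?_
    rw [integral_const_mul, (hterm z hz).integral_fun_mul_eq_mul_integral (hi1 z hz).1 (hi2 z hz).1,
      ih (by have := Finset.HasAntidiagonal.mem_antidiagonal.1 hz; omega), momentSeries, PowerSeries.coeff_mk,
      h.integral_comp (g := fun x => x ^ z.1) (by fun_prop) n, div_mul_div_comm, div_mul_eq_mul_div]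
    ring

/-- Reading the coefficient as a moment of the linear combination gives a bound independent of the
number of factors. -/
theorem exists_coeff_momentSeries_bound (h : Innovations μ ξ s r) (B : ℝ) :
    ∃ K : ℝ, 0 ≤ K ∧ ∀ (a : ℤ → ℝ) (Λ : Finset ℤ), ∑ l ∈ Λ, a l ^ 2 ≤ B → ∀ i ≤ s,
      |PowerSeries.coeff i (∏ l ∈ Λ, momentSeries μ ξ (a l))| ≤ K := by
  obtain ⟨K, hK1, hK⟩ := h.exists_moment_bound B
  refine ⟨1 + K, by linarith, fun a Λ ha i hi => ?_⟩
  have hSL := h.memLp_linear a Λ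
  have h1 : |∫ ω, (∑ l ∈ Λ, a l * ξ l ω) ^ i ∂μ| ≤ 1 + K := by
    calc |∫ ω, (∑ l ∈ Λ, a l * ξ l ω) ^ i ∂μ|
        ≤ ∫ ω, |(∑ l ∈ Λ, a l * ξ l ω) ^ i| ∂μ := abs_integral_le_integral_abs
      _ ≤ ∫ ω, (1 + |∑ l ∈ Λ, a l * ξ l ω| ^ (s * r)) ∂μ := by
          refine integral_mono (h.integrable_pow_of_memLp hSL hi).abs
            ((integrable_const 1).add (hSL.integrable_abs_rpow h.q_pos)) fun ω => ?_
          simp only [abs_pow]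
          rw [← Real.rpow_natCast]
          refine rpow_le_one_add_rpow (abs_nonneg _) (Nat.cast_nonneg i) ?_
          have h1 : (i : ℝ) ≤ s := by exact_mod_cast hi
          have h2 := h.one_lt
          nlinarith [Nat.cast_nonneg (α := ℝ) s]
      _ = 1 + ∫ ω, |∑ l ∈ Λ, a l * ξ l ω| ^ (s * r) ∂μ := by
          rw [integral_add (integrable_const 1) (hSL.integrable_abs_rpow h.q_pos)]; simp
      _ ≤ 1 + K := by linarith [hK a Λ ha]
  rw [h.coeff_prod_momentSeries a Λ hi, abs_div, Nat.abs_cast]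
  refine (div_le_self (abs_nonneg _) ?_).trans h1
  exact_mod_cast Nat.factorial_pos i

theorem measurable_multilinear {Ω : Type*} (ξ : ℤ → Ω → ℝ) (θ : Finset ℤ → ℝ) (Λ : Finset ℤ)
    {S : Set ℤ} (hS : ∀ l ∈ Λ, l ∈ S) :
    Measurable[coordAlg ξ S] (fun ω => ∑ I ∈ Λ.powerset, θ I * ∏ l ∈ I, ξ l ω) := by
  refine Finset.measurable_fun_sum _ fun I hI => Measurable.const_mul ?_ _
  exact Finset.measurable_fun_prod _ fun l hl =>
    measurable_coordAlg_self (hS l (Finset.mem_powerset.1 hI hl))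

/-- Orthogonality of square-free monomials in the innovations. -/
theorem multilinear_sq (h : Innovations μ ξ s r) (θ : Finset ℤ → ℝ) (Λ : Finset ℤ) :
    MemLp (fun ω => ∑ I ∈ Λ.powerset, θ I * ∏ l ∈ I, ξ l ω) 2 μ ∧
    ∫ ω, (∑ I ∈ Λ.powerset, θ I * ∏ l ∈ I, ξ l ω) ^ 2 ∂μ =
      ∑ I ∈ Λ.powerset, θ I ^ 2 * (∫ ω, ξ 1 ω ^ 2 ∂μ) ^ I.card := by
  induction Λ using Finset.induction_on generalizing θ with
  | empty => simp [memLp_const]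
  | insert i Λ hi ih =>
    set F : Ω → ℝ := fun ω => ∑ I ∈ Λ.powerset, θ I * ∏ l ∈ I, ξ l ω with hF
    set G : Ω → ℝ := fun ω => ∑ I ∈ Λ.powerset, θ (insert i I) * ∏ l ∈ I, ξ l ω with hG
    obtain ⟨hF1, hF2⟩ := ih θ
    obtain ⟨hG1, hG2⟩ := ih fun I => θ (insert i I)
    have hFm : Measurable[coordAlg ξ (Λ : Set ℤ)] F := measurable_multilinear ξ θ Λ fun l hl => hl
    have hGm : Measurable[coordAlg ξ (Λ : Set ℤ)] G := measurable_multilinear ξ _ Λ fun l hl => hl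
    have hdisj : Disjoint ({i} : Set ℤ) Λ := Set.disjoint_singleton_left.2 (by simpa using hi)
    have hxm : Measurable[coordAlg ξ ({i} : Set ℤ)] (ξ i) := measurable_coordAlg_self rfl
    -- The split is by whether `I` contains `i`. Since `ξ i` is centred and independent of `F * G`,
    -- the cross term vanishes.
    have hsplit : ∀ ω, ∑ I ∈ (insert i Λ).powerset, θ I * ∏ l ∈ I, ξ l ω =
        F ω + ξ i ω * G ω := by
      intro ω
      rw [Finset.sum_powerset_insert hi, hF, hG, Finset.mul_sum]
      congr 1
      refine Finset.sum_congr rfl fun I hI => ?_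
      rw [Finset.prod_insert fun h' => hi (Finset.mem_powerset.1 hI h')]
      ring
    have hxG : IndepFun (ξ i) G μ := indepFun_of_coordAlg h.meas h.indep hdisj hxm hGm
    have hxFG : IndepFun (ξ i) (fun ω => F ω * G ω) μ :=
      indepFun_of_coordAlg h.meas h.indep hdisj hxm (hFm.mul hGm)
    have h2 : (2 : ENNReal) = ENNReal.ofReal 2 := by simp
    have hxGL : MemLp (fun ω => ξ i ω * G ω) 2 μ := by
      have hx := h.memLp_two i
      rw [h2] at hx hG1 ⊢
      exact hxG.memLp_mul two_pos hx hG1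
    have hFG : Integrable (fun ω => F ω * G ω) μ := hF1.integrable_mul hG1
    simp only [hsplit]
    refine ⟨hF1.add hxGL, ?_⟩
    have hx2G2 : IndepFun (fun ω => ξ i ω ^ 2) (fun ω => G ω ^ 2) μ :=
      hxG.comp (φ := fun x : ℝ => x ^ 2) (ψ := fun x : ℝ => x ^ 2) (by fun_prop) (by fun_prop)
    have e1 : ∫ ω, ξ i ω * (F ω * G ω) ∂μ = 0 := by
      rw [hxFG.integral_fun_mul_eq_mul_integral (h.integrable i).1 hFG.1, h.integral_eq_zero i,
        zero_mul]
    have e2 : ∫ ω, ξ i ω ^ 2 * G ω ^ 2 ∂μ = (∫ ω, ξ 1 ω ^ 2 ∂μ) * ∫ ω, G ω ^ 2 ∂μ := by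
      rw [hx2G2.integral_fun_mul_eq_mul_integral (h.memLp_two i).integrable_sq.1
        hG1.integrable_sq.1, h.integral_comp (g := fun x => x ^ 2) (by fun_prop) i]
    have i1 : Integrable (fun ω => ξ i ω * (F ω * G ω)) μ :=
      hxFG.integrable_mul (h.integrable i) hFG
    have i2 : Integrable (fun ω => ξ i ω ^ 2 * G ω ^ 2) μ :=
      hx2G2.integrable_mul (h.memLp_two i).integrable_sq hG1.integrable_sq
    have hsq : ∀ ω, (F ω + ξ i ω * G ω) ^ 2 =
        F ω ^ 2 + 2 * (ξ i ω * (F ω * G ω)) + ξ i ω ^ 2 * G ω ^ 2 := fun ω => by ring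
    simp only [hsq]
    have i3 : Integrable (fun ω => F ω ^ 2 + 2 * (ξ i ω * (F ω * G ω))) μ :=
      hF1.integrable_sq.add (i1.const_mul 2)
    rw [integral_add i3 i2, integral_add hF1.integrable_sq (i1.const_mul 2), integral_const_mul, e1,
      e2, hF2, hG2, Finset.sum_powerset_insert hi, Finset.mul_sum]
    simp only [mul_zero, add_zero]
    congr 1
    refine Finset.sum_congr rfl fun I hI => ?_
    rw [Finset.card_insert_of_notMem fun h' => hi (Finset.mem_powerset.1 hI h')]
    ring

/-- Taking the linear term on `I` uses up degree `I.card`. Weights `v` and variables `x` are kept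
apart so that `multilinear_sq` applies with deterministic coefficients. -/
theorem coeff_prod_add_linear (φ : ℤ → PowerSeries ℝ) (v x : ℤ → ℝ) (Λ : Finset ℤ) (b : ℕ) :
    PowerSeries.coeff b (∏ l ∈ Λ, (φ l + PowerSeries.C (v l * x l) * PowerSeries.X)) =
      ∑ I ∈ Λ.powerset, ((if I.card ≤ b then
        PowerSeries.coeff (b - I.card) (∏ l ∈ Λ \ I, φ l) else 0) * ∏ l ∈ I, v l) *
          ∏ l ∈ I, x l := by
  simp only [add_comm (φ _)]
  rw [Finset.prod_add, map_sum]
  refine Finset.sum_congr rfl fun I _ => ?_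
  rw [Finset.prod_mul_distrib, Finset.prod_const, ← map_prod, mul_assoc, PowerSeries.coeff_C_mul,
    PowerSeries.coeff_X_pow_mul', Finset.prod_mul_distrib]
  split_ifs <;> ring

/-- The free weights `v` accommodate decoupling, which replaces `a l` by `2 * a l` or `0` in the
linear terms but not in the moment series. -/
theorem exists_multilinear_bound (h : Innovations μ ξ s r) (B : ℝ) :
    ∃ K : ℝ, 0 ≤ K ∧ ∀ (a v : ℤ → ℝ) (Λ : Finset ℤ), ∑ l ∈ Λ, a l ^ 2 ≤ B →
      (∀ l, v l ^ 2 ≤ 4 * a l ^ 2) → ∀ b ≤ s,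
      MemLp (fun ω => PowerSeries.coeff b (∏ l ∈ Λ,
        (momentSeries μ ξ (a l) + PowerSeries.C (v l * ξ l ω) * PowerSeries.X))) 2 μ ∧
      ∫ ω, (PowerSeries.coeff b (∏ l ∈ Λ,
        (momentSeries μ ξ (a l) + PowerSeries.C (v l * ξ l ω) * PowerSeries.X))) ^ 2 ∂μ ≤ K := by
  obtain ⟨K, hK0, hK⟩ := h.exists_coeff_momentSeries_bound B
  set m2 := ∫ ω, ξ 1 ω ^ 2 ∂μ with hm2
  have hm2' : 0 ≤ m2 := integral_nonneg fun ω => sq_nonneg _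
  refine ⟨K ^ 2 * Real.exp (4 * B * m2), by positivity, fun a v Λ ha hv b hb => ?_⟩
  simp only [coeff_prod_add_linear]
  obtain ⟨h1, h2⟩ := h.multilinear_sq (fun I => (if I.card ≤ b then
        PowerSeries.coeff (b - I.card) (∏ l ∈ Λ \ I, momentSeries μ ξ (a l)) else 0) *
          ∏ l ∈ I, v l) Λ
  refine ⟨h1, h2.le.trans ?_⟩
  calc ∑ I ∈ Λ.powerset, ((if I.card ≤ b then
        PowerSeries.coeff (b - I.card) (∏ l ∈ Λ \ I, momentSeries μ ξ (a l)) else 0) *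
          ∏ l ∈ I, v l) ^ 2 * m2 ^ I.card
      ≤ ∑ I ∈ Λ.powerset, K ^ 2 * ∏ l ∈ I, (4 * a l ^ 2 * m2) := by
        refine Finset.sum_le_sum fun I hI => ?_
        rw [Finset.prod_mul_distrib, Finset.prod_const, ← mul_assoc, mul_pow, ← Finset.prod_pow]
        refine mul_le_mul_of_nonneg_right ?_ (by positivity)
        refine mul_le_mul ?_ (Finset.prod_le_prod (fun l _ => sq_nonneg _) fun l _ => hv l)
          (Finset.prod_nonneg fun l _ => sq_nonneg _) (by positivity)
        split_ifs
        · rw [← sq_abs]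
          have := hK a (Λ \ I) ((Finset.sum_le_sum_of_subset_of_nonneg Finset.sdiff_subset
            fun l _ _ => sq_nonneg _).trans ha) (b - I.card) (by omega)
          gcongr
        · simpa using sq_nonneg K
    _ = K ^ 2 * ∑ I ∈ Λ.powerset with 0 ≤ I.card, ∏ l ∈ I, (4 * a l ^ 2 * m2) := by
        rw [Finset.mul_sum]; simp
    _ ≤ K ^ 2 * ((∑ l ∈ Λ, 4 * a l ^ 2 * m2) ^ 0 * Real.exp (∑ l ∈ Λ, 4 * a l ^ 2 * m2)) := by
        gcongr
        exact sum_powerset_filter_prod_le Λ _ (fun l => by positivity) 0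
    _ ≤ _ := by
        rw [pow_zero, one_mul, ← Finset.sum_mul, ← Finset.mul_sum]
        gcongr

end Innovations

/-! ### Decoupling by averaging over subsets. -/

section Decoupling

/-- For a uniformly random `A`, the indicators of `m ∉ A` and of `l ∈ A` for `l > m` are independent
with mean `1/2`; the factors `2` restore the original product on average. -/
theorem sum_powerset_decoupling {R : Type*} [CommSemiring R] {ι : Type*} [LinearOrder ι]
    (Λ : Finset ι) {m : ι} (hm : m ∈ Λ) (φ Y : ι → R) :
    ∑ A ∈ Λ.powerset, (if m ∈ A then 0 else 2) *
        ∏ l ∈ Λ with m < l, (φ l + if l ∈ A then 2 * Y l else 0) =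
      2 ^ Λ.card * ∏ l ∈ Λ with m < l, (φ l + Y l) := by
  -- `F` is the factor of an index in `A`, `H` that of an index outside; expanding `∏ (F + H)`
  -- yields the sum over `A`.
  set F : ι → R := fun l => if l = m then 0 else if m < l then φ l + 2 * Y l else 1 with hF
  set H : ι → R := fun l => if l = m then 2 else if m < l then φ l else 1 with hH
  have h1 : ∏ l ∈ Λ, (F l + H l) = 2 ^ Λ.card * ∏ l ∈ Λ with m < l, (φ l + Y l) := by
    rw [Finset.prod_filter, ← Finset.prod_const, ← Finset.prod_mul_distrib]
    refine Finset.prod_congr rfl fun l _ => ?_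
    simp only [hF, hH]
    by_cases h1 : l = m
    · simp [h1]
    · by_cases h2 : m < l
      · simp only [h1, h2, if_true, if_false]; ring
      · simp only [h1, h2, if_false]; norm_num
  rw [← h1, Finset.prod_add]
  refine Finset.sum_congr rfl fun A hA => ?_
  have hA' := Finset.mem_powerset.1 hA
  have h2 : (∏ l ∈ A, F l) * ∏ l ∈ Λ \ A, H l = ∏ l ∈ Λ, if l ∈ A then F l else H l := by
    rw [← Finset.prod_sdiff hA', mul_comm]
    congr 1
    · exact Finset.prod_congr rfl fun l hl => (if_neg (Finset.mem_sdiff.1 hl).2).symm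
    · exact Finset.prod_congr rfl fun l hl => (if_pos hl).symm
  have h3 : (if m ∈ A then (0 : R) else 2) = ∏ l ∈ Λ, if l = m then (if m ∈ A then 0 else 2) else 1
      := by
    rw [Finset.prod_ite_eq' Λ m, if_pos hm]
  rw [h2, h3, Finset.prod_filter, ← Finset.prod_mul_distrib]
  refine Finset.prod_congr rfl fun l _ => ?_
  by_cases e1 : l = m
  · simp [e1, hF, hH]
  · by_cases e2 : m < l <;> by_cases e3 : l ∈ A <;> simp [e1, e2, e3, hF, hH]

end Decoupling

/-! ### Comparison of `L^r` norms with moments. -/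

section LpBounds

variable {Ω : Type*} [MeasurableSpace Ω] {μ : Measure Ω}

theorem lpNorm_le_of_integral_le {f : Ω → ℝ} {r M : ℝ} (hr : 1 ≤ r)
    (hf : AEStronglyMeasurable f μ) (hM : 1 ≤ M) (h : ∫ ω, |f ω| ^ r ∂μ ≤ M) :
    lpNorm f (ENNReal.ofReal r) μ ≤ M := by
  have hr0 : 0 < r := by linarith
  rw [← Real.rpow_le_rpow_iff lpNorm_nonneg (by linarith) hr0, lpNorm_rpow_eq_integral hr0 hf]
  exact h.trans (Real.self_le_rpow_of_one_le hM hr)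

variable [IsProbabilityMeasure μ]

theorem lpNorm_le_of_integral_sq_le {f : Ω → ℝ} {r M : ℝ} (hr : 1 ≤ r) (hr2 : r ≤ 2)
    (hf : MemLp f 2 μ) (h : ∫ ω, f ω ^ 2 ∂μ ≤ M) :
    lpNorm f (ENNReal.ofReal r) μ ≤ 1 + M := by
  have hM : 0 ≤ M := (integral_nonneg fun ω => sq_nonneg _).trans h
  refine lpNorm_le_of_integral_le hr hf.1 (by linarith) ?_
  have hfr : MemLp f (ENNReal.ofReal r) μ := hf.mono_exponent (by
    rw [← ENNReal.ofReal_ofNat]; exact ENNReal.ofReal_le_ofReal hr2)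
  calc ∫ ω, |f ω| ^ r ∂μ ≤ ∫ ω, (1 + f ω ^ 2) ∂μ := by
        refine integral_mono (hfr.integrable_abs_rpow (by linarith))
          ((integrable_const 1).add hf.integrable_sq) fun ω => ?_
        have := rpow_le_one_add_rpow (abs_nonneg (f ω)) (by linarith) hr2
        simpa using this
    _ = 1 + ∫ ω, f ω ^ 2 ∂μ := by rw [integral_add (integrable_const 1) hf.integrable_sq]; simp
    _ ≤ 1 + M := by linarith

theorem memLp_pow_of_le {f : Ω → ℝ} {r : ℝ} (hr : 0 < r) {s j : ℕ} (hs : 0 < s) (hj : j ≤ s)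
    (hf : MemLp f (ENNReal.ofReal (s * r)) μ) :
    MemLp (fun ω => f ω ^ j) (ENNReal.ofReal r) μ ∧
      ∫ ω, |f ω ^ j| ^ r ∂μ ≤ 1 + ∫ ω, |f ω| ^ (s * r) ∂μ := by
  have hq : 0 < s * r := by positivity
  have hi := hf.integrable_abs_rpow hq
  have hle : ∀ ω, |f ω ^ j| ^ r ≤ 1 + |f ω| ^ (s * r) := by
    intro ω
    rw [abs_pow, ← Real.rpow_natCast, ← Real.rpow_mul (abs_nonneg _)]
    refine rpow_le_one_add_rpow (abs_nonneg _) (by positivity) ?_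
    gcongr
  have hi2 : Integrable (fun ω => |f ω ^ j| ^ r) μ := by
    refine ((integrable_const 1).add hi).mono'
      ((hf.1.aemeasurable.pow_const j).abs.pow_const r).aestronglyMeasurable
      (ae_of_all _ fun ω => ?_)
    rw [Real.norm_of_nonneg (by positivity)]
    exact hle ω
  refine ⟨(memLp_ofReal_iff hr (hf.1.pow j)).2 hi2, ?_⟩
  calc ∫ ω, |f ω ^ j| ^ r ∂μ ≤ ∫ ω, (1 + |f ω| ^ (s * r)) ∂μ :=
        integral_mono hi2 ((integrable_const 1).add hi) hle
    _ = _ := by rw [integral_add (integrable_const 1) hi]; simp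

end LpBounds

/-! ### Orthogonality and size of the centred higher-order part. -/

namespace Innovations

variable {Ω : Type*} [MeasurableSpace Ω] {μ : Measure Ω} {ξ : ℤ → Ω → ℝ} {s : ℕ} {r : ℝ}

/-- Orthogonality of a sum of centred functions of `ξ_m` with coefficients that do not depend on
`ξ_m` to the functions that do not depend on `ξ_m`. -/
theorem integral_mul_rpow_eq_zero (h : Innovations μ ξ s r) {ι : Type*} (Z : Finset ι) (m : ℤ)
    (W V : ι → Ω → ℝ) (f : Ω → ℝ)
    (hWm : ∀ z ∈ Z, Measurable[coordAlg ξ {m}] (W z)) (hWi : ∀ z ∈ Z, Integrable (W z) μ)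
    (hW0 : ∀ z ∈ Z, ∫ ω, W z ω ∂μ = 0)
    (hVm : ∀ z ∈ Z, Measurable[coordAlg ξ {m}ᶜ] (V z))
    (hV : ∀ z ∈ Z, MemLp (V z) (ENNReal.ofReal r) μ)
    (hfm : Measurable[coordAlg ξ {m}ᶜ] f) (hf : MemLp f (ENNReal.ofReal r) μ) :
    ∫ ω, (∑ z ∈ Z, W z ω * V z ω) * (|f ω| ^ (r - 2) * f ω) ∂μ = 0 := by
  have hψ : Measurable (fun x : ℝ => |x| ^ (r - 2) * x) := by fun_prop
  have hψm : Measurable[coordAlg ξ {m}ᶜ] (fun ω => |f ω| ^ (r - 2) * f ω) := hψ.comp hfm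
  have hUm : ∀ z ∈ Z, Measurable[coordAlg ξ {m}ᶜ] (fun ω => V z ω * (|f ω| ^ (r - 2) * f ω)) :=
    fun z hz => (hVm z hz).mul hψm
  have hUi : ∀ z ∈ Z, Integrable (fun ω => V z ω * (|f ω| ^ (r - 2) * f ω)) μ := by
    intro z hz
    refine (((hV z hz).integrable_abs_rpow h.r_pos).add (hf.integrable_abs_rpow h.r_pos)).mono'
      ((hUm z hz).of_coordAlg h.meas).aestronglyMeasurable (ae_of_all _ fun ω => ?_)
    rw [Real.norm_eq_abs, abs_mul, abs_abs_rpow_mul_self h.one_lt]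
    have := mul_rpow_le_add_rpow (abs_nonneg (V z ω)) (abs_nonneg (f ω)) zero_le_one
      (show 0 ≤ r - 1 by linarith [h.one_lt])
    simpa using this
  have hind : ∀ z ∈ Z, IndepFun (W z) (fun ω => V z ω * (|f ω| ^ (r - 2) * f ω)) μ := fun z hz =>
    indepFun_of_coordAlg h.meas h.indep disjoint_compl_right (hWm z hz) (hUm z hz)
  simp only [Finset.sum_mul, mul_assoc]
  have hi : ∀ z ∈ Z, Integrable (fun ω => W z ω * (V z ω * (|f ω| ^ (r - 2) * f ω))) μ :=
    fun z hz => (hind z hz).integrable_mul (hWi z hz) (hUi z hz)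
  rw [integral_finsetSum _ hi]
  refine Finset.sum_eq_zero fun z hz => ?_
  rw [(hind z hz).integral_fun_mul_eq_mul_integral (hWi z hz).1 (hUi z hz).1, hW0 z hz, zero_mul]

/-- The centred part of `exp (a ξ_m t)` of order at least two in `t`. -/
noncomputable def higherSeries (μ : Measure Ω) (ξ : ℤ → Ω → ℝ) (a : ℝ) (m : ℤ) (ω : Ω) :
    PowerSeries ℝ :=
  expSeries (a * ξ m ω) - (momentSeries μ ξ a + PowerSeries.C (a * ξ m ω) * PowerSeries.X)

variable [IsProbabilityMeasure μ]

theorem coeff_higherSeries (h : Innovations μ ξ s r) (a : ℝ) (m : ℤ) (ω : Ω) (j : ℕ) :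
    PowerSeries.coeff j (higherSeries μ ξ a m ω) =
      if j < 2 then 0 else a ^ j / j.factorial * (ξ m ω ^ j - ∫ ω', ξ 1 ω' ^ j ∂μ) := by
  rw [higherSeries, map_sub, map_add, coeff_expSeries, momentSeries, PowerSeries.coeff_mk,
    PowerSeries.coeff_C_mul, PowerSeries.coeff_X]
  rcases j with _ | _ | j
  · simp
  · simp [h.mean]
  · rw [if_neg (by omega), if_neg (by omega), mul_pow]
    ring

/-- Starting at order two in `t` yields the factor `a ^ 2`; this is the source of the short memory
of the remainder. -/
theorem exists_higherSeries_bound (h : Innovations μ ξ s r) (B : ℝ) :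
    ∃ K : ℝ, 0 ≤ K ∧ ∀ (a : ℝ) (m : ℤ) (j : ℕ), a ^ 2 ≤ B → j ≤ s →
      MemLp (fun ω => PowerSeries.coeff j (higherSeries μ ξ a m ω)) (ENNReal.ofReal r) μ ∧
      ∫ ω, PowerSeries.coeff j (higherSeries μ ξ a m ω) ∂μ = 0 ∧
      lpNorm (fun ω => PowerSeries.coeff j (higherSeries μ ξ a m ω)) (ENNReal.ofReal r) μ ≤
        K * a ^ 2 := by
  set N : ℕ → ℝ := fun j =>
    lpNorm (fun ω => ξ 1 ω ^ j - ∫ ω', ξ 1 ω' ^ j ∂μ) (ENNReal.ofReal r) μ with hN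
  have hN0 : ∀ j, 0 ≤ N j := fun j => lpNorm_nonneg
  refine ⟨(2 + |B|) ^ s * ∑ j ∈ Finset.range (s + 1), N j,
    mul_nonneg (by positivity) (Finset.sum_nonneg fun j _ => hN0 j), fun a m j ha hj => ?_⟩
  have hpow : MemLp (fun ω => ξ m ω ^ j) (ENNReal.ofReal r) μ :=
    (memLp_pow_of_le h.r_pos h.one_le_s hj (h.memLp m)).1
  have hcen : MemLp (fun ω => ξ m ω ^ j - ∫ ω', ξ 1 ω' ^ j ∂μ) (ENNReal.ofReal r) μ :=
    hpow.sub (memLp_const _)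
  simp only [h.coeff_higherSeries]
  split_ifs with h2
  · refine ⟨MemLp.zero', by simp, ?_⟩
    rw [lpNorm_fun_zero]
    exact mul_nonneg (mul_nonneg (by positivity) (Finset.sum_nonneg fun j _ => hN0 j))
      (sq_nonneg a)
  · refine ⟨hcen.const_mul _, ?_, ?_⟩
    · rw [integral_const_mul, integral_sub (h.integrable_pow_of_memLp (h.memLp m) hj)
        (integrable_const _), h.integral_comp (g := fun x => x ^ j) (by fun_prop) m]
      simp
    · have e1 : lpNorm (fun ω => a ^ j / j.factorial * (ξ m ω ^ j - ∫ ω', ξ 1 ω' ^ j ∂μ))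
          (ENNReal.ofReal r) μ = |a ^ j / j.factorial| * N j := by
        have e2 := lpNorm_const_smul (p := ENNReal.ofReal r) (a ^ j / j.factorial : ℝ)
          (fun ω => ξ m ω ^ j - ∫ ω', ξ 1 ω' ^ j ∂μ) μ
        have e3 : eLpNorm (fun ω => ξ m ω ^ j - ∫ ω', ξ 1 ω' ^ j ∂μ) (ENNReal.ofReal r) μ =
            eLpNorm (fun ω => ξ 1 ω ^ j - ∫ ω', ξ 1 ω' ^ j ∂μ) (ENNReal.ofReal r) μ :=
          ((h.ident m).comp (u := fun x => x ^ j - ∫ ω', ξ 1 ω' ^ j ∂μ) (by fun_prop)).eLpNorm_eq _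
        have hcen1 : AEStronglyMeasurable (fun ω => ξ 1 ω ^ j - ∫ ω', ξ 1 ω' ^ j ∂μ) μ :=
          (((h.meas 1).pow_const j).sub_const _).aestronglyMeasurable
        have e4 : lpNorm (fun ω => ξ m ω ^ j - ∫ ω', ξ 1 ω' ^ j ∂μ) (ENNReal.ofReal r) μ = N j := by
          rw [← toReal_eLpNorm hcen.1, e3, toReal_eLpNorm hcen1]
        rw [← e4]
        exact e2
      rw [e1]
      have h3 : |a ^ j / j.factorial| ≤ (2 + |B|) ^ s * a ^ 2 := by
        rw [abs_div, Nat.abs_cast, abs_pow]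
        have hf : (1 : ℝ) ≤ j.factorial := by exact_mod_cast Nat.factorial_pos j
        refine (div_le_self (by positivity) hf).trans ?_
        obtain ⟨i, rfl⟩ : ∃ i, j = i + 2 := ⟨j - 2, by omega⟩
        rw [pow_add, sq_abs]
        refine mul_le_mul_of_nonneg_right ?_ (sq_nonneg a)
        have ha1 : |a| ≤ 2 + |B| := by
          have := le_abs_self B
          have := sq_abs a
          nlinarith [sq_nonneg (|a| - 1)]
        calc |a| ^ i ≤ (2 + |B|) ^ i := by gcongr
          _ ≤ (2 + |B|) ^ s := pow_le_pow_right₀ (by linarith [abs_nonneg B]) (by omega)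
      have h4 : N j ≤ ∑ j ∈ Finset.range (s + 1), N j :=
        Finset.single_le_sum (fun i _ => hN0 i) (Finset.mem_range.2 (by omega))
      calc |a ^ j / j.factorial| * N j
          ≤ ((2 + |B|) ^ s * a ^ 2) * ∑ j ∈ Finset.range (s + 1), N j := by
            gcongr
            exact hN0 j
        _ = _ := by ring

end Innovations

/-! ### The multilinear part and the decoupled remainder. -/

namespace Innovations

variable {Ω : Type*} [MeasurableSpace Ω] {μ : Measure Ω} {ξ : ℤ → Ω → ℝ} {s : ℕ} {r : ℝ}

/-- The coefficient of `t ^ b` in `∏ (φ_l + a_l ξ_l t)`, where `φ_l` is the moment series. -/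
noncomputable def multilinearPart (μ : Measure Ω) (ξ : ℤ → Ω → ℝ) (b : ℕ) (Λ : Finset ℤ)
    (a : ℤ → ℝ) (ω : Ω) : ℝ :=
  PowerSeries.coeff b (∏ l ∈ Λ,
    (momentSeries μ ξ (a l) + PowerSeries.C (a l * ξ l ω) * PowerSeries.X))

/-- The coefficients of the factor carried by the indices below `m` and the decoupled factor
carried by the indices above `m`. -/
noncomputable def outerCoeff (μ : Measure Ω) (ξ : ℤ → Ω → ℝ) (Λ : Finset ℤ) (a : ℤ → ℝ)
    (A : Finset ℤ) (m : ℤ) (i : ℕ) (ω : Ω) : ℝ :=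
  PowerSeries.coeff i (expSeries (∑ l ∈ Λ with l < m, a l * ξ l ω) *
    ∏ l ∈ Λ with m < l, (momentSeries μ ξ (a l) +
      PowerSeries.C ((if l ∈ A then 2 * a l else 0) * ξ l ω) * PowerSeries.X))

/-- The decoupled terms of the remainder. -/
noncomputable def remainderTerm (μ : Measure Ω) (ξ : ℤ → Ω → ℝ) (s : ℕ) (Λ : Finset ℤ) (a : ℤ → ℝ)
    (A : Finset ℤ) (m : ℤ) (ω : Ω) : ℝ :=
  ∑ z ∈ Finset.HasAntidiagonal.antidiagonal s,
    PowerSeries.coeff z.1 (higherSeries μ ξ (a m) m ω) * outerCoeff μ ξ Λ a A m z.2 ω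

/-- Expand `∏ ((φ_l + Y_l) + g_l)` by the largest index `m` at which `g` is chosen: below `m` the
full exponentials recombine, above `m` only `φ_l + Y_l` is left. The factors above `m` are then
decoupled. -/
theorem pow_sub_multilinearPart (s : ℕ) (Λ : Finset ℤ) (a : ℤ → ℝ) (ω : Ω) :
    2 ^ Λ.card * ((∑ l ∈ Λ, a l * ξ l ω) ^ s - s.factorial * multilinearPart μ ξ s Λ a ω) =
      ∑ A ∈ Λ.powerset, ∑ m ∈ Λ \ A, 2 * s.factorial * remainderTerm μ ξ s Λ a A m ω := by
  set Y : ℤ → PowerSeries ℝ := fun l => PowerSeries.C (a l * ξ l ω) * PowerSeries.X with hY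
  set φ : ℤ → PowerSeries ℝ := fun l => momentSeries μ ξ (a l) with hφ
  set g : ℤ → PowerSeries ℝ := fun l => higherSeries μ ξ (a l) l ω with hg
  have hsplit : ∀ l, φ l + Y l + g l = expSeries (a l * ξ l ω) := fun l => by
    simp only [hg, higherSeries, hφ, hY]; ring
  have hY2 : ∀ (A : Finset ℤ) (l : ℤ), (if l ∈ A then 2 * Y l else 0) =
      PowerSeries.C ((if l ∈ A then 2 * a l else 0) * ξ l ω) * PowerSeries.X := by
    intro A l
    split_ifs
    · simp only [hY, map_mul, map_ofNat]; ring
    · simp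
  have h1 := Finset.prod_add_ordered Λ (fun l => φ l + Y l) g
  simp only [hsplit, prod_expSeries] at h1
  have h2 : (∑ l ∈ Λ, a l * ξ l ω) ^ s - s.factorial * multilinearPart μ ξ s Λ a ω =
      s.factorial * ∑ m ∈ Λ, PowerSeries.coeff s (g m *
        expSeries (∑ l ∈ Λ with l < m, a l * ξ l ω) * ∏ l ∈ Λ with m < l, (φ l + Y l)) := by
    rw [pow_eq_factorial_mul_coeff, h1, map_add, map_sum, multilinearPart]
    ring
  have h3 : ∀ m ∈ Λ, 2 ^ Λ.card * PowerSeries.coeff s (g m *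
      expSeries (∑ l ∈ Λ with l < m, a l * ξ l ω) * ∏ l ∈ Λ with m < l, (φ l + Y l)) =
      ∑ A ∈ Λ.powerset, if m ∈ A then 0 else 2 * remainderTerm μ ξ s Λ a A m ω := by
    intro m hm
    have h4 : (2 : ℝ) ^ Λ.card * PowerSeries.coeff s (g m *
        expSeries (∑ l ∈ Λ with l < m, a l * ξ l ω) * ∏ l ∈ Λ with m < l, (φ l + Y l)) =
        PowerSeries.coeff s (g m * expSeries (∑ l ∈ Λ with l < m, a l * ξ l ω) *
          (2 ^ Λ.card * ∏ l ∈ Λ with m < l, (φ l + Y l))) := by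
      rw [← PowerSeries.coeff_C_mul, map_pow, map_ofNat]
      congr 1; ring
    rw [h4, ← sum_powerset_decoupling Λ hm φ Y, Finset.mul_sum, map_sum]
    refine Finset.sum_congr rfl fun A _ => ?_
    simp only [hY2]
    split_ifs
    · simp
    · rw [remainderTerm]
      simp only [outerCoeff]
      rw [← PowerSeries.coeff_mul, ← PowerSeries.coeff_C_mul, map_ofNat]
      congr 1; ring
  rw [h2, mul_left_comm, Finset.mul_sum, Finset.sum_congr rfl h3, Finset.sum_comm, Finset.mul_sum]
  refine Finset.sum_congr rfl fun A _ => ?_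
  rw [Finset.sdiff_eq_filter, Finset.sum_filter, Finset.mul_sum]
  refine Finset.sum_congr rfl fun m _ => ?_
  split_ifs
  · simp
  · ring

theorem measurable_coeff_higherSeries (a : ℝ) (m : ℤ) (j : ℕ) :
    Measurable[coordAlg ξ {m}] (fun ω => PowerSeries.coeff j (higherSeries μ ξ a m ω)) := by
  have hx : Measurable[coordAlg ξ {m}] (ξ m) := measurable_coordAlg_self rfl
  simp only [higherSeries, map_sub, map_add, coeff_expSeries, PowerSeries.coeff_C_mul]
  exact (((hx.const_mul a).pow_const j).div_const _).sub
    (((hx.const_mul a).mul_const _).const_add _)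

theorem measurable_coeff_decoupled (Λ : Finset ℤ) (a : ℤ → ℝ) (A : Finset ℤ) (m : ℤ) (b : ℕ) :
    Measurable[coordAlg ξ {l | l ∈ A ∧ m < l}] (fun ω => PowerSeries.coeff b
      (∏ l ∈ Λ with m < l, (momentSeries μ ξ (a l) +
        PowerSeries.C ((if l ∈ A then 2 * a l else 0) * ξ l ω) * PowerSeries.X))) := by
  have h1 := fun ω => coeff_prod_add_linear (fun l => momentSeries μ ξ (a l)) (fun _ => 1)
    (fun l => (if l ∈ A then 2 * a l else 0) * ξ l ω) (Λ.filter (m < ·)) b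
  simp only [one_mul] at h1
  simp only [h1]
  refine Finset.measurable_fun_sum _ fun I hI => Measurable.const_mul ?_ _
  refine Finset.measurable_fun_prod _ fun l hl => ?_
  have hl' := (Finset.mem_filter.1 (Finset.mem_powerset.1 hI hl)).2
  split_ifs with hA
  · exact (measurable_coordAlg_self (S := {l | l ∈ A ∧ m < l}) (And.intro hA hl')).const_mul _
  · simp only [zero_mul]
    exact measurable_const

/-- Decoupling pays off here: `m` itself is not needed, and above `m` only the indices in `A` are.
-/
theorem measurable_outerCoeff (Λ : Finset ℤ) (a : ℤ → ℝ) (A : Finset ℤ) (m : ℤ) (i : ℕ) {S : Set ℤ}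
    (h1 : ∀ l < m, l ∈ S) (h2 : ∀ l ∈ A, m < l → l ∈ S) :
    Measurable[coordAlg ξ S] (outerCoeff μ ξ Λ a A m i) := by
  unfold outerCoeff
  simp only [PowerSeries.coeff_mul, coeff_expSeries]
  refine Finset.measurable_fun_sum _ fun z _ => ?_
  refine Measurable.mul ?_ ?_
  · exact ((measurable_coordAlg_linear ξ a _ fun l hl =>
      h1 l (Finset.mem_filter.1 hl).2).pow_const _).div_const _
  · exact (measurable_coeff_decoupled Λ a A m z.2).coordAlg_mono fun l hl => h2 l hl.1 hl.2

theorem measurable_remainderTerm (Λ : Finset ℤ) (a : ℤ → ℝ) (A : Finset ℤ) (m : ℤ) {S : Set ℤ}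
    (h0 : m ∈ S) (h1 : ∀ l < m, l ∈ S) (h2 : ∀ l ∈ A, m < l → l ∈ S) :
    Measurable[coordAlg ξ S] (remainderTerm μ ξ s Λ a A m) := by
  unfold remainderTerm
  refine Finset.measurable_fun_sum _ fun z _ => ?_
  exact ((measurable_coeff_higherSeries _ m _).coordAlg_mono
    (Set.singleton_subset_iff.2 h0)).mul (measurable_outerCoeff Λ a A m _ h1 h2)

variable [IsProbabilityMeasure μ]

/-- The past factor has powers up to `s` in `L^r`, the decoupled factor is in `L²`, and they are
independent, so their product stays in `L^r`. -/
theorem exists_outerCoeff_bound (h : Innovations μ ξ s r) (B : ℝ) :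
    ∃ K : ℝ, 0 ≤ K ∧ ∀ (Λ : Finset ℤ) (a : ℤ → ℝ) (A : Finset ℤ) (m : ℤ) (i : ℕ),
      ∑ l ∈ Λ, a l ^ 2 ≤ B → i ≤ s →
      MemLp (outerCoeff μ ξ Λ a A m i) (ENNReal.ofReal r) μ ∧
      lpNorm (outerCoeff μ ξ Λ a A m i) (ENNReal.ofReal r) μ ≤ K := by
  obtain ⟨K1, hK1, hb1⟩ := h.exists_moment_bound B
  obtain ⟨K2, hK2, hb2⟩ := h.exists_multilinear_bound B
  have hr1 : (1 : ENNReal) ≤ ENNReal.ofReal r := by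
    rw [ENNReal.one_le_ofReal]; exact h.one_lt.le
  refine ⟨(s + 1) * ((1 + K1) * (1 + K2)), by positivity, fun Λ a A m i ha hi => ?_⟩
  have ha1 : ∑ l ∈ Λ with l < m, a l ^ 2 ≤ B :=
    (Finset.sum_le_sum_of_subset_of_nonneg (Finset.filter_subset _ _) fun _ _ _ =>
      sq_nonneg _).trans ha
  have ha2 : ∑ l ∈ Λ with m < l, a l ^ 2 ≤ B :=
    (Finset.sum_le_sum_of_subset_of_nonneg (Finset.filter_subset _ _) fun _ _ _ =>
      sq_nonneg _).trans ha
  set X : Ω → ℝ := fun ω => ∑ l ∈ Λ with l < m, a l * ξ l ω with hX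
  set G : ℕ → Ω → ℝ := fun b ω => PowerSeries.coeff b
      (∏ l ∈ Λ with m < l, (momentSeries μ ξ (a l) +
        PowerSeries.C ((if l ∈ A then 2 * a l else 0) * ξ l ω) * PowerSeries.X)) with hG
  have hXL : MemLp X (ENNReal.ofReal (s * r)) μ := h.memLp_linear a _
  have hXm : Measurable[coordAlg ξ (Set.Iio m)] X :=
    measurable_coordAlg_linear ξ a _ fun l hl => (Finset.mem_filter.1 hl).2
  have hGm : ∀ b, Measurable[coordAlg ξ {l | l ∈ A ∧ m < l}] (G b) :=
    measurable_coeff_decoupled Λ a A m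
  have hdisj : Disjoint (Set.Iio m) {l | l ∈ A ∧ m < l} := by
    rw [Set.disjoint_left]
    intro l hl hl'
    exact lt_asymm hl hl'.2
  have hterm : ∀ z ∈ Finset.HasAntidiagonal.antidiagonal i,
      MemLp (fun ω => X ω ^ z.1 / z.1.factorial * G z.2 ω) (ENNReal.ofReal r) μ ∧
      lpNorm (fun ω => X ω ^ z.1 / z.1.factorial * G z.2 ω) (ENNReal.ofReal r) μ ≤
        (1 + K1) * (1 + K2) := by
    intro z hz
    have hzi := Finset.HasAntidiagonal.mem_antidiagonal.1 hz
    obtain ⟨p1, p2⟩ := memLp_pow_of_le h.r_pos h.one_le_s (j := z.1) (by omega) hXL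
    have p3 : MemLp (fun ω => X ω ^ z.1 / z.1.factorial) (ENNReal.ofReal r) μ := by
      simpa only [div_eq_inv_mul] using p1.const_mul ((z.1.factorial : ℝ)⁻¹)
    have p4 : lpNorm (fun ω => X ω ^ z.1 / z.1.factorial) (ENNReal.ofReal r) μ ≤ 1 + K1 := by
      refine lpNorm_le_of_integral_le h.one_lt.le p3.1 (by linarith) ?_
      refine le_trans (integral_mono (p3.integrable_abs_rpow h.r_pos)
        (p1.integrable_abs_rpow h.r_pos) fun ω => ?_) (p2.trans (by linarith [hb1 a _ ha1]))
      refine Real.rpow_le_rpow (abs_nonneg _) ?_ h.r_pos.le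
      rw [abs_div, Nat.abs_cast]
      exact div_le_self (abs_nonneg _) (by exact_mod_cast Nat.factorial_pos _)
    obtain ⟨q1, q2⟩ := hb2 a (fun l => if l ∈ A then 2 * a l else 0) (Λ.filter (m < ·)) ha2
      (fun l => by
        split_ifs
        · nlinarith
        · nlinarith [sq_nonneg (a l)]) z.2 (by omega)
    have q3 : MemLp (G z.2) (ENNReal.ofReal r) μ := q1.mono_exponent (by
      rw [← ENNReal.ofReal_ofNat]; exact ENNReal.ofReal_le_ofReal h.le_two)
    have q4 : lpNorm (G z.2) (ENNReal.ofReal r) μ ≤ 1 + K2 :=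
      lpNorm_le_of_integral_sq_le h.one_lt.le h.le_two q1 q2
    have hind : IndepFun (fun ω => X ω ^ z.1 / z.1.factorial) (G z.2) μ :=
      indepFun_of_coordAlg h.meas h.indep hdisj ((hXm.pow_const _).div_const _) (hGm _)
    refine ⟨hind.memLp_mul h.r_pos p3 q3, ?_⟩
    rw [hind.lpNorm_mul h.r_pos p3.1 q3.1]
    exact mul_le_mul p4 q4 lpNorm_nonneg (by linarith)
  have heq : outerCoeff μ ξ Λ a A m i = fun ω => ∑ z ∈ Finset.HasAntidiagonal.antidiagonal i,
      X ω ^ z.1 / z.1.factorial * G z.2 ω := by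
    funext ω
    simp only [outerCoeff, PowerSeries.coeff_mul, coeff_expSeries, hX, hG]
  rw [heq]
  refine ⟨memLp_finsetSum _ fun z hz => (hterm z hz).1, ?_⟩
  have hle := lpNorm_sum_le (fun z hz => (hterm z hz).1) hr1
  have heq2 : (∑ z ∈ Finset.HasAntidiagonal.antidiagonal i,
      fun ω => X ω ^ z.1 / z.1.factorial * G z.2 ω) =
      fun ω => ∑ z ∈ Finset.HasAntidiagonal.antidiagonal i,
        X ω ^ z.1 / z.1.factorial * G z.2 ω := by
    funext ω; simp
  rw [heq2] at hle
  refine hle.trans ((Finset.sum_le_sum fun z hz => (hterm z hz).2).trans ?_)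
  rw [Finset.sum_const, Finset.Nat.card_antidiagonal, nsmul_eq_mul]
  have : ((i + 1 : ℕ) : ℝ) ≤ s + 1 := by exact_mod_cast Nat.succ_le_succ hi
  gcongr

theorem exists_remainderTerm_bound (h : Innovations μ ξ s r) (B : ℝ) :
    ∃ K : ℝ, 0 ≤ K ∧ ∀ (Λ : Finset ℤ) (a : ℤ → ℝ) (A : Finset ℤ), ∀ m ∈ Λ, m ∉ A →
      ∑ l ∈ Λ, a l ^ 2 ≤ B →
      MemLp (remainderTerm μ ξ s Λ a A m) (ENNReal.ofReal r) μ ∧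
      lpNorm (remainderTerm μ ξ s Λ a A m) (ENNReal.ofReal r) μ ≤ K * a m ^ 2 := by
  obtain ⟨K1, hK1, hb1⟩ := h.exists_higherSeries_bound B
  obtain ⟨K2, hK2, hb2⟩ := h.exists_outerCoeff_bound B
  have hr1 : (1 : ENNReal) ≤ ENNReal.ofReal r := by
    rw [ENNReal.one_le_ofReal]; exact h.one_lt.le
  refine ⟨(s + 1) * (K1 * K2), by positivity, fun Λ a A m hm hmA ha => ?_⟩
  have ham : a m ^ 2 ≤ B :=
    (Finset.single_le_sum (f := fun l => a l ^ 2) (fun l _ => sq_nonneg _) hm).trans ha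
  have hterm : ∀ z ∈ Finset.HasAntidiagonal.antidiagonal s,
      MemLp (fun ω => PowerSeries.coeff z.1 (higherSeries μ ξ (a m) m ω) *
        outerCoeff μ ξ Λ a A m z.2 ω) (ENNReal.ofReal r) μ ∧
      lpNorm (fun ω => PowerSeries.coeff z.1 (higherSeries μ ξ (a m) m ω) *
        outerCoeff μ ξ Λ a A m z.2 ω) (ENNReal.ofReal r) μ ≤ K1 * K2 * a m ^ 2 := by
    intro z hz
    have hzi := Finset.HasAntidiagonal.mem_antidiagonal.1 hz
    obtain ⟨p1, _, p3⟩ := hb1 (a m) m z.1 ham (by omega)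
    obtain ⟨q1, q2⟩ := hb2 Λ a A m z.2 ha (by omega)
    have hind : IndepFun (fun ω => PowerSeries.coeff z.1 (higherSeries μ ξ (a m) m ω))
        (outerCoeff μ ξ Λ a A m z.2) μ :=
      indepFun_of_coordAlg h.meas h.indep (T := {m}ᶜ) disjoint_compl_right
        (measurable_coeff_higherSeries _ m _)
        (measurable_outerCoeff Λ a A m _ (fun l hl => ne_of_lt hl) fun l _ hl => ne_of_gt hl)
    refine ⟨hind.memLp_mul h.r_pos p1 q1, ?_⟩
    rw [hind.lpNorm_mul h.r_pos p1.1 q1.1]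
    calc _ ≤ K1 * a m ^ 2 * K2 := mul_le_mul p3 q2 lpNorm_nonneg (by positivity)
      _ = _ := by ring
  refine ⟨memLp_finsetSum _ fun z hz => (hterm z hz).1, ?_⟩
  have hle := lpNorm_sum_le (fun z hz => (hterm z hz).1) hr1
  have heq2 : (∑ z ∈ Finset.HasAntidiagonal.antidiagonal s,
      fun ω => PowerSeries.coeff z.1 (higherSeries μ ξ (a m) m ω) *
        outerCoeff μ ξ Λ a A m z.2 ω) = remainderTerm μ ξ s Λ a A m := by
    funext ω; simp [remainderTerm]
  rw [heq2] at hle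
  refine hle.trans ((Finset.sum_le_sum fun z hz => (hterm z hz).2).trans (le_of_eq ?_))
  rw [Finset.sum_const, Finset.Nat.card_antidiagonal, nsmul_eq_mul]
  push_cast
  ring

end Innovations

/-! ### Block sums of the remainder and of the multilinear part. -/

namespace Innovations

variable {Ω : Type*} [MeasurableSpace Ω] {μ : Measure Ω} {ξ : ℤ → Ω → ℝ} {s : ℕ} {r : ℝ}

/-- The linear monomials carry a coefficient of the odd degree `s - 1`, hence drop out; this
supplies the case `d = 2` below. -/
theorem coeff_momentSeries_eq_zero_of_even (hs : Even s)
    (hodd : ∀ j < s, Odd j → ∫ ω, ξ 1 ω ^ j ∂μ = 0) (a : ℤ → ℝ) (Λ : Finset ℤ) (i : ℕ)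
    (hi1 : 1 ≤ i) (hi2 : i < 2) (his : i ≤ s) :
    PowerSeries.coeff (s - i) (∏ l ∈ Λ, momentSeries μ ξ (a l)) = 0 := by
  obtain rfl : i = 1 := by omega
  refine coeff_prod_eq_zero_of_odd (N := s) Λ _ (fun l _ j hj hj' => ?_) (by omega)
    (Nat.Even.sub_odd his hs odd_one)
  rw [momentSeries, PowerSeries.coeff_mk, hodd j hj hj']
  simp

variable [IsProbabilityMeasure μ]

/-- For fixed `A`, grouping by `m` gives increments of norm at most a constant times the column sum
of squares, to which the von Bahr–Esseen inequality applies. -/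
theorem exists_decoupled_sum_bound (h : Innovations μ ξ s r) (B : ℝ) :
    ∃ K : ℝ, 0 ≤ K ∧ ∀ (T : Finset ℤ) (a : ℤ → ℤ → ℝ) (Λ A : Finset ℤ),
      (∀ k ∈ T, ∑ l ∈ Λ, a k l ^ 2 ≤ B) → (∀ l ∈ Λ, ∑ k ∈ T, a k l ^ 2 ≤ B) →
      MemLp (fun ω => ∑ m ∈ Λ \ A, ∑ k ∈ T, remainderTerm μ ξ s Λ (a k) A m ω)
        (ENNReal.ofReal r) μ ∧
      lpNorm (fun ω => ∑ m ∈ Λ \ A, ∑ k ∈ T, remainderTerm μ ξ s Λ (a k) A m ω)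
        (ENNReal.ofReal r) μ ≤ K * (T.card : ℝ) ^ r⁻¹ := by
  obtain ⟨K1, hK1, hb1⟩ := h.exists_remainderTerm_bound B
  obtain ⟨K2, hK2, hb2⟩ := h.exists_outerCoeff_bound B
  obtain ⟨K3, hK3, hb3⟩ := h.exists_higherSeries_bound B
  have hr0 := h.r_pos
  have hr1 : (1 : ENNReal) ≤ ENNReal.ofReal r := by
    rw [ENNReal.one_le_ofReal]; exact h.one_lt.le
  set C0 := (r + 1) ^ r + r ^ 2 with hC0
  have hC0' : 0 ≤ C0 := by positivity
  set M := C0 * (K1 ^ r * |B| ^ (r - 1) * |B|) with hM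
  have hM0 : 0 ≤ M := by positivity
  refine ⟨M ^ r⁻¹, by positivity, fun T a Λ A hrow hcol => ?_⟩
  set D : ℤ → Ω → ℝ := fun m ω => ∑ k ∈ T, remainderTerm μ ξ s Λ (a k) A m ω with hD
  have hrem : ∀ m ∈ Λ \ A, ∀ k ∈ T, MemLp (remainderTerm μ ξ s Λ (a k) A m) (ENNReal.ofReal r) μ ∧
      lpNorm (remainderTerm μ ξ s Λ (a k) A m) (ENNReal.ofReal r) μ ≤ K1 * a k m ^ 2 :=
    fun m hm k hk => hb1 Λ (a k) A m (Finset.mem_sdiff.1 hm).1 (Finset.mem_sdiff.1 hm).2 (hrow k hk)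
  have hDL : ∀ m ∈ Λ \ A, MemLp (D m) (ENNReal.ofReal r) μ := fun m hm =>
    memLp_finsetSum T fun k hk => (hrem m hm k hk).1
  -- Bounding `x ^ r` by `|B| ^ (r - 1) * x` makes the estimate linear in the column sums, so that
  -- they can later be resummed by rows.
  have hDn : ∀ m ∈ Λ \ A, ∫ ω, |D m ω| ^ r ∂μ ≤ K1 ^ r * |B| ^ (r - 1) * ∑ k ∈ T, a k m ^ 2 := by
    intro m hm
    set x := ∑ k ∈ T, a k m ^ 2 with hx
    have hx0 : 0 ≤ x := Finset.sum_nonneg fun k _ => sq_nonneg _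
    have hxB : x ≤ |B| := (hcol m (Finset.mem_sdiff.1 hm).1).trans (le_abs_self B)
    have h1 : lpNorm (D m) (ENNReal.ofReal r) μ ≤ K1 * x := by
      have hle := lpNorm_sum_le (fun k hk => (hrem m hm k hk).1) hr1
      have heq : (∑ k ∈ T, remainderTerm μ ξ s Λ (a k) A m) = D m := by
        funext ω; simp [hD]
      rw [heq] at hle
      refine hle.trans ((Finset.sum_le_sum fun k hk => (hrem m hm k hk).2).trans (le_of_eq ?_))
      rw [Finset.mul_sum]
    rw [← lpNorm_rpow_eq_integral hr0 (hDL m hm).1]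
    calc lpNorm (D m) (ENNReal.ofReal r) μ ^ r ≤ (K1 * x) ^ r :=
          Real.rpow_le_rpow lpNorm_nonneg h1 hr0.le
      _ = K1 ^ r * (x ^ (r - 1) * x ^ (1 : ℝ)) := by
          rw [Real.mul_rpow hK1 hx0, ← Real.rpow_add_of_nonneg hx0 (by linarith [h.one_lt])
            zero_le_one, sub_add_cancel]
      _ ≤ K1 ^ r * (|B| ^ (r - 1) * x) := by
          rw [Real.rpow_one]
          have := h.one_lt
          gcongr
      _ = _ := by ring
  have horth : ∀ m ∈ Λ \ A, ∀ f : Ω → ℝ, f = (fun ω => ∑ i ∈ Λ \ A with i < m, D i ω) →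
      ∫ ω, D m ω * (|f ω| ^ (r - 2) * f ω) ∂μ = 0 := by
    intro m hm f hf
    have hmA := (Finset.mem_sdiff.1 hm).2
    -- An earlier `D i` involves only indices up to `i` and indices in `A`; `m` is neither.
    have hfm : Measurable[coordAlg ξ {m}ᶜ] f := by
      rw [hf]
      refine Finset.measurable_fun_sum _ fun i hi => Finset.measurable_fun_sum _ fun k _ => ?_
      have him := (Finset.mem_filter.1 hi).2
      refine measurable_remainderTerm Λ (a k) A i ?_ ?_ ?_
      · exact ne_of_lt him
      · exact fun l hl => ne_of_lt (hl.trans him)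
      · exact fun l hl _ hlm => hmA (hlm ▸ hl)
    have hfL : MemLp f (ENNReal.ofReal r) μ := by
      rw [hf]
      exact memLp_finsetSum _ fun i hi => hDL i (Finset.mem_filter.1 hi).1
    have hDeq : ∀ ω, D m ω = ∑ z ∈ T ×ˢ Finset.HasAntidiagonal.antidiagonal s,
        PowerSeries.coeff z.2.1 (higherSeries μ ξ (a z.1 m) m ω) *
          outerCoeff μ ξ Λ (a z.1) A m z.2.2 ω := by
      intro ω
      rw [Finset.sum_product]
      rfl
    simp only [hDeq]
    have hz : ∀ z ∈ T ×ˢ Finset.HasAntidiagonal.antidiagonal s,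
        z.1 ∈ T ∧ z.2.1 ≤ s ∧ z.2.2 ≤ s := by
      intro z hz
      have h1 := Finset.HasAntidiagonal.mem_antidiagonal.1 (Finset.mem_product.1 hz).2
      exact ⟨(Finset.mem_product.1 hz).1, by omega, by omega⟩
    have ham : ∀ z ∈ T ×ˢ Finset.HasAntidiagonal.antidiagonal s, a z.1 m ^ 2 ≤ B := fun z hz' =>
      (Finset.single_le_sum (f := fun l => a z.1 l ^ 2) (fun l _ => sq_nonneg _)
        (Finset.mem_sdiff.1 hm).1).trans (hrow z.1 (hz z hz').1)
    refine h.integral_mul_rpow_eq_zero (T ×ˢ Finset.HasAntidiagonal.antidiagonal s) m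
      (fun z ω => PowerSeries.coeff z.2.1 (higherSeries μ ξ (a z.1 m) m ω))
      (fun z => outerCoeff μ ξ Λ (a z.1) A m z.2.2) f
      (fun z _ => measurable_coeff_higherSeries _ m _)
      (fun z hz' => (hb3 (a z.1 m) m z.2.1 (ham z hz') (hz z hz').2.1).1.integrable hr1)
      (fun z hz' => (hb3 (a z.1 m) m z.2.1 (ham z hz') (hz z hz').2.1).2.1)
      (fun z _ => measurable_outerCoeff Λ _ A m _ (fun l hl => ne_of_lt hl)
        fun l _ hl => ne_of_gt hl)
      (fun z hz' => (hb2 Λ (a z.1) A m z.2.2 (hrow z.1 (hz z hz').1) (hz z hz').2.2).1) hfm hfL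
  have hS : MemLp (fun ω => ∑ m ∈ Λ \ A, D m ω) (ENNReal.ofReal r) μ :=
    memLp_finsetSum _ fun m hm => hDL m hm
  refine ⟨hS, ?_⟩
  have hT : (∑ m ∈ Λ \ A, ∑ k ∈ T, a k m ^ 2) ≤ |B| * T.card := by
    rw [Finset.sum_comm]
    calc ∑ k ∈ T, ∑ m ∈ Λ \ A, a k m ^ 2 ≤ ∑ k ∈ T, |B| := by
          refine Finset.sum_le_sum fun k hk => ?_
          exact (Finset.sum_le_sum_of_subset_of_nonneg Finset.sdiff_subset fun _ _ _ =>
            sq_nonneg _).trans ((hrow k hk).trans (le_abs_self B))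
      _ = |B| * T.card := by rw [Finset.sum_const, nsmul_eq_mul, mul_comm]
  have hfin : lpNorm (fun ω => ∑ m ∈ Λ \ A, D m ω) (ENNReal.ofReal r) μ ^ r ≤ M * T.card := by
    rw [lpNorm_rpow_eq_integral hr0 hS.1]
    refine (integral_abs_sum_rpow_le h.one_lt h.le_two (Λ \ A) D hDL horth).trans ?_
    calc C0 * ∑ m ∈ Λ \ A, ∫ ω, |D m ω| ^ r ∂μ
        ≤ C0 * ∑ m ∈ Λ \ A, K1 ^ r * |B| ^ (r - 1) * ∑ k ∈ T, a k m ^ 2 := by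
          gcongr with m hm
          exact hDn m hm
      _ ≤ C0 * (K1 ^ r * |B| ^ (r - 1) * (|B| * T.card)) := by
          rw [← Finset.mul_sum]
          gcongr
      _ = M * T.card := by rw [hM]; ring
  rw [← Real.mul_rpow hM0 (Nat.cast_nonneg _)]
  rwa [Real.le_rpow_inv_iff_of_pos lpNorm_nonneg (by positivity) hr0]

/-- The difference between the sums of the `s`-th powers and of their multilinear parts. -/
theorem exists_remainder_sum_bound (h : Innovations μ ξ s r) (B : ℝ) :
    ∃ K : ℝ, 0 ≤ K ∧ ∀ (T : Finset ℤ) (a : ℤ → ℤ → ℝ) (Λ : Finset ℤ),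
      (∀ k ∈ T, ∑ l ∈ Λ, a k l ^ 2 ≤ B) → (∀ l ∈ Λ, ∑ k ∈ T, a k l ^ 2 ≤ B) →
      MemLp (fun ω => ∑ k ∈ T, ((∑ l ∈ Λ, a k l * ξ l ω) ^ s -
        s.factorial * multilinearPart μ ξ s Λ (a k) ω)) (ENNReal.ofReal r) μ ∧
      lpNorm (fun ω => ∑ k ∈ T, ((∑ l ∈ Λ, a k l * ξ l ω) ^ s -
        s.factorial * multilinearPart μ ξ s Λ (a k) ω)) (ENNReal.ofReal r) μ ≤
          K * (T.card : ℝ) ^ r⁻¹ := by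
  obtain ⟨K, hK, hb⟩ := h.exists_decoupled_sum_bound B
  have hr1 : (1 : ENNReal) ≤ ENNReal.ofReal r := by
    rw [ENNReal.one_le_ofReal]; exact h.one_lt.le
  refine ⟨2 * s.factorial * K, by positivity, fun T a Λ hrow hcol => ?_⟩
  set c : ℝ := (2 ^ Λ.card)⁻¹ * (2 * s.factorial) with hc
  have hc0 : 0 ≤ c := by positivity
  set E : Finset ℤ → Ω → ℝ := fun A ω =>
    ∑ m ∈ Λ \ A, ∑ k ∈ T, remainderTerm μ ξ s Λ (a k) A m ω with hE
  have heq : (fun ω => ∑ k ∈ T, ((∑ l ∈ Λ, a k l * ξ l ω) ^ s -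
        s.factorial * multilinearPart μ ξ s Λ (a k) ω)) = c • ∑ A ∈ Λ.powerset, E A := by
    funext ω
    have h2 : (2 : ℝ) ^ Λ.card ≠ 0 := by positivity
    rw [Pi.smul_apply, Finset.sum_apply, smul_eq_mul, hc, mul_assoc, eq_inv_mul_iff_mul_eq₀ h2,
      Finset.mul_sum]
    simp only [pow_sub_multilinearPart]
    rw [Finset.sum_comm, Finset.mul_sum]
    refine Finset.sum_congr rfl fun A _ => ?_
    rw [Finset.sum_comm, hE, Finset.mul_sum]
    refine Finset.sum_congr rfl fun m _ => ?_
    rw [Finset.mul_sum]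
  rw [heq]
  have hE1 : ∀ A ∈ Λ.powerset, MemLp (E A) (ENNReal.ofReal r) μ := fun A _ =>
    (hb T a Λ A hrow hcol).1
  refine ⟨(memLp_finsetSum' _ hE1).const_smul c, ?_⟩
  rw [lpNorm_const_smul]
  have h1 : (‖c‖₊ : ℝ) = c := by simp [abs_of_nonneg hc0]
  rw [h1]
  -- The number of subsets cancels the normalisation in `c`, so the bound does not depend on `Λ`.
  calc c * lpNorm (∑ A ∈ Λ.powerset, E A) (ENNReal.ofReal r) μ
      ≤ c * ∑ A ∈ Λ.powerset, K * (T.card : ℝ) ^ r⁻¹ := by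
        gcongr
        refine (lpNorm_sum_le hE1 hr1).trans (Finset.sum_le_sum fun A _ => ?_)
        exact (hb T a Λ A hrow hcol).2
    _ = _ := by
        rw [Finset.sum_const, Finset.card_powerset, nsmul_eq_mul, hc]
        push_cast
        field_simp

/-- Orthogonality reduces the second moment to a sum over `I`. Monomials of degree between `1` and
`d - 1` vanish by hypothesis, and `sum_powerset_filter_prod_le` sums the others. -/
theorem exists_multilinear_sum_bound (h : Innovations μ ξ s r) (B : ℝ) (d : ℕ) (hd1 : 1 ≤ d)
    (hd : ∀ (a : ℤ → ℝ) (Λ : Finset ℤ) (i : ℕ), 1 ≤ i → i < d → i ≤ s →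
      PowerSeries.coeff (s - i) (∏ l ∈ Λ, momentSeries μ ξ (a l)) = 0) :
    ∃ K : ℝ, 0 ≤ K ∧ ∀ (T : Finset ℤ) (a : ℤ → ℤ → ℝ) (Λ : Finset ℤ),
      (∀ k ∈ T, ∑ l ∈ Λ, a k l ^ 2 ≤ B) →
      MemLp (fun ω => ∑ k ∈ T, (multilinearPart μ ξ s Λ (a k) ω -
        PowerSeries.coeff s (∏ l ∈ Λ, momentSeries μ ξ (a k l)))) 2 μ ∧
      ∫ ω, (∑ k ∈ T, (multilinearPart μ ξ s Λ (a k) ω -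
        PowerSeries.coeff s (∏ l ∈ Λ, momentSeries μ ξ (a k l)))) ^ 2 ∂μ ≤
          K * ∑ k ∈ T, ∑ k' ∈ T, (∑ l ∈ Λ, |a k l| * |a k' l|) ^ d := by
  obtain ⟨K, hK0, hK⟩ := h.exists_coeff_momentSeries_bound B
  set m2 := ∫ ω, ξ 1 ω ^ 2 ∂μ with hm2
  have hm2' : 0 ≤ m2 := integral_nonneg fun ω => sq_nonneg _
  refine ⟨K ^ 2 * (m2 ^ d * Real.exp (B * m2)), by positivity, fun T a Λ hrow => ?_⟩
  set t : ℤ → Finset ℤ → ℝ := fun k I => (if I.card ≤ s then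
    PowerSeries.coeff (s - I.card) (∏ l ∈ Λ \ I, momentSeries μ ξ (a k l)) else 0) *
      ∏ l ∈ I, a k l with ht
  -- The empty monomial is the constant removed by the centring.
  set t' : ℤ → Finset ℤ → ℝ := fun k I => if I = ∅ then 0 else t k I with ht'
  have hpart : ∀ k ω, multilinearPart μ ξ s Λ (a k) ω -
      PowerSeries.coeff s (∏ l ∈ Λ, momentSeries μ ξ (a k l)) =
      ∑ I ∈ Λ.powerset, t' k I * ∏ l ∈ I, ξ l ω := by
    intro k ω
    have h0 : PowerSeries.coeff s (∏ l ∈ Λ, momentSeries μ ξ (a k l)) =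
        ∑ I ∈ Λ.powerset, if I = ∅ then t k ∅ else 0 := by
      rw [Finset.sum_ite_eq' Λ.powerset, if_pos (Finset.empty_mem_powerset Λ)]
      simp [ht]
    rw [multilinearPart, coeff_prod_add_linear (fun l => momentSeries μ ξ (a k l)) (a k)
      (fun l => ξ l ω), h0, ← Finset.sum_sub_distrib]
    refine Finset.sum_congr rfl fun I _ => ?_
    by_cases hI : I = ∅
    · subst hI; simp [ht, ht']
    · simp only [ht', if_neg hI, sub_zero, ht]
  have hsum : ∀ ω, ∑ k ∈ T, (multilinearPart μ ξ s Λ (a k) ω -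
      PowerSeries.coeff s (∏ l ∈ Λ, momentSeries μ ξ (a k l))) =
      ∑ I ∈ Λ.powerset, (∑ k ∈ T, t' k I) * ∏ l ∈ I, ξ l ω := by
    intro ω
    simp only [hpart, Finset.sum_mul]
    exact Finset.sum_comm
  simp only [hsum]
  obtain ⟨h1, h2⟩ := h.multilinear_sq (fun I => ∑ k ∈ T, t' k I) Λ
  refine ⟨h1, h2.le.trans ?_⟩
  have hbound : ∀ k ∈ T, ∀ I, I ⊆ Λ →
      |t' k I| ≤ if d ≤ I.card then K * ∏ l ∈ I, |a k l| else 0 := by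
    intro k hk I hI
    by_cases hI0 : I = ∅
    · subst hI0
      have hd0 : ¬d ≤ (∅ : Finset ℤ).card := by rw [Finset.card_empty]; omega
      simp only [ht', if_true, abs_zero, if_neg hd0, le_refl]
    · simp only [ht', if_neg hI0, ht]
      have hI1 : 1 ≤ I.card := Finset.card_pos.2 (Finset.nonempty_iff_ne_empty.2 hI0)
      by_cases hdI : d ≤ I.card
      · rw [if_pos hdI, abs_mul, Finset.abs_prod]
        refine mul_le_mul_of_nonneg_right ?_ (Finset.prod_nonneg fun _ _ => abs_nonneg _)
        split_ifs
        · exact hK (a k) (Λ \ I) ((Finset.sum_le_sum_of_subset_of_nonneg Finset.sdiff_subset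
            fun _ _ _ => sq_nonneg _).trans (hrow k hk)) _ (Nat.sub_le _ _)
        · simpa using hK0
      · rw [if_neg hdI]
        split_ifs with hs
        · rw [hd (a k) (Λ \ I) I.card hI1 (not_le.1 hdI) hs]; simp
        · simp
  calc ∑ I ∈ Λ.powerset, (∑ k ∈ T, t' k I) ^ 2 * m2 ^ I.card
      ≤ ∑ I ∈ Λ.powerset, (if d ≤ I.card then
          K ^ 2 * ∑ k ∈ T, ∑ k' ∈ T, ∏ l ∈ I, (|a k l| * |a k' l| * m2) else 0) := by
        refine Finset.sum_le_sum fun I hI => ?_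
        have hI' := Finset.mem_powerset.1 hI
        have h3 : |∑ k ∈ T, t' k I| ≤ ∑ k ∈ T, if d ≤ I.card then K * ∏ l ∈ I, |a k l| else 0 :=
          (Finset.abs_sum_le_sum_abs _ _).trans (Finset.sum_le_sum fun k hk => hbound k hk I hI')
        split_ifs at h3 ⊢ with hdI
        · have h4 : (∑ k ∈ T, t' k I) ^ 2 ≤ (∑ k ∈ T, K * ∏ l ∈ I, |a k l|) ^ 2 := by
            rw [← sq_abs]
            gcongr
          refine (mul_le_mul_of_nonneg_right h4 (by positivity)).trans (le_of_eq ?_)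
          simp only [Finset.prod_mul_distrib, Finset.prod_const]
          rw [← Finset.mul_sum, mul_pow, sq (∑ k ∈ T, ∏ l ∈ I, |a k l|), Finset.sum_mul_sum,
            mul_assoc, Finset.sum_mul]
          simp only [Finset.sum_mul]
        · have h5 : ∑ k ∈ T, t' k I = 0 := by simpa using h3
          rw [h5]; simp
    _ = K ^ 2 * ∑ k ∈ T, ∑ k' ∈ T,
          ∑ I ∈ Λ.powerset with d ≤ I.card, ∏ l ∈ I, (|a k l| * |a k' l| * m2) := by
        rw [← Finset.sum_filter, ← Finset.mul_sum, Finset.sum_comm]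
        congr 1
        refine Finset.sum_congr rfl fun k _ => Finset.sum_comm
    _ ≤ K ^ 2 * ∑ k ∈ T, ∑ k' ∈ T,
          (∑ l ∈ Λ, |a k l| * |a k' l|) ^ d * (m2 ^ d * Real.exp (B * m2)) := by
        gcongr with k hk k' hk'
        refine (sum_powerset_filter_prod_le Λ (fun l => |a k l| * |a k' l| * m2)
          (fun l => by positivity) d).trans ?_
        rw [← Finset.sum_mul, mul_pow, mul_assoc]
        have hU : ∑ l ∈ Λ, |a k l| * |a k' l| ≤ B := by
          calc ∑ l ∈ Λ, |a k l| * |a k' l| ≤ ∑ l ∈ Λ, (a k l ^ 2 + a k' l ^ 2) / 2 := by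
                refine Finset.sum_le_sum fun l _ => ?_
                rw [← sq_abs (a k l), ← sq_abs (a k' l)]
                nlinarith [sq_nonneg (|a k l| - |a k' l|)]
            _ = (∑ l ∈ Λ, a k l ^ 2 + ∑ l ∈ Λ, a k' l ^ 2) / 2 := by
                rw [← Finset.sum_div, Finset.sum_add_distrib]
            _ ≤ B := by linarith [hrow k hk, hrow k' hk']
        gcongr
    _ = _ := by
        simp only [← Finset.sum_mul]
        ring

end Innovations

/-! ### Decay of coefficient correlations. -/

section Convolution

theorem summable_one_add_abs_rpow {b : ℝ} (hb : 1 < b) :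
    Summable (fun l : ℤ => (1 + |(l : ℝ)|) ^ (-b)) := by
  have h : Summable (fun n : ℕ => (1 + (n : ℝ)) ^ (-b)) := by
    have h1 : Summable (fun n : ℕ => (n : ℝ) ^ (-b)) := Real.summable_nat_rpow.2 (by linarith)
    refine ((summable_nat_add_iff 1).2 h1).congr fun n => ?_
    push_cast
    rw [add_comm]
  refine Summable.of_nat_of_neg ?_ ?_ <;> simpa using h

theorem sum_sub_le_tsum {f : ℤ → ℝ} (hf : Summable f) (h0 : ∀ l, 0 ≤ f l) (k : ℤ) (Λ : Finset ℤ) :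
    ∑ l ∈ Λ, f (k - l) ≤ ∑' l, f l := by
  have hinj : Function.Injective fun l : ℤ => k - l := fun x y hxy => by simpa using hxy
  rw [← Finset.sum_image (s := Λ) (g := fun l => k - l) (f := f) (hinj.injOn)]
  exact hf.sum_le_tsum _ fun l _ => h0 l

theorem sum_sub_le_tsum' {f : ℤ → ℝ} (hf : Summable f) (h0 : ∀ l, 0 ≤ f l) (l : ℤ) (T : Finset ℤ) :
    ∑ k ∈ T, f (k - l) ≤ ∑' k, f k := by
  have hinj : Function.Injective fun k : ℤ => k - l := fun x y hxy => by simpa using hxy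
  rw [← Finset.sum_image (s := T) (g := fun k => k - l) (f := f) (hinj.injOn)]
  exact hf.sum_le_tsum _ fun l _ => h0 l

/-- The larger of `x` and `y` is at least `H / 2` and supplies the exponent `τ`; the remaining `1 +
ε` falls on the smaller one. -/
theorem rpow_mul_rpow_le_of_le_add {σ τ ε x y H : ℝ} (hτ : 0 ≤ τ) (hστ : τ ≤ σ)
    (he : 2 * σ = τ + (1 + ε)) (hx : 0 < x) (hy : 0 < y) (hH : 0 < H) (hle : H ≤ x + y) :
    x ^ (-σ) * y ^ (-σ) ≤ 2 ^ τ * H ^ (-τ) * (x ^ (-(1 + ε)) + y ^ (-(1 + ε))) := by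
  wlog hxy : x ≤ y generalizing x y with hwlog
  · have := hwlog hy hx (by linarith) (le_of_not_ge hxy)
    rw [mul_comm (x ^ (-σ)), add_comm (x ^ (-(1 + ε)))]
    exact this
  · have h1 : y ^ (-σ) = y ^ (-τ) * y ^ (-(σ - τ)) := by
      rw [← Real.rpow_add hy]; congr 1; ring
    have h2 : y ^ (-(σ - τ)) ≤ x ^ (-(σ - τ)) :=
      Real.rpow_le_rpow_of_nonpos hx hxy (by linarith)
    have h3 : y ^ (-τ) ≤ 2 ^ τ * H ^ (-τ) := by
      have : (H / 2) ^ (-τ) = 2 ^ τ * H ^ (-τ) := by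
        rw [Real.div_rpow hH.le two_pos.le, Real.rpow_neg two_pos.le τ]
        field_simp
      rw [← this]
      exact Real.rpow_le_rpow_of_nonpos (by linarith) (by linarith) (by linarith)
    have h4 : x ^ (-σ) * x ^ (-(σ - τ)) = x ^ (-(1 + ε)) := by
      rw [← Real.rpow_add hx]; congr 1; linarith
    calc x ^ (-σ) * y ^ (-σ) ≤ x ^ (-σ) * (2 ^ τ * H ^ (-τ) * x ^ (-(σ - τ))) := by
          rw [h1]; gcongr
      _ = 2 ^ τ * H ^ (-τ) * x ^ (-(1 + ε)) := by rw [← h4]; ring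
      _ ≤ _ := by
          gcongr
          exact le_add_of_nonneg_right (by positivity)

theorem exists_convolution_bound {c : ℤ → ℝ} {σ τ ε C : ℝ} (hε : 0 < ε) (hτ : 0 ≤ τ)
    (hστ : τ ≤ σ) (he : 2 * σ = τ + (1 + ε)) (hC : 0 ≤ C)
    (hc : ∀ l : ℤ, |c l| ≤ C * (1 + |(l : ℝ)|) ^ (-σ)) :
    ∃ K : ℝ, 0 ≤ K ∧ ∀ (k k' : ℤ) (Λ : Finset ℤ),
      ∑ l ∈ Λ, |c (k - l)| * |c (k' - l)| ≤ K * (1 + |((k - k' : ℤ) : ℝ)|) ^ (-τ) := by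
  have hsum := summable_one_add_abs_rpow (b := 1 + ε) (by linarith)
  set Z := ∑' l : ℤ, (1 + |(l : ℝ)|) ^ (-(1 + ε)) with hZ
  have hpos : ∀ l : ℤ, 0 ≤ (1 + |(l : ℝ)|) ^ (-(1 + ε)) := fun l => by positivity
  have hZ0 : 0 ≤ Z := tsum_nonneg hpos
  refine ⟨C ^ 2 * (2 ^ τ * (Z + Z)), by positivity, fun k k' Λ => ?_⟩
  set H : ℝ := 1 + |((k - k' : ℤ) : ℝ)| with hH
  calc ∑ l ∈ Λ, |c (k - l)| * |c (k' - l)|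
      ≤ ∑ l ∈ Λ, C ^ 2 * (2 ^ τ * H ^ (-τ)) * ((1 + |((k - l : ℤ) : ℝ)|) ^ (-(1 + ε)) +
          (1 + |((k' - l : ℤ) : ℝ)|) ^ (-(1 + ε))) := by
        refine Finset.sum_le_sum fun l _ => ?_
        calc |c (k - l)| * |c (k' - l)|
            ≤ (C * (1 + |((k - l : ℤ) : ℝ)|) ^ (-σ)) * (C * (1 + |((k' - l : ℤ) : ℝ)|) ^ (-σ)) := by
              gcongr
              · exact hc _
              · exact hc _
          _ = C ^ 2 * ((1 + |((k - l : ℤ) : ℝ)|) ^ (-σ) * (1 + |((k' - l : ℤ) : ℝ)|) ^ (-σ)) := by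
              ring
          _ ≤ C ^ 2 * (2 ^ τ * H ^ (-τ) * ((1 + |((k - l : ℤ) : ℝ)|) ^ (-(1 + ε)) +
                (1 + |((k' - l : ℤ) : ℝ)|) ^ (-(1 + ε)))) := by
              refine mul_le_mul_of_nonneg_left ?_ (sq_nonneg C)
              refine rpow_mul_rpow_le_of_le_add hτ hστ he (by positivity) (by positivity)
                (by positivity) ?_
              have h1 : ((k - k' : ℤ) : ℝ) = ((k - l : ℤ) : ℝ) - ((k' - l : ℤ) : ℝ) := by
                push_cast; ring
              rw [hH, h1]
              have := abs_sub (((k - l : ℤ) : ℝ)) (((k' - l : ℤ) : ℝ))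
              linarith
          _ = _ := by ring
    _ = C ^ 2 * (2 ^ τ * H ^ (-τ)) * (∑ l ∈ Λ, (1 + |((k - l : ℤ) : ℝ)|) ^ (-(1 + ε)) +
          ∑ l ∈ Λ, (1 + |((k' - l : ℤ) : ℝ)|) ^ (-(1 + ε))) := by
        rw [← Finset.mul_sum, Finset.sum_add_distrib]
    _ ≤ C ^ 2 * (2 ^ τ * H ^ (-τ)) * (Z + Z) := by
        gcongr
        · exact sum_sub_le_tsum hsum hpos k Λ
        · exact sum_sub_le_tsum hsum hpos k' Λ
    _ = _ := by ring

/-- Distances are at most `n`, so the nonnegative power `1 + ε - θ` of them can be traded for `n`,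
leaving a summable exponent. -/
theorem exists_block_sum_bound {ε θ : ℝ} (hε : 0 < ε) (hθ : θ ≤ 1) :
    ∃ K : ℝ, 0 ≤ K ∧ ∀ (n : ℕ) (T : Finset ℤ), T.card ≤ n →
      (∀ k ∈ T, ∀ k' ∈ T, 1 + |((k - k' : ℤ) : ℝ)| ≤ n) →
      ∑ k ∈ T, ∑ k' ∈ T, (1 + |((k - k' : ℤ) : ℝ)|) ^ (-θ) ≤ K * (n * (n : ℝ) ^ (1 + ε - θ)) := by
  have hsum := summable_one_add_abs_rpow (b := 1 + ε) (by linarith)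
  set Z := ∑' l : ℤ, (1 + |(l : ℝ)|) ^ (-(1 + ε)) with hZ
  have hpos : ∀ l : ℤ, 0 ≤ (1 + |(l : ℝ)|) ^ (-(1 + ε)) := fun l => by positivity
  have hZ0 : 0 ≤ Z := tsum_nonneg hpos
  refine ⟨Z, hZ0, fun n T hn hT => ?_⟩
  calc ∑ k ∈ T, ∑ k' ∈ T, (1 + |((k - k' : ℤ) : ℝ)|) ^ (-θ)
      ≤ ∑ k ∈ T, ∑ k' ∈ T, (n : ℝ) ^ (1 + ε - θ) * (1 + |((k - k' : ℤ) : ℝ)|) ^ (-(1 + ε)) := by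
        refine Finset.sum_le_sum fun k hk => Finset.sum_le_sum fun k' hk' => ?_
        have h0 : 0 < 1 + |((k - k' : ℤ) : ℝ)| := by positivity
        have h1 : (1 + |((k - k' : ℤ) : ℝ)|) ^ (-θ) = (1 + |((k - k' : ℤ) : ℝ)|) ^ (1 + ε - θ) *
            (1 + |((k - k' : ℤ) : ℝ)|) ^ (-(1 + ε)) := by
          rw [← Real.rpow_add h0]; congr 1; ring
        rw [h1]
        have h2 : 0 ≤ 1 + ε - θ := by linarith
        gcongr
        exact hT k hk k' hk'
    _ ≤ ∑ k ∈ T, (n : ℝ) ^ (1 + ε - θ) * Z := by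
        refine Finset.sum_le_sum fun k _ => ?_
        rw [← Finset.mul_sum]
        gcongr
        exact sum_sub_le_tsum hsum hpos k T
    _ = Z * (T.card * (n : ℝ) ^ (1 + ε - θ)) := by
        rw [Finset.sum_const, nsmul_eq_mul]; ring
    _ ≤ _ := by gcongr

theorem exists_decay_bound {c : ℤ → ℝ} {σ : ℝ} (hσ : 0 ≤ σ)
    (hdecay : ∃ C : ℝ, ∀ l : ℤ, |(l : ℝ)| ^ σ * |c l| ≤ C) :
    ∃ C : ℝ, 0 ≤ C ∧ ∀ l : ℤ, |c l| ≤ C * (1 + |(l : ℝ)|) ^ (-σ) := by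
  obtain ⟨C, hC⟩ := hdecay
  refine ⟨|c 0| + 2 ^ σ * |C|, by positivity, fun l => ?_⟩
  have h0 : 0 < 1 + |(l : ℝ)| := by positivity
  rw [Real.rpow_neg h0.le, ← div_eq_mul_inv, le_div_iff₀ (by positivity)]
  rcases eq_or_ne l 0 with rfl | hl
  · simp only [Int.cast_zero, abs_zero, add_zero, Real.one_rpow, mul_one]
    exact le_add_of_nonneg_right (by positivity)
  · have h1 : (1 : ℝ) ≤ |(l : ℝ)| := by
      have : 1 ≤ |l| := Int.one_le_abs hl
      exact_mod_cast this
    calc |c l| * (1 + |(l : ℝ)|) ^ σ ≤ |c l| * (2 * |(l : ℝ)|) ^ σ := by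
          gcongr; linarith
      _ = 2 ^ σ * (|(l : ℝ)| ^ σ * |c l|) := by
          rw [Real.mul_rpow two_pos.le (abs_nonneg _)]; ring
      _ ≤ 2 ^ σ * |C| := by
          gcongr
          exact (hC l).trans (le_abs_self C)
      _ ≤ _ := le_add_of_nonneg_left (abs_nonneg _)

theorem summable_sq_of_decay {c : ℤ → ℝ} {σ C : ℝ} (hσ : 1 / 2 < σ)
    (hc : ∀ l : ℤ, |c l| ≤ C * (1 + |(l : ℝ)|) ^ (-σ)) : Summable (fun l => c l ^ 2) := by
  refine Summable.of_nonneg_of_le (fun l => sq_nonneg _) (fun l => ?_)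
    ((summable_one_add_abs_rpow (b := 2 * σ) (by linarith)).mul_left (C ^ 2))
  have h0 : 0 < 1 + |(l : ℝ)| := by positivity
  calc c l ^ 2 = |c l| ^ 2 := (sq_abs _).symm
    _ ≤ (C * (1 + |(l : ℝ)|) ^ (-σ)) ^ 2 := by
        gcongr
        exact hc l
    _ = C ^ 2 * (1 + |(l : ℝ)|) ^ (-(2 * σ)) := by
        rw [mul_pow, ← Real.rpow_natCast ((1 + |(l : ℝ)|) ^ (-σ)) 2, ← Real.rpow_mul h0.le]
        congr 2; push_cast; ring

end Convolution

/-! ### From second moments to `L^r` norms. -/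

section LpNormTwo

variable {Ω : Type*} [MeasurableSpace Ω] {μ : Measure Ω} [IsProbabilityMeasure μ]

theorem lpNorm_le_of_integral_sq_le_sq {f : Ω → ℝ} {r M : ℝ} (hr2 : r ≤ 2)
    (hf : MemLp f 2 μ) (hM : 0 ≤ M) (h : ∫ ω, f ω ^ 2 ∂μ ≤ M ^ 2) :
    lpNorm f (ENNReal.ofReal r) μ ≤ M := by
  have hle : ENNReal.ofReal r ≤ 2 := by
    rw [← ENNReal.ofReal_ofNat]; exact ENNReal.ofReal_le_ofReal hr2
  have h1 : lpNorm f (ENNReal.ofReal r) μ ≤ lpNorm f 2 μ := by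
    rw [← toReal_eLpNorm hf.1, ← toReal_eLpNorm hf.1]
    exact ENNReal.toReal_mono hf.eLpNorm_ne_top (eLpNorm_le_eLpNorm_of_exponent_le hle hf.1)
  refine h1.trans (le_of_sq_le_sq ?_ hM)
  have h2 := lpNorm_rpow_eq_integral (q := 2) two_pos hf.1
  simp only [Real.rpow_two, sq_abs, ENNReal.ofReal_ofNat] at h2
  rw [h2]; exact h

end LpNormTwo

/-! ### Block bounds uniform over finite sections. -/

namespace Innovations

variable {Ω : Type*} [MeasurableSpace Ω] {μ : Measure Ω} {ξ : ℤ → Ω → ℝ} {s : ℕ} {r : ℝ}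
  [IsProbabilityMeasure μ]

/-- Block sums of centred powers of finite sections of the linear process. -/
theorem exists_window_bound (h : Innovations μ ξ s r) {c : ℤ → ℝ} {σ ε θ β C : ℝ} {d : ℕ}
    (hσ : 1 / 2 < σ) (hσ1 : σ ≤ 1) (hC : 0 ≤ C)
    (hc : ∀ l : ℤ, |c l| ≤ C * (1 + |(l : ℝ)|) ^ (-σ)) (hd1 : 1 ≤ d)
    (hd : ∀ (a : ℤ → ℝ) (Λ : Finset ℤ) (i : ℕ), 1 ≤ i → i < d → i ≤ s →
      PowerSeries.coeff (s - i) (∏ l ∈ Λ, momentSeries μ ξ (a l)) = 0)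
    (hε : 0 < ε) (hεσ : ε ≤ 2 * σ - 1) (hθ1 : θ ≤ 1) (hθ : θ ≤ d * (2 * σ - 1 - ε))
    (hβr : r⁻¹ ≤ β) (hβ : 2 + ε - θ ≤ 2 * β) :
    ∃ K : ℝ, 0 ≤ K ∧ ∀ (n : ℕ) (T Λ : Finset ℤ), 1 ≤ n → T.card ≤ n →
      (∀ k ∈ T, ∀ k' ∈ T, 1 + |((k - k' : ℤ) : ℝ)| ≤ n) →
      MemLp (fun ω => ∑ k ∈ T, ((∑ l ∈ Λ, c (k - l) * ξ l ω) ^ s -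
        ∫ ω', (∑ l ∈ Λ, c (k - l) * ξ l ω') ^ s ∂μ)) (ENNReal.ofReal r) μ ∧
      lpNorm (fun ω => ∑ k ∈ T, ((∑ l ∈ Λ, c (k - l) * ξ l ω) ^ s -
        ∫ ω', (∑ l ∈ Λ, c (k - l) * ξ l ω') ^ s ∂μ)) (ENNReal.ofReal r) μ ≤ K * (n : ℝ) ^ β := by
  have hsq := summable_sq_of_decay hσ hc
  set B := ∑' l, c l ^ 2 with hB
  obtain ⟨K1, hK1, hb1⟩ := h.exists_remainder_sum_bound B
  obtain ⟨K2, hK2, hb2⟩ := h.exists_multilinear_sum_bound B d hd1 hd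
  obtain ⟨K3, hK3, hb3⟩ := exists_convolution_bound (τ := 2 * σ - 1 - ε) hε (by linarith)
    (by linarith) (by ring) hC hc
  obtain ⟨K4, hK4, hb4⟩ := exists_block_sum_bound hε hθ1
  have hr1 : (1 : ENNReal) ≤ ENNReal.ofReal r := by
    rw [ENNReal.one_le_ofReal]; exact h.one_lt.le
  have hr0 := h.r_pos
  refine ⟨K1 + s.factorial * √(K2 * (K3 ^ d * K4)), by positivity, fun n T Λ hn hT hT2 => ?_⟩
  have hn1 : (1 : ℝ) ≤ n := by exact_mod_cast hn
  have hn0 : (0 : ℝ) < n := by linarith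
  have hrow : ∀ k ∈ T, ∑ l ∈ Λ, c (k - l) ^ 2 ≤ B := fun k _ =>
    sum_sub_le_tsum hsq (fun l => sq_nonneg _) k Λ
  have hcol : ∀ l ∈ Λ, ∑ k ∈ T, c (k - l) ^ 2 ≤ B := fun l _ =>
    sum_sub_le_tsum' hsq (fun l => sq_nonneg _) l T
  obtain ⟨p1, p2⟩ := hb1 T (fun k l => c (k - l)) Λ hrow hcol
  obtain ⟨q1, q2⟩ := hb2 T (fun k l => c (k - l)) Λ hrow
  set P : Ω → ℝ := fun ω => ∑ k ∈ T, ((∑ l ∈ Λ, c (k - l) * ξ l ω) ^ s -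
    s.factorial * multilinearPart μ ξ s Λ (fun l => c (k - l)) ω) with hP
  set Q : Ω → ℝ := fun ω => ∑ k ∈ T, (multilinearPart μ ξ s Λ (fun l => c (k - l)) ω -
    PowerSeries.coeff s (∏ l ∈ Λ, momentSeries μ ξ (c (k - l)))) with hQ
  have hcov : ∑ k ∈ T, ∑ k' ∈ T, (∑ l ∈ Λ, |c (k - l)| * |c (k' - l)|) ^ d ≤
      K3 ^ d * K4 * ((n : ℝ) ^ β) ^ 2 := by
    calc ∑ k ∈ T, ∑ k' ∈ T, (∑ l ∈ Λ, |c (k - l)| * |c (k' - l)|) ^ d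
        ≤ ∑ k ∈ T, ∑ k' ∈ T, K3 ^ d * (1 + |((k - k' : ℤ) : ℝ)|) ^ (-θ) := by
          refine Finset.sum_le_sum fun k hk => Finset.sum_le_sum fun k' hk' => ?_
          have h0 : 0 < 1 + |((k - k' : ℤ) : ℝ)| := by positivity
          calc (∑ l ∈ Λ, |c (k - l)| * |c (k' - l)|) ^ d
              ≤ (K3 * (1 + |((k - k' : ℤ) : ℝ)|) ^ (-(2 * σ - 1 - ε))) ^ d := by
                refine pow_le_pow_left₀ (Finset.sum_nonneg fun l _ => by positivity) ?_ d
                exact hb3 k k' Λ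
            _ = K3 ^ d * (1 + |((k - k' : ℤ) : ℝ)|) ^ (-(d * (2 * σ - 1 - ε))) := by
                rw [mul_pow, ← Real.rpow_natCast _ d, ← Real.rpow_natCast _ d, ← Real.rpow_mul h0.le]
                congr 2; ring
            _ ≤ _ := by
                refine mul_le_mul_of_nonneg_left ?_ (by positivity)
                refine Real.rpow_le_rpow_of_exponent_le ?_ (by linarith)
                exact le_add_of_nonneg_right (abs_nonneg _)
      _ ≤ K3 ^ d * (K4 * (n * (n : ℝ) ^ (1 + ε - θ))) := by
          simp only [← Finset.mul_sum]
          gcongr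
          exact hb4 n T hT hT2
      _ ≤ K3 ^ d * (K4 * ((n : ℝ) ^ β) ^ 2) := by
          gcongr
          have e1 : (n : ℝ) * (n : ℝ) ^ (1 + ε - θ) = (n : ℝ) ^ (2 + ε - θ) := by
            nth_rewrite 1 [← Real.rpow_one (n : ℝ)]
            rw [← Real.rpow_add hn0]; congr 1; ring
          have e2 : ((n : ℝ) ^ β) ^ 2 = (n : ℝ) ^ (2 * β) := by
            rw [← Real.rpow_natCast, ← Real.rpow_mul hn0.le]; congr 1; push_cast; ring
          rw [e1, e2]
          exact Real.rpow_le_rpow_of_exponent_le hn1 hβ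
      _ = _ := by ring
  have hQn : lpNorm Q (ENNReal.ofReal r) μ ≤ √(K2 * (K3 ^ d * K4)) * (n : ℝ) ^ β := by
    refine lpNorm_le_of_integral_sq_le_sq h.le_two q1 (by positivity) (q2.trans ?_)
    rw [mul_pow, Real.sq_sqrt (by positivity), mul_assoc]
    exact mul_le_mul_of_nonneg_left hcov hK2
  have hQr : MemLp Q (ENNReal.ofReal r) μ := q1.mono_exponent (by
    rw [← ENNReal.ofReal_ofNat]; exact ENNReal.ofReal_le_ofReal h.le_two)
  -- The coefficient subtracted in `Q`, times `s!`, is the expectation of the power, so the centring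
  -- sits entirely in `Q`.
  have heq : (fun ω => ∑ k ∈ T, ((∑ l ∈ Λ, c (k - l) * ξ l ω) ^ s -
        ∫ ω', (∑ l ∈ Λ, c (k - l) * ξ l ω') ^ s ∂μ)) = P + (s.factorial : ℝ) • Q := by
    funext ω
    simp only [hP, hQ, Pi.add_apply, Pi.smul_apply, smul_eq_mul]
    rw [Finset.mul_sum, ← Finset.sum_add_distrib]
    refine Finset.sum_congr rfl fun k _ => ?_
    rw [h.coeff_prod_momentSeries (fun l => c (k - l)) Λ le_rfl]
    field_simp
    ring
  rw [heq]
  refine ⟨p1.add (hQr.const_smul _), ?_⟩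
  refine (lpNorm_add_le p1 hr1).trans ?_
  rw [lpNorm_const_smul, add_mul]
  have hnn : (‖(s.factorial : ℝ)‖₊ : ℝ) = s.factorial := by simp
  rw [hnn, mul_assoc]
  refine add_le_add (p2.trans ?_) (by gcongr)
  refine mul_le_mul_of_nonneg_left ?_ hK1
  calc (T.card : ℝ) ^ r⁻¹ ≤ (n : ℝ) ^ r⁻¹ := by gcongr
    _ ≤ (n : ℝ) ^ β := Real.rpow_le_rpow_of_exponent_le hn1 hβr

end Innovations

/-! ### Passing to the limit under `L^r` bounds. -/

section LimitOfBounded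

variable {Ω : Type*} [MeasurableSpace Ω] {μ : Measure Ω}

theorem le_min_add_rpow {x r T : ℝ} (hx : 0 ≤ x) (hr : 1 < r) (hT : 0 < T) :
    x ≤ min x T + T ^ (1 - r) * x ^ r := by
  rcases le_total x T with h | h
  · rw [min_eq_left h]
    exact le_add_of_nonneg_right (by positivity)
  · have hx0 : 0 < x := by linarith
    have h1 : x = x ^ (1 - r) * x ^ r := by
      rw [← Real.rpow_add hx0]; simp
    have h2 : x ^ (1 - r) ≤ T ^ (1 - r) := Real.rpow_le_rpow_of_nonpos hT h (by linarith)
    have h3 : 0 ≤ min x T := le_min hx hT.le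
    calc x = x ^ (1 - r) * x ^ r := h1
      _ ≤ T ^ (1 - r) * x ^ r := by gcongr
      _ ≤ _ := le_add_of_nonneg_left h3

theorem memLp_lpNorm_le_of_tendsto_ae {f : ℕ → Ω → ℝ} {g : Ω → ℝ} {r M : ℝ}
    (hf : ∀ n, MemLp (f n) (ENNReal.ofReal r) μ)
    (hb : ∀ n, lpNorm (f n) (ENNReal.ofReal r) μ ≤ M)
    (hlim : ∀ᵐ ω ∂μ, Tendsto (fun n => f n ω) atTop (𝓝 (g ω))) :
    MemLp g (ENNReal.ofReal r) μ ∧ lpNorm g (ENNReal.ofReal r) μ ≤ M := by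
  have hM : 0 ≤ M := lpNorm_nonneg.trans (hb 0)
  have hg : AEStronglyMeasurable g μ := aestronglyMeasurable_of_tendsto_ae atTop (fun n => (hf n).1) hlim
  have h1 : eLpNorm g (ENNReal.ofReal r) μ ≤ ENNReal.ofReal M := by
    refine (Lp.eLpNorm_lim_le_liminf_eLpNorm (fun n => (hf n).1) g hlim).trans ?_
    refine liminf_le_of_frequently_le' (Frequently.of_forall fun n => ?_)
    rw [← ofReal_lpNorm (hf n)]
    exact ENNReal.ofReal_le_ofReal (hb n)
  refine ⟨⟨hg, h1.trans_lt ENNReal.ofReal_lt_top⟩, ?_⟩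
  rw [← toReal_eLpNorm hg]
  exact ENNReal.toReal_le_of_le_ofReal hM h1

variable [IsProbabilityMeasure μ]

/-- Convergence of expectations under almost sure convergence and boundedness in `L^r`, `r > 1`. -/
theorem tendsto_integral_of_lpNorm_le {f : ℕ → Ω → ℝ} {g : Ω → ℝ} {r M : ℝ} (hr : 1 < r)
    (hf : ∀ n, MemLp (f n) (ENNReal.ofReal r) μ)
    (hb : ∀ n, lpNorm (f n) (ENNReal.ofReal r) μ ≤ M)
    (hlim : ∀ᵐ ω ∂μ, Tendsto (fun n => f n ω) atTop (𝓝 (g ω))) :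
    Tendsto (fun n => ∫ ω, f n ω ∂μ) atTop (𝓝 (∫ ω, g ω ∂μ)) := by
  have hr0 : 0 < r := by linarith
  have hM : 0 ≤ M := lpNorm_nonneg.trans (hb 0)
  have hr1 : (1 : ENNReal) ≤ ENNReal.ofReal r := by
    rw [ENNReal.one_le_ofReal]; exact hr.le
  obtain ⟨hg, hgM⟩ := memLp_lpNorm_le_of_tendsto_ae hf hb hlim
  have hy : ∀ n, MemLp (f n - g) (ENNReal.ofReal r) μ := fun n => (hf n).sub hg
  have hyb : ∀ n, ∫ ω, |f n ω - g ω| ^ r ∂μ ≤ (M + M) ^ r := by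
    intro n
    have h1 := lpNorm_rpow_eq_integral hr0 (hy n).1
    have h2 : lpNorm (f n - g) (ENNReal.ofReal r) μ ≤ M + M :=
      (lpNorm_sub_le (hf n) hr1).trans (add_le_add (hb n) hgM)
    calc ∫ ω, |f n ω - g ω| ^ r ∂μ = lpNorm (f n - g) (ENNReal.ofReal r) μ ^ r := h1.symm
      _ ≤ _ := Real.rpow_le_rpow lpNorm_nonneg h2 hr0.le
  have hyi : ∀ n, Integrable (fun ω => |f n ω - g ω|) μ := fun n => ((hy n).integrable hr1).abs
  -- Truncate at `T`: the tail is uniformly small by the `L^r` bound, the truncated part tends to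
  -- zero by dominated convergence.
  have hkey : Tendsto (fun n => ∫ ω, |f n ω - g ω| ∂μ) atTop (𝓝 0) := by
    rw [Metric.tendsto_atTop]
    intro ε hε
    have hT : ∃ T : ℝ, 0 < T ∧ T ^ (1 - r) * (M + M) ^ r < ε / 2 := by
      have := (tendsto_rpow_neg_atTop (y := r - 1) (by linarith)).mul_const ((M + M) ^ r)
      rw [zero_mul] at this
      obtain ⟨T, hT, hT0⟩ := ((this.eventually (gt_mem_nhds (half_pos hε))).and
        (eventually_gt_atTop 0)).exists
      exact ⟨T, hT0, by simpa using hT⟩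
    obtain ⟨T, hT0, hT⟩ := hT
    have hdct : Tendsto (fun n => ∫ ω, min |f n ω - g ω| T ∂μ) atTop (𝓝 0) := by
      have : Tendsto (fun n => ∫ ω, min |f n ω - g ω| T ∂μ) atTop (𝓝 (∫ _ : Ω, (0 : ℝ) ∂μ)) := by
        refine tendsto_integral_of_dominated_convergence (fun _ => T) (fun n => ?_)
          (integrable_const T) (fun n => ae_of_all _ fun ω => ?_) ?_
        · exact ((hyi n).1.aemeasurable.min aemeasurable_const).aestronglyMeasurable
        · rw [Real.norm_of_nonneg (le_min (abs_nonneg _) hT0.le)]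
          exact min_le_right _ _
        · filter_upwards [hlim] with ω hω
          have h1 : Tendsto (fun n => |f n ω - g ω|) atTop (𝓝 0) := by
            have := (hω.sub_const (g ω)).abs
            simpa using this
          have h2 := h1.min (tendsto_const_nhds (x := T))
          rwa [min_eq_left hT0.le] at h2
      simpa using this
    obtain ⟨N, hN⟩ := eventually_atTop.1 (hdct.eventually (gt_mem_nhds (half_pos hε)))
    refine ⟨N, fun n hn => ?_⟩
    have h0 : 0 ≤ ∫ ω, |f n ω - g ω| ∂μ := integral_nonneg fun ω => abs_nonneg _
    rw [Real.dist_eq, sub_zero, abs_of_nonneg h0]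
    have hmin : Integrable (fun ω => min |f n ω - g ω| T) μ :=
      (hyi n).inf (integrable_const T)
    have hpow : Integrable (fun ω => |f n ω - g ω| ^ r) μ := (hy n).integrable_abs_rpow hr0
    calc ∫ ω, |f n ω - g ω| ∂μ
        ≤ ∫ ω, (min |f n ω - g ω| T + T ^ (1 - r) * |f n ω - g ω| ^ r) ∂μ :=
          integral_mono (hyi n) (hmin.add (hpow.const_mul _)) fun ω =>
            le_min_add_rpow (abs_nonneg _) hr hT0
      _ = ∫ ω, min |f n ω - g ω| T ∂μ + T ^ (1 - r) * ∫ ω, |f n ω - g ω| ^ r ∂μ := by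
          rw [integral_add hmin (hpow.const_mul _), integral_const_mul]
      _ ≤ ∫ ω, min |f n ω - g ω| T ∂μ + T ^ (1 - r) * (M + M) ^ r := by
          gcongr
          exact hyb n
      _ < ε := by linarith [hN n hn]
  rw [tendsto_iff_norm_sub_tendsto_zero]
  refine squeeze_zero (fun n => norm_nonneg _) (fun n => ?_) hkey
  rw [← integral_sub ((hf n).integrable hr1) (hg.integrable hr1)]
  exact norm_integral_le_integral_norm _

end LimitOfBounded

/-! ### The infinite series and the law of large numbers for it. -/

namespace Innovations

variable {Ω : Type*} [MeasurableSpace Ω] {μ : Measure Ω} {ξ : ℤ → Ω → ℝ} {s : ℕ} {r : ℝ}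
  [IsProbabilityMeasure μ]

theorem integral_abs_linear_le (h : Innovations μ ξ s r) (B : ℝ) :
    ∃ K : ℝ, 0 ≤ K ∧ ∀ (a : ℤ → ℝ) (Λ : Finset ℤ), ∑ l ∈ Λ, a l ^ 2 ≤ B →
      ∫ ω, |∑ l ∈ Λ, a l * ξ l ω| ∂μ ≤ K := by
  obtain ⟨K, hK1, hK⟩ := h.exists_moment_bound B
  refine ⟨1 + K, by linarith, fun a Λ ha => ?_⟩
  have hL := h.memLp_linear a Λ
  have h1 := h.two_le
  have hi : Integrable (fun ω => ∑ l ∈ Λ, a l * ξ l ω) μ :=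
    hL.integrable (by rw [ENNReal.one_le_ofReal]; linarith)
  have hq := hL.integrable_abs_rpow h.q_pos
  calc ∫ ω, |∑ l ∈ Λ, a l * ξ l ω| ∂μ
      ≤ ∫ ω, (1 + |∑ l ∈ Λ, a l * ξ l ω| ^ (s * r)) ∂μ := by
        refine integral_mono hi.abs ((integrable_const 1).add hq) fun ω => ?_
        have := rpow_le_one_add_rpow (p := 1) (q := s * r) (abs_nonneg (∑ l ∈ Λ, a l * ξ l ω))
          zero_le_one (by linarith)
        simpa using this
    _ = 1 + ∫ ω, |∑ l ∈ Λ, a l * ξ l ω| ^ (s * r) ∂μ := by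
        rw [integral_add (integrable_const 1) hq]; simp
    _ ≤ 1 + K := by linarith [hK a Λ ha]

/-- The partial sums along `e` form a martingale bounded in `L¹`. -/
theorem ae_exists_tendsto_sum (h : Innovations μ ξ s r) {a : ℤ → ℝ}
    (ha : Summable fun l => a l ^ 2) {e : ℕ → ℤ} (he : Function.Injective e) :
    ∀ᵐ ω ∂μ, ∃ x, Tendsto (fun N => ∑ i ∈ Finset.range N, a (e i) * ξ (e i) ω) atTop (𝓝 x) := by
  set η : ℕ → Ω → ℝ := fun i ω => a (e i) * ξ (e i) ω with hη
  have hηm : ∀ i, StronglyMeasurable (η i) := fun i =>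
    ((h.meas (e i)).const_mul _).stronglyMeasurable
  have hηi : ∀ i, Integrable (η i) μ := fun i => (h.integrable (e i)).const_mul _
  have hηindep : iIndepFun η μ :=
    (h.indep.precomp he).comp (fun i x => a (e i) * x) fun i => by fun_prop
  set M : ℕ → Ω → ℝ := fun n ω => ∑ i ∈ Finset.range (n + 1), η i ω with hM
  set 𝓖 := Filtration.natural η hηm with h𝓖
  have hadp : StronglyAdapted 𝓖 M := by
    intro n
    refine Finset.stronglyMeasurable_fun_sum _ fun i hi => ?_
    exact (Filtration.stronglyAdapted_natural hηm i).mono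
      (𝓖.mono (Nat.lt_succ_iff.1 (Finset.mem_range.1 hi)))
  have hint : ∀ n, Integrable (M n) μ := fun n => integrable_finsetSum _ fun i _ => hηi i
  have hmart : Martingale M 𝓖 μ := by
    refine martingale_of_condExp_sub_eq_zero_nat hadp hint fun n => ?_
    have h1 : M (n + 1) - M n = η (n + 1) := by
      funext ω
      simp [hM, Finset.sum_range_succ _ (n + 1)]
    rw [h1]
    refine (hηindep.condExp_natural_ae_eq_of_lt hηm (Nat.lt_succ_self n)).trans ?_
    have h2 : ∫ ω, η (n + 1) ω ∂μ = 0 := by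
      simp only [hη]
      rw [integral_const_mul, h.integral_eq_zero, mul_zero]
    rw [h2]
    rfl
  obtain ⟨K, hK0, hK⟩ := h.integral_abs_linear_le (∑' l, a l ^ 2)
  have hbdd : ∀ n, eLpNorm (M n) 1 μ ≤ (K.toNNReal : ENNReal) := by
    intro n
    rw [eLpNorm_one_eq_lintegral_enorm, ← ofReal_integral_norm_eq_lintegral_enorm (hint n)]
    refine ENNReal.ofReal_le_ofReal ?_
    have h3 : ∀ ω, M n ω = ∑ l ∈ (Finset.range (n + 1)).image e, a l * ξ l ω := fun ω => by
      rw [Finset.sum_image he.injOn]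
    simp only [h3, Real.norm_eq_abs]
    exact hK a _ (ha.sum_le_tsum _ fun l _ => sq_nonneg _)
  filter_upwards [hmart.submartingale.ae_tendsto_limitProcess hbdd] with ω hω
  exact ⟨_, (tendsto_add_atTop_iff_nat 1).1 hω⟩

/-- Splitting into nonnegative and negative indices gives two one-sided series that converge
separately, hence independent end points. -/
theorem linearPartialSum_eq {Ω : Type*} (c : ℤ → ℝ) (ξ : ℤ → Ω → ℝ) (k : ℤ) (ω : Ω) (w : ℕ × ℕ) :
    linearPartialSum c ξ k ω w =
      ∑ i ∈ Finset.range (w.2 + 1), c (k - (i : ℤ)) * ξ (i : ℤ) ω +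
        ∑ i ∈ Finset.range w.1, c (k - (-(i : ℤ) - 1)) * ξ (-(i : ℤ) - 1) ω := by
  have h1 : Function.Injective fun i : ℕ => (i : ℤ) := Nat.cast_injective
  have h2 : Function.Injective fun i : ℕ => -(i : ℤ) - 1 := fun i j hij => by
    simp only at hij; omega
  rw [linearPartialSum, ← Finset.sum_image (g := fun i : ℕ => (i : ℤ))
    (f := fun l => c (k - l) * ξ l ω) h1.injOn, ← Finset.sum_image (g := fun i : ℕ => -(i : ℤ) - 1)
    (f := fun l => c (k - l) * ξ l ω) h2.injOn, ← Finset.sum_union]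
  · congr 1
    ext l
    simp only [Finset.mem_Icc, Finset.mem_union, Finset.mem_image, Finset.mem_range]
    constructor
    · intro hl
      rcases le_or_gt 0 l with h0 | h0
      · exact Or.inl ⟨l.toNat, by omega, by omega⟩
      · exact Or.inr ⟨(-l - 1).toNat, by omega, by omega⟩
    · rintro (⟨i, hi, rfl⟩ | ⟨i, hi, rfl⟩) <;> omega
  · rw [Finset.disjoint_left]
    intro l hl hl'
    obtain ⟨i, _, rfl⟩ := Finset.mem_image.1 hl
    obtain ⟨j, _, hj⟩ := Finset.mem_image.1 hl'
    omega

theorem ae_tendsto_linearPartialSum (h : Innovations μ ξ s r) {c : ℤ → ℝ}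
    (hc : Summable fun l => c l ^ 2) (k : ℤ) :
    ∀ᵐ ω ∂μ, Tendsto (linearPartialSum c ξ k ω) atTop (𝓝 (linearProcess c ξ k ω)) := by
  have ha : Summable fun l => c (k - l) ^ 2 :=
    hc.comp_injective (i := fun l => k - l) fun x y hxy => by simpa using hxy
  have h1 := h.ae_exists_tendsto_sum ha (e := fun i : ℕ => (i : ℤ)) Nat.cast_injective
  have h2 := h.ae_exists_tendsto_sum ha (e := fun i : ℕ => -(i : ℤ) - 1) fun i j hij => by
    simp only at hij; omega
  filter_upwards [h1, h2] with ω hω1 hω2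
  obtain ⟨x, hx⟩ := hω1
  obtain ⟨y, hy⟩ := hω2
  refine tendsto_nhds_limUnder ⟨x + y, ?_⟩
  have hsum := (((tendsto_add_atTop_iff_nat 1).2 hx).comp
    (tendsto_snd (f := (atTop : Filter ℕ)) (g := (atTop : Filter ℕ)))).add
    (hy.comp (tendsto_fst (f := (atTop : Filter ℕ)) (g := (atTop : Filter ℕ))))
  rw [prod_atTop_atTop_eq] at hsum
  refine hsum.congr fun w => ?_
  rw [linearPartialSum_eq]
  rfl

theorem window_pow_bound (h : Innovations μ ξ s r) {c : ℤ → ℝ}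
    (hc : Summable fun l => c l ^ 2) :
    ∃ K : ℝ, ∀ (k : ℤ) (Λ : Finset ℤ),
      MemLp (fun ω => (∑ l ∈ Λ, c (k - l) * ξ l ω) ^ s) (ENNReal.ofReal r) μ ∧
      lpNorm (fun ω => (∑ l ∈ Λ, c (k - l) * ξ l ω) ^ s) (ENNReal.ofReal r) μ ≤ K := by
  obtain ⟨K, hK1, hK⟩ := h.exists_moment_bound (∑' l, c l ^ 2)
  refine ⟨1 + K, fun k Λ => ?_⟩
  have hL := h.memLp_linear (fun l => c (k - l)) Λ
  obtain ⟨p1, p2⟩ := memLp_pow_of_le h.r_pos h.one_le_s le_rfl hL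
  refine ⟨p1, lpNorm_le_of_integral_le h.one_lt.le p1.1 (by linarith) (p2.trans ?_)⟩
  have := hK (fun l => c (k - l)) Λ (sum_sub_le_tsum hc (fun l => sq_nonneg _) k Λ)
  linarith

theorem ae_tendsto_window (h : Innovations μ ξ s r) {c : ℤ → ℝ}
    (hc : Summable fun l => c l ^ 2) (k : ℤ) :
    ∀ᵐ ω ∂μ, Tendsto (fun N : ℕ => ∑ l ∈ Finset.Icc (-(N : ℤ)) (N : ℤ), c (k - l) * ξ l ω) atTop
      (𝓝 (linearProcess c ξ k ω)) := by
  filter_upwards [h.ae_tendsto_linearPartialSum hc k] with ω hω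
  have h1 : Tendsto (linearPartialSum c ξ k ω ∘ fun N : ℕ => (N, N)) atTop
      (𝓝 (linearProcess c ξ k ω)) := hω.comp tendsto_atTop_diagonal
  simpa only [linearPartialSum, Function.comp_def] using h1

theorem memLp_linearProcess_pow (h : Innovations μ ξ s r) {c : ℤ → ℝ}
    (hc : Summable fun l => c l ^ 2) (k : ℤ) :
    MemLp (fun ω => linearProcess c ξ k ω ^ s) (ENNReal.ofReal r) μ ∧
    Tendsto (fun N : ℕ => ∫ ω, (∑ l ∈ Finset.Icc (-(N : ℤ)) (N : ℤ), c (k - l) * ξ l ω) ^ s ∂μ)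
      atTop (𝓝 (∫ ω, linearProcess c ξ k ω ^ s ∂μ)) := by
  obtain ⟨K, hK⟩ := h.window_pow_bound hc
  have hlim : ∀ᵐ ω ∂μ, Tendsto (fun N : ℕ =>
      (∑ l ∈ Finset.Icc (-(N : ℤ)) (N : ℤ), c (k - l) * ξ l ω) ^ s) atTop
      (𝓝 (linearProcess c ξ k ω ^ s)) := by
    filter_upwards [h.ae_tendsto_window hc k] with ω hω
    exact hω.pow s
  exact ⟨(memLp_lpNorm_le_of_tendsto_ae (fun N => (hK k _).1) (fun N => (hK k _).2) hlim).1,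
    tendsto_integral_of_lpNorm_le h.one_lt (fun N => (hK k _).1) (fun N => (hK k _).2) hlim⟩

/-- The bound for finite sections is uniform, so it survives the limit and feeds the chaining lemma;
`r⁻¹ ≤ β` is what chaining requires. -/
theorem powerMSLLN (h : Innovations μ ξ s r) {c : ℤ → ℝ} {σ ε θ β C p : ℝ} {d : ℕ}
    (hσ : 1 / 2 < σ) (hσ1 : σ ≤ 1) (hC : 0 ≤ C)
    (hc : ∀ l : ℤ, |c l| ≤ C * (1 + |(l : ℝ)|) ^ (-σ)) (hd1 : 1 ≤ d)
    (hd : ∀ (a : ℤ → ℝ) (Λ : Finset ℤ) (i : ℕ), 1 ≤ i → i < d → i ≤ s →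
      PowerSeries.coeff (s - i) (∏ l ∈ Λ, momentSeries μ ξ (a l)) = 0)
    (hε : 0 < ε) (hεσ : ε ≤ 2 * σ - 1) (hθ1 : θ ≤ 1) (hθ : θ ≤ d * (2 * σ - 1 - ε))
    (hβr : r⁻¹ ≤ β) (hβ : 2 + ε - θ ≤ 2 * β) (hp : β < 1 / p) :
    PowerMSLLN μ (linearProcess c ξ) s p := by
  have hsq := summable_sq_of_decay hσ hc
  have hr0 := h.r_pos
  obtain ⟨K, hK0, hK⟩ := h.exists_window_bound hσ hσ1 hC hc hd1 hd hε hεσ hθ1 hθ hβr hβ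
  have hx : ∀ k, MemLp (fun ω => linearProcess c ξ k ω ^ s) (ENNReal.ofReal r) μ := fun k =>
    (h.memLp_linearProcess_pow hsq k).1
  refine ae_tendsto_rpow_mul_sum (r := r) (β := β) (C := K ^ r)
    (y := fun k ω => linearProcess c ξ (k : ℤ) ω ^ s - ∫ ω', linearProcess c ξ (k : ℤ) ω' ^ s ∂μ)
    hr0 ?_ hp (fun k => (hx k).1.aemeasurable.sub_const _) ?_
  · rwa [inv_le_iff_one_le_mul₀ hr0] at hβr
  · intro m n hn
    set T : Finset ℤ := (Finset.Ioc m (m + n)).map Nat.castEmbedding with hT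
    have hTcard : T.card ≤ n := by rw [hT, Finset.card_map, Nat.card_Ioc]; omega
    have hTdist : ∀ k ∈ T, ∀ k' ∈ T, 1 + |((k - k' : ℤ) : ℝ)| ≤ n := by
      intro k hk k' hk'
      obtain ⟨i, hi, rfl⟩ := Finset.mem_map.1 hk
      obtain ⟨j, hj, rfl⟩ := Finset.mem_map.1 hk'
      rw [Finset.mem_Ioc] at hi hj
      simp only [Nat.castEmbedding_apply]
      have : 1 + |(i : ℤ) - (j : ℤ)| ≤ n := by
        rcases abs_cases ((i : ℤ) - (j : ℤ)) with h' | h' <;> omega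
      exact_mod_cast this
    have hlim : ∀ᵐ ω ∂μ, Tendsto (fun N : ℕ => ∑ k ∈ T,
        ((∑ l ∈ Finset.Icc (-(N : ℤ)) (N : ℤ), c (k - l) * ξ l ω) ^ s -
        ∫ ω', (∑ l ∈ Finset.Icc (-(N : ℤ)) (N : ℤ), c (k - l) * ξ l ω') ^ s ∂μ)) atTop
        (𝓝 (∑ k ∈ T, (linearProcess c ξ k ω ^ s - ∫ ω', linearProcess c ξ k ω' ^ s ∂μ))) := by
      filter_upwards [ae_all_iff.2 (h.ae_tendsto_window hsq)] with ω hω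
      exact tendsto_finsetSum _ fun k _ =>
        ((hω k).pow s).sub (h.memLp_linearProcess_pow hsq k).2
    obtain ⟨p1, p2⟩ := memLp_lpNorm_le_of_tendsto_ae
      (fun N => (hK n T _ hn hTcard hTdist).1) (fun N => (hK n T _ hn hTcard hTdist).2) hlim
    have hsum : ∀ ω, ∑ k ∈ Finset.Ioc m (m + n), (linearProcess c ξ (k : ℤ) ω ^ s -
        ∫ ω', linearProcess c ξ (k : ℤ) ω' ^ s ∂μ) =
        ∑ k ∈ T, (linearProcess c ξ k ω ^ s - ∫ ω', linearProcess c ξ k ω' ^ s ∂μ) := fun ω => by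
      rw [hT, Finset.sum_map]; rfl
    simp only [hsum]
    have h1 := eLpNorm_eq_lintegral_rpow_enorm_toReal (μ := μ) (f := fun ω =>
      ∑ k ∈ T, (linearProcess c ξ k ω ^ s - ∫ ω', linearProcess c ξ k ω' ^ s ∂μ))
      (p := ENNReal.ofReal r) (by simpa using hr0) ENNReal.ofReal_ne_top
    rw [ENNReal.toReal_ofReal hr0.le, ← ofReal_lpNorm p1] at h1
    have h2 := congrArg (fun z : ENNReal => z ^ r) h1
    simp only [one_div] at h2
    rw [ENNReal.rpow_inv_rpow hr0.ne', ENNReal.ofReal_rpow_of_nonneg lpNorm_nonneg hr0.le] at h2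
    rw [← h2]
    refine ENNReal.ofReal_le_ofReal ?_
    refine (Real.rpow_le_rpow lpNorm_nonneg p2 hr0.le).trans (le_of_eq ?_)
    rw [Real.mul_rpow hK0 (by positivity), ← Real.rpow_mul (Nat.cast_nonneg n)]

end Innovations

/-! ### Moments from the tail condition. -/

section TailMoments

variable {Ω : Type*} [MeasurableSpace Ω] {μ : Measure Ω} [IsProbabilityMeasure μ]

/-- Summing over dyadic levels of `Y` gives a geometric series of ratio `2 ^ (r - α) < 1`. -/
theorem integrable_rpow_of_tail {Y : Ω → ℝ} (hY : Measurable Y) (hY0 : ∀ ω, 0 ≤ Y ω) {α r C : ℝ}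
    (hr : 0 < r) (hrα : r < α) (hC : ∀ t : ℝ, 1 ≤ t → t ^ α * μ.real {ω | t < Y ω} ≤ C) :
    Integrable (fun ω => Y ω ^ r) μ := by
  set A : ℕ → Set Ω := fun n => {ω | (2 : ℝ) ^ n < Y ω} with hA
  have hAm : ∀ n, MeasurableSet (A n) := fun n => measurableSet_lt measurable_const hY
  have hpt : ∀ ω, ENNReal.ofReal (Y ω ^ r) ≤ ENNReal.ofReal (2 ^ r) +
      ∑' n, ENNReal.ofReal (((2 : ℝ) ^ (n + 2)) ^ r) * (A n).indicator 1 ω := by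
    intro ω
    rcases le_total (Y ω) 2 with h | h
    · exact (ENNReal.ofReal_le_ofReal (Real.rpow_le_rpow (hY0 ω) h hr.le)).trans le_self_add
    · obtain ⟨n, hn1, hn2⟩ := exists_nat_pow_near (show 1 ≤ Y ω by linarith) one_lt_two
      rcases n with _ | n
      · norm_num at hn2; linarith
      -- Dropping one dyadic level turns `2 ^ (n + 1) ≤ Y ω` into the strict inequality of `A n`.
      · have hmem : ω ∈ A n := lt_of_lt_of_le (pow_lt_pow_right₀ one_lt_two (Nat.lt_succ_self n)) hn1
        refine le_trans ?_ le_add_self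
        refine le_trans ?_ (ENNReal.le_tsum n)
        rw [Set.indicator_of_mem hmem, Pi.one_apply, mul_one]
        exact ENNReal.ofReal_le_ofReal (Real.rpow_le_rpow (hY0 ω) hn2.le hr.le)
  have hmeas : ∀ n, AEMeasurable (fun ω => ENNReal.ofReal (((2 : ℝ) ^ (n + 2)) ^ r) *
      (A n).indicator 1 ω) μ := fun n =>
    ((measurable_one.indicator (hAm n)).const_mul _).aemeasurable
  have hterm : ∀ n, ∫⁻ ω, ENNReal.ofReal (((2 : ℝ) ^ (n + 2)) ^ r) * (A n).indicator 1 ω ∂μ ≤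
      ENNReal.ofReal ((2 ^ (2 * r) * C) * ((2 : ℝ) ^ (r - α)) ^ n) := by
    intro n
    rw [lintegral_const_mul _ (measurable_one.indicator (hAm n)), lintegral_indicator_one (hAm n),
      ← ofReal_measureReal, ← ENNReal.ofReal_mul (by positivity)]
    refine ENNReal.ofReal_le_ofReal ?_
    have h1 := hC ((2 : ℝ) ^ n) (one_le_pow₀ one_le_two)
    have h2 : ((2 : ℝ) ^ (n + 2)) ^ r = 2 ^ (2 * r) * ((2 : ℝ) ^ (r - α)) ^ n * ((2 : ℝ) ^ n) ^ α := by
      simp only [← Real.rpow_natCast, ← Real.rpow_mul two_pos.le]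
      rw [← Real.rpow_add two_pos, ← Real.rpow_add two_pos]
      congr 1; push_cast; ring
    rw [h2]
    calc 2 ^ (2 * r) * ((2 : ℝ) ^ (r - α)) ^ n * ((2 : ℝ) ^ n) ^ α * μ.real (A n)
        = 2 ^ (2 * r) * ((2 : ℝ) ^ (r - α)) ^ n * (((2 : ℝ) ^ n) ^ α * μ.real (A n)) := by ring
      _ ≤ 2 ^ (2 * r) * ((2 : ℝ) ^ (r - α)) ^ n * C := by gcongr
      _ = _ := by ring
  refine ⟨(hY.pow_const r).aestronglyMeasurable, ?_⟩
  rw [hasFiniteIntegral_iff_ofReal (ae_of_all _ fun ω => Real.rpow_nonneg (hY0 ω) r)]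
  refine lt_of_le_of_lt (lintegral_mono hpt) ?_
  rw [lintegral_add_left measurable_const, lintegral_tsum hmeas]
  refine ENNReal.add_lt_top.2 ⟨by simp, ?_⟩
  refine lt_of_le_of_lt (ENNReal.tsum_le_tsum hterm) (lt_top_iff_ne_top.2 ?_)
  refine Summable.tsum_ofReal_ne_top ?_
  refine Summable.mul_left _ (summable_geometric_of_lt_one (by positivity) ?_)
  exact Real.rpow_lt_one_of_one_lt_of_neg one_lt_two (by linarith)

end TailMoments

/-! ### Choice of the auxiliary exponents. -/

section Exponents

/-- As `ε` tends to `0`, the lower bound on `2 * β` from the multilinear part tends to `max 1 (2 - d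
(2σ - 1))`, which is below `2 / p`. -/
theorem exists_exponents {σ p r : ℝ} {d : ℕ} (hσ : 1 / 2 < σ) (hp : 0 < p) (hp2 : p < 2)
    (hpr : p < r) (hpd : p * (2 - d * (2 * σ - 1)) < 2) :
    ∃ ε θ β : ℝ, 0 < ε ∧ ε ≤ 2 * σ - 1 ∧ θ ≤ 1 ∧ θ ≤ d * (2 * σ - 1 - ε) ∧ r⁻¹ ≤ β ∧
      2 + ε - θ ≤ 2 * β ∧ β < 1 / p := by
  have h1 : 1 < 2 / p := by rwa [lt_div_iff₀ hp, one_mul]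
  have h2 : 2 - d * (2 * σ - 1) < 2 / p := by rwa [lt_div_iff₀ hp, mul_comm]
  have h3 : 2 / p = 2 * (1 / p) := by ring
  set G := min (2 / p - 1) (2 / p - (2 - d * (2 * σ - 1))) with hG
  have hG0 : 0 < G := lt_min (by linarith) (by linarith)
  have hG1 : G ≤ 2 / p - 1 := min_le_left _ _
  have hG2 : G ≤ 2 / p - (2 - d * (2 * σ - 1)) := min_le_right _ _
  have hd0 : (0 : ℝ) ≤ d := Nat.cast_nonneg d
  -- The loss in `2 * β` is at most `(d + 1) ε`, which is less than the available gap `G`.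
  set ε := min (2 * σ - 1) (G / (d + 2)) with hε
  have hε0 : 0 < ε := lt_min (by linarith) (by positivity)
  have hεG : ε * (d + 2) ≤ G := by
    rw [← le_div_iff₀ (by positivity)]
    exact min_le_right _ _
  refine ⟨ε, min 1 (d * (2 * σ - 1 - ε)), max r⁻¹ ((2 + ε - min 1 (d * (2 * σ - 1 - ε))) / 2), hε0,
    min_le_left _ _, min_le_left _ _, min_le_right _ _, le_max_left _ _, ?_, ?_⟩
  · have := le_max_right r⁻¹ ((2 + ε - min 1 (d * (2 * σ - 1 - ε))) / 2)
    linarith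
  · refine max_lt ?_ ?_
    · rw [one_div]
      exact inv_strictAnti₀ hp hpr
    · have hdε : 0 ≤ d * ε := by positivity
      rcases min_choice 1 (d * (2 * σ - 1 - ε)) with h | h <;> rw [h] <;> nlinarith

end Exponents

/-! ### The main theorem. -/

theorem mainTheorem3 {Ω : Type*} [MeasurableSpace Ω] (μ : Measure Ω) [IsProbabilityMeasure μ]
    (s : ℕ) (hs : 1 ≤ s)
    -- i.i.d. zero-mean innovations
    (ξ : ℤ → Ω → ℝ) (hmeas : ∀ l, Measurable (ξ l)) (hindep : iIndepFun ξ μ)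
    (hident : ∀ l, IdentDistrib (ξ l) (ξ 1) μ μ) (hmean : ∫ ω, ξ 1 ω ∂μ = 0)
    -- finite second moment
    (hreg : MemLp (ξ 1) 2 μ)
    -- tail condition
    (α : ℝ) (hα : 1 < α)
    (htail : ∃ C : ℝ, ∀ t : ℝ, 1 ≤ t → t ^ α * μ.real {ω | t < |ξ 1 ω| ^ s} ≤ C)
    -- decay condition
    (c : ℤ → ℝ) (σ : ℝ) (hσ : 1 / 2 < σ) (hσ' : σ ≤ 1)
    (hdecay : ∃ C : ℝ, ∀ l : ℤ, |(l : ℝ)| ^ σ * |c l| ≤ C) :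
    -- the series that defines the process converges almost surely
    (∀ k : ℤ, ∀ᵐ ω ∂μ,
      Tendsto (linearPartialSum c ξ k ω) atTop (𝓝 (linearProcess c ξ k ω))) ∧
    -- the moments `E[x_k ^ s]` exist
    (∀ k : ℤ, Integrable (fun ω => linearProcess c ξ k ω ^ s) μ) ∧
    -- general innovations; `1 / (2 - 2 * σ)` is read as infinity when `σ = 1`
    (∀ p : ℝ, 0 < p →
      (s = 1 → p < 2 / (3 - 2 * σ)) →
      (s = 2 → p < min 2 α ∧ (σ < 1 → p < 1 / (2 - 2 * σ))) →
      (2 < s → p < min α (2 / (3 - 2 * σ))) →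
      PowerMSLLN μ (linearProcess c ξ) s p) ∧
    -- symmetric innovations and even powers
    (IdentDistrib (fun ω => -ξ 1 ω) (ξ 1) μ μ → Even s →
      ∀ p : ℝ, 0 < p → p < min 2 α → (σ < 1 → p < 1 / (2 - 2 * σ)) →
        PowerMSLLN μ (linearProcess c ξ) s p) := by
  obtain ⟨C, hC0, hC⟩ := exists_decay_bound (by linarith) hdecay
  have hsq := summable_sq_of_decay hσ hC
  -- For `s = 1` the second moment permits `r = 2`, so `α` does not restrict `p`.
  have hinn_one : s = 1 → Innovations μ ξ s 2 := by
    rintro rfl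
    exact ⟨hmeas, hindep, hident, hmean, one_lt_two, le_rfl, by norm_num, by simpa using hreg⟩
  have hinn : ∀ r : ℝ, 1 < r → r ≤ 2 → r < α → 2 ≤ s → Innovations μ ξ s r := by
    intro r hr1 hr2 hrα hs2
    obtain ⟨C', hC'⟩ := htail
    have hs2' : (2 : ℝ) ≤ s := by exact_mod_cast hs2
    refine ⟨hmeas, hindep, hident, hmean, hr1, hr2, by nlinarith, ?_⟩
    rw [memLp_ofReal_iff (by positivity) (hmeas 1).aestronglyMeasurable]
    refine (integrable_rpow_of_tail ((hmeas 1).abs.pow_const s) (fun ω => by positivity)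
      (by linarith : (0 : ℝ) < r) hrα hC').congr (ae_of_all _ fun ω => ?_)
    simp only
    rw [← Real.rpow_natCast, ← Real.rpow_mul (abs_nonneg _)]
  have hex : ∃ r, Innovations μ ξ s r := by
    rcases hs.eq_or_lt with h1 | h1
    · exact ⟨2, hinn_one h1.symm⟩
    · obtain ⟨r, hr1, hr2⟩ := exists_between (lt_min one_lt_two hα)
      exact ⟨r, hinn r hr1 (hr2.trans_le (min_le_left _ _)).le (hr2.trans_le (min_le_right _ _)) h1⟩
  have hσ3 : 0 < 3 - 2 * σ := by linarith
  -- the long memory regime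
  have hlong : ∀ r p : ℝ, Innovations μ ξ s r → 0 < p → p < r → p < 2 / (3 - 2 * σ) →
      PowerMSLLN μ (linearProcess c ξ) s p := by
    intro r p h hp hpr hpσ
    rw [lt_div_iff₀ hσ3] at hpσ
    obtain ⟨ε, θ, β, h1, h2, h3, h4, h5, h6, h7⟩ :=
      exists_exponents (d := 1) hσ hp (by nlinarith) hpr (by push_cast; linarith)
    exact h.powerMSLLN hσ hσ' hC0 hC le_rfl (fun a Λ i hi1 hi2 _ => by omega) h1 h2 h3 h4 h5 h6 h7
  -- the regime without a linear term
  have heven : Even s → (∀ j < s, Odd j → ∫ ω, ξ 1 ω ^ j ∂μ = 0) →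
      ∀ p : ℝ, 0 < p → p < min 2 α → (σ < 1 → p < 1 / (2 - 2 * σ)) →
        PowerMSLLN μ (linearProcess c ξ) s p := by
    intro hse hodd p hp hpα hpσ
    have hs2 : 2 ≤ s := by
      obtain ⟨m, rfl⟩ := hse
      omega
    -- `r` lies strictly between `max 1 p` and `min 2 α`: the moment of order `s * r` is finite and
    -- `1 / r < 1 / p`.
    obtain ⟨r, hr1, hr2⟩ := exists_between (max_lt (lt_min one_lt_two hα) hpα)
    have hr2' := (hr2.trans_le (min_le_left _ _)).le
    have h := hinn r ((le_max_left _ _).trans_lt hr1) hr2' (hr2.trans_le (min_le_right _ _)) hs2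
    -- This reads `p * (4 - 4 * σ) < 2`, which is vacuous at `σ = 1`.
    have hpd : p * (2 - (2 : ℕ) * (2 * σ - 1)) < 2 := by
      rcases hσ'.lt_or_eq with hlt | rfl
      · have := hpσ hlt
        rw [lt_div_iff₀ (by linarith)] at this
        push_cast; linarith
      · norm_num
    obtain ⟨ε, θ, β, h1, h2, h3, h4, h5, h6, h7⟩ :=
      exists_exponents (d := 2) hσ hp (hpα.trans_le (min_le_left _ _))
        ((le_max_right _ _).trans_lt hr1) hpd
    exact h.powerMSLLN hσ hσ' hC0 hC one_le_two
      (Innovations.coeff_momentSeries_eq_zero_of_even hse hodd) h1 h2 h3 h4 h5 h6 h7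
  obtain ⟨r₀, h₀⟩ := hex
  refine ⟨h₀.ae_tendsto_linearPartialSum hsq, fun k => ?_, fun p hp hp1 hp2 hp3 => ?_,
    fun hsymm hse => heven hse fun j _ hj => ?_⟩
  · exact (h₀.memLp_linearProcess_pow hsq k).1.integrable
      (by rw [ENNReal.one_le_ofReal]; exact h₀.one_lt.le)
  · rcases lt_trichotomy s 2 with h2 | h2 | h2
    · have hs1 : s = 1 := by omega
      have hpσ := hp1 hs1
      have hp2' : p < 2 := by
        rw [lt_div_iff₀ hσ3] at hpσ
        nlinarith
      exact hlong 2 p (hinn_one hs1) hp hp2' hpσ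
    · subst h2
      obtain ⟨hpα, hpσ⟩ := hp2 rfl
      refine heven even_two (fun j hj hj' => ?_) p hp hpα hpσ
      -- For `s = 2` the only odd moment below `s` is the mean, so no symmetry is needed.
      obtain rfl : j = 1 := by
        rcases hj' with ⟨m, rfl⟩
        omega
      simpa using hmean
    · have hpm := hp3 h2
      have hpα : p < α := hpm.trans_le (min_le_left _ _)
      have hpσ : p < 2 / (3 - 2 * σ) := hpm.trans_le (min_le_right _ _)
      have hp2' : p < 2 := by
        rw [lt_div_iff₀ hσ3] at hpσ
        nlinarith
      obtain ⟨r, hr1, hr2⟩ := exists_between (max_lt (lt_min one_lt_two hα) (lt_min hp2' hpα))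
      exact hlong r p (hinn r ((le_max_left _ _).trans_lt hr1)
        (hr2.trans_le (min_le_left _ _)).le (hr2.trans_le (min_le_right _ _)) h2.le) hp
        ((le_max_right _ _).trans_lt hr1) hpσ
  · have h1 := (hsymm.comp (u := fun x : ℝ => x ^ j) (by fun_prop)).integral_eq
    simp only [Function.comp_def, hj.neg_pow] at h1
    rw [integral_neg] at h1
    linarith
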